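/- Let $V:\mathbb R^3\to[0,\infty)$ be smooth, symmetric ($V(-x)=V(x)$) and of fast decay (for every $n$, $|x|^nV(x)$ is bounded), and let $1-w$ be its zero-energy scattering solution: $w\in C^2$, $-\Delta(1-w)+V(1-w)=0$, $0\le w<1$, $w(x)\to0$ as $|x|\to\infty$. Put $g=V(1-w)$, $g_p=\int e^{-ip\cdot x}g(x)\,dx$ (so that $g_0=\int g=4\pi a$, with $a$ the scattering length), and $w_p=g_p/|p|^2$ for $p\ne0$. For $\rho>0$ let $L=\rho^{-25/24}$, $\Lambda=[0,L]^3$, $|\Lambda|=L^3$, $\Lambda^*=(\frac{2\pi}L\mathbb Z)^3$, and suppose that $N=\rho|\Lambda|$ is an integer. Let $\eta=1/200$, $\varepsilon_L=\eta_L=\varepsilon_H=\rho^\eta$, $m_c=\rho^{-\eta}$, and define subsets of $\Lambda^*$ by $P_0=\{0\}$, $P_L=\{\varepsilon_L\rho^{1/2}\le|p|\le\eta_L^{-1}\rho^{1/2}\}$, $P_I=\{\eta_L^{-1}\rho^{1/2}<|p|\le\varepsilon_H\}$, $P_H=\{\varepsilon_H<|p|\}$, $P=P_0\cup P_L\cup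 P_I\cup P_H$. Let $\widetilde M$ be the set of $\alpha:P\to\{0,1,2,\dots\}$ with $\sum_k\alpha(k)=N$, and let $|\alpha\rangle$ be the normalized $N$-boson state with occupation numbers $\alpha$. For $k\ne0$, $\mathcal A^k\alpha$ arises from $\alpha$ by replacing two particles of momentum $0$ by particles of momenta $k$ and $-k$; for $u\in P_L$ and $\pm k+u/2\in P_H$, $\mathcal A^{u,k}\alpha$ arises from $\alpha$ by replacing one particle of momentum $0$ and one of momentum $u$ by particles of momenta $k+u/2$ and $-k+u/2$. Fix $k_c>0$. Let $M\subset\widetilde M$ be the smallest set such that: (1) $\alpha_{free}=N\delta_{0,\cdot}\in M$; (2) if $\alpha\in M$, $u\in P_I\cup P_H$ and $\mathcal A^u\alpha\in\widetilde M$, then $\mathcal A^u\alpha\in M$; (3) if $\alpha\in M$, $u\in P_L$, $\max\{\alpha(u),\alpha(-u)\}<m_c$ and $\mathcal A^u\alpha\in\widetilde M$, then $\mathcal A^u\alpha\in M$; (4) if $\alpha\in M$, $u\in P_L$, $\alpha(u)=\alpha(-u)$, $\mathcal A^{u,k}\alpha\in\widetilde M$ and $\varepsilon_H\le|\pm k+u/2|\le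 k_c$, then $\mathcal A^{u,k}\alpha\in M$. Let $$\lambda_k=\frac{1-\sqrt{1+4\rho g_0|k|^{-2}}}{1+\sqrt{1+4\rho g_0|k|^{-2}}}\,\rho^{-1}\quad(k\in P_L),\qquad \lambda_k=-w_k\quad(k\in P_I\cup P_H),$$ let $\alpha^*(u)=\max\{\alpha(u),\alpha(-u)\}$, and define $\Psi=\sum_{\alpha\in M}f(\alpha)|\alpha\rangle$ with $$f(\alpha)=C_N\sqrt{\frac{|\Lambda|^{\alpha(0)}}{\alpha(0)!}}\ \prod_{k\ne0}\bigl(\sqrt{\lambda_k}\bigr)^{\alpha(k)}\prod_{u\in P_L,\ \alpha^*(u)-\alpha(u)=1}\sqrt{\frac{4\alpha^*(u)\lambda_u}{|\Lambda|}},$$ where $\sqrt x=i\sqrt{|x|}$ for $x<0$ and $C_N>0$ is the constant with $\langle\Psi|\Psi\rangle=1$. Let $$Q_\Psi(u_1,\dots,u_s)=\Bigl\langle\prod_{i}a^\dagger_{u_i}a_{u_i}\Bigr\rangle_\Psi=\sum_{\alpha\in M}\prod_i\alpha(u_i)\,|f(\alpha)|^2 ,\qquad \rho_0=\rho-\frac1{3\pi^2}\,g_0^{3/2}\rho^{3/2}.$$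 Then for every $\varepsilon>0$ there is $\rho_1>0$, depending only on $V$ (with $w$), $k_c$ and $\varepsilon$, such that for all $0<\rho<\rho_1$ for which $N=\rho|\Lambda|$ is an integer, the state $\Psi$ is well defined (the sum of the squared moduli of its coefficients before normalization is finite and positive), and $$|\Lambda|\,(\rho_0-\varepsilon\rho^{3/2})\le Q_\Psi(0)\le|\Lambda|\,(\rho_0+\varepsilon\rho^{3/2}),$$ $$\bigl(|\Lambda|\,(\rho_0-\varepsilon\rho^{3/2})\bigr)^2\le Q_\Psi(0,0)\le\bigl(|\Lambda|\,(\rho_0+\varepsilon\rho^{3/2})\bigr)^2 .$$ -/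

import Mathlib

open MeasureTheory Filter Topology

noncomputable section

namespace BoseGas

/-- Physical space, and also momentum space. -/
abbrev Space : Type := EuclideanSpace ℝ (Fin 3)

/-! ### The potential and its zero-energy scattering solution -/

/-- A smooth, symmetric, nonnegative potential of fast decay. -/
structure IsPotential (V : Space → ℝ) : Prop where
  smooth : ContDiff ℝ (⊤ : ℕ∞) V
  symm : ∀ x, V (-x) = V x
  nonneg : ∀ x, 0 ≤ V x
  decay : ∀ n : ℕ, ∃ C : ℝ, ∀ x, ‖x‖ ^ n * V x ≤ C

/-- `1 - w` is the zero-energy scattering solution of `V`: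
`-Δ(1 - w) + V (1 - w) = 0`, `0 ≤ w < 1`, and `w x → 0` as `|x| → ∞`. -/
structure IsScatteringSolution (V w : Space → ℝ) : Prop where
  contDiff : ContDiff ℝ 2 w
  equation : ∀ x,
    -(Laplacian.laplacian (fun y => 1 - w y) x) + V x * (1 - w x) = 0
  nonneg : ∀ x, 0 ≤ w x
  lt_one : ∀ x, w x < 1
  tendsto_zero : Tendsto w (cocompact Space) (𝓝 0)

/-- The scattering length `a = (4π)⁻¹ ∫ V (1 - w)`. -/
def scatteringLength (V w : Space → ℝ) : ℝ :=
  1 / (4 * Real.pi) * ∫ x, V x * (1 - w x)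

/-- `g₀ = 4πa`. -/
def g0 (V w : Space → ℝ) : ℝ := 4 * Real.pi * scatteringLength V w

/-- The Fourier transform `W_p = ∫ e^{-ip·x} W(x) dx`. -/
def fourier (W : Space → ℝ) (p : Space) : ℂ :=
  ∫ x, Complex.exp (-(Complex.I * ((inner ℝ p x : ℝ) : ℂ))) * ((W x : ℝ) : ℂ)

/-- `w_p` for `p ≠ 0`, through the scattering equation in momentum space `p² w_p = g_p`, where
`g = V (1 - w)`. (`w` itself decays only like `1/|x|`, so `∫ e^{-ip·x} w(x) dx` does not converge
absolutely.) As `g` is even and real, `g_p` is real. -/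
def wHat (V w : Space → ℝ) (p : Space) : ℝ :=
  (fourier (fun x => V x * (1 - w x)) p).re / ‖p‖ ^ 2

/-! ### The box, the momentum lattice and its regions -/

/-- The side length `L = ρ^{-25/24}`. -/
def boxLength (ρ : ℝ) : ℝ := ρ ^ (-(25 / 24) : ℝ)

/-- The volume `|Λ| = L³`. -/
def boxVolume (ρ : ℝ) : ℝ := boxLength ρ ^ 3

/-- Labels `n ∈ ℤ³` of the momenta `p = 2πn/L` in `Λ* = ((2π/L)ℤ)³`. -/
abbrev Mode : Type := Fin 3 → ℤ

/-- The momentum `2πn/L` with label `n`. -/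
def momentum (ρ : ℝ) (n : Mode) : Space :=
  (2 * Real.pi / boxLength ρ) • WithLp.toLp 2 (fun i => (n i : ℝ))

/-- The exponent `η = 1/200`. -/
def eta : ℝ := 1 / 200

/-- `ε_L = ρ^η`. -/
def epsL (ρ : ℝ) : ℝ := ρ ^ eta

/-- `η_L = ρ^η`. -/
def etaL (ρ : ℝ) : ℝ := ρ ^ eta

/-- `ε_H = ρ^η`. -/
def epsH (ρ : ℝ) : ℝ := ρ ^ eta

/-- `m_c = ρ^{-η}`. -/
def mCut (ρ : ℝ) : ℝ := ρ ^ (-eta)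

/-- The condensate `P_0`. -/
def P0 : Set Mode := {0}

/-- The low momenta `P_L`. -/
def PL (ρ : ℝ) : Set Mode :=
  {n | epsL ρ * ρ ^ (1 / 2 : ℝ) ≤ ‖momentum ρ n‖ ∧
    ‖momentum ρ n‖ ≤ (etaL ρ)⁻¹ * ρ ^ (1 / 2 : ℝ)}

/-- The intermediate momenta `P_I`. -/
def PI (ρ : ℝ) : Set Mode :=
  {n | (etaL ρ)⁻¹ * ρ ^ (1 / 2 : ℝ) < ‖momentum ρ n‖ ∧ ‖momentum ρ n‖ ≤ epsH ρ}

/-- The high momenta `P_H`. -/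
def PH (ρ : ℝ) : Set Mode := {n | epsH ρ < ‖momentum ρ n‖}

/-- `P = P_0 ∪ P_L ∪ P_I ∪ P_H`. -/
def PAll (ρ : ℝ) : Set Mode := P0 ∪ PL ρ ∪ PI ρ ∪ PH ρ

/-! ### Occupation numbers and the set `M` -/

/-- Occupation numbers: finitely supported functions from momenta to `ℕ`. The function `α` labels
the normalized state `|α⟩ = C ∏ (a†_k)^{α(k)} |0⟩`; these states are orthonormal. -/
abbrev Occ : Type := Mode →₀ ℕ

/-- The set of all `α : P → ℕ` (extended by zero to `Λ*`) with `∑ α(k) = N`. -/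
def AllConfig (ρ : ℝ) (N : ℕ) : Set Occ :=
  {α | (∀ k ∈ α.support, k ∈ PAll ρ) ∧ ∑ k ∈ α.support, α k = N}

/-- `β = 𝒜^k α`: two particles are moved from momentum `0` to the momenta `k` and `-k`. -/
def IsStrictPair (k : Mode) (α β : Occ) : Prop :=
  k ≠ 0 ∧ β + Finsupp.single 0 2 = α + Finsupp.single k 1 + Finsupp.single (-k) 1

/-- `β = 𝒜^{u,k} α`, where `p = k + u/2` and `q = -k + u/2` (so `p + q = u`): one particle of
momentum `0` and one of momentum `u ∈ P_L` are replaced by particles of momenta `p, q ∈ P_H`. -/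
def IsSoftPair (ρ : ℝ) (u p q : Mode) (α β : Occ) : Prop :=
  u ∈ PL ρ ∧ p ∈ PH ρ ∧ q ∈ PH ρ ∧ p + q = u ∧
    β + Finsupp.single 0 1 + Finsupp.single u 1 =
      α + Finsupp.single p 1 + Finsupp.single q 1

/-- The smallest set `M` of configurations that contains `α_free` and is closed under the allowed
strict and soft pair creations. -/
inductive InM (ρ kc : ℝ) (N : ℕ) : Occ → Prop
  | free : InM ρ kc N (Finsupp.single 0 N)
  | strict_high {α β : Occ} {u : Mode} : InM ρ kc N α → u ∈ PI ρ ∪ PH ρ →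
      IsStrictPair u α β → β ∈ AllConfig ρ N → InM ρ kc N β
  | strict_low {α β : Occ} {u : Mode} : InM ρ kc N α → u ∈ PL ρ →
      ((max (α u) (α (-u)) : ℕ) : ℝ) < mCut ρ →
      IsStrictPair u α β → β ∈ AllConfig ρ N → InM ρ kc N β
  | soft {α β : Occ} {u p q : Mode} : InM ρ kc N α → u ∈ PL ρ → α u = α (-u) →
      IsSoftPair ρ u p q α β →
      epsH ρ ≤ ‖momentum ρ p‖ → ‖momentum ρ p‖ ≤ kc →
      epsH ρ ≤ ‖momentum ρ q‖ → ‖momentum ρ q‖ ≤ kc →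
      β ∈ AllConfig ρ N → InM ρ kc N β

/-! ### The trial state -/

open Classical in
/-- The coefficients `λ_k` (used for `k ≠ 0` only). -/
def lam (V w : Space → ℝ) (ρ : ℝ) (k : Mode) : ℝ :=
  if k ∈ PL ρ then
    (1 - Real.sqrt (1 + 4 * ρ * g0 V w / ‖momentum ρ k‖ ^ 2)) /
      (1 + Real.sqrt (1 + 4 * ρ * g0 V w / ‖momentum ρ k‖ ^ 2)) * ρ⁻¹
  else -wHat V w (momentum ρ k)

/-- The square root with the convention `√x = √|x| i` for `x < 0`. -/
def csqrt (x : ℝ) : ℂ :=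
  if x < 0 then (Real.sqrt |x| : ℂ) * Complex.I else (Real.sqrt x : ℂ)

/-- `α*(u) = max (α(u), α(-u))`. -/
def occMax (α : Occ) (u : Mode) : ℕ := max (α u) (α (-u))

open Classical in
/-- The finite set of `u ∈ P_L` with `α*(u) - α(u) = 1` (so that `-u` is occupied). -/
def asymModes (ρ : ℝ) (α : Occ) : Finset Mode :=
  (α.support.image (fun k => -k)).filter (fun u => u ∈ PL ρ ∧ occMax α u = α u + 1)

/-- The coefficient `f(α)` without the normalization constant. -/
def rawCoeff (V w : Space → ℝ) (ρ : ℝ) (α : Occ) : ℂ :=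
  (Real.sqrt (boxVolume ρ ^ (α 0) / (Nat.factorial (α 0) : ℝ)) : ℂ) *
    (∏ k ∈ α.support.erase 0, csqrt (lam V w ρ k) ^ (α k)) *
    ∏ u ∈ asymModes ρ α, csqrt (4 * (occMax α u : ℝ) * lam V w ρ u / boxVolume ρ)

open Classical in
/-- The coefficient without the normalization constant, extended by zero outside `M`. -/
def rawState (V w : Space → ℝ) (ρ kc : ℝ) (N : ℕ) (α : Occ) : ℂ :=
  if InM ρ kc N α then rawCoeff V w ρ α else 0

/-- The normalization constant `C_N`. -/
def normConst (V w : Space → ℝ) (ρ kc : ℝ) (N : ℕ) : ℝ :=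
  1 / Real.sqrt (∑' α : Occ, ‖rawState V w ρ kc N α‖ ^ 2)

/-- The coefficients `f(α) = ⟨α|Ψ⟩` of the trial state `Ψ = ∑_{α ∈ M} f(α) |α⟩`. -/
def trialState (V w : Space → ℝ) (ρ kc : ℝ) (N : ℕ) (α : Occ) : ℂ :=
  (normConst V w ρ kc N : ℂ) * rawState V w ρ kc N α

/-- For a state `Ψ = ∑ f(α) |α⟩`, the expectation of a product of particle numbers:
`Q_Ψ(u₁, …, u_s) = ⟨∏ a†_{u_i} a_{u_i}⟩_Ψ = ∑ ∏ α(u_i) |f(α)|²`. -/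
def Q (f : Occ → ℂ) (us : List Mode) : ℝ :=
  ∑' α : Occ, (us.map (fun u => (α u : ℝ))).prod * ‖f α‖ ^ 2

/-- `ρ_0 = ρ - (3π²)⁻¹ g₀^{3/2} ρ^{3/2}`. -/
def rho0 (V w : Space → ℝ) (ρ : ℝ) : ℝ :=
  ρ - 1 / (3 * Real.pi ^ 2) * g0 V w ^ (3 / 2 : ℝ) * ρ ^ (3 / 2 : ℝ)

end BoseGas

end

/-! The squared coefficients form a probability measure on `M`, and everything follows from how they
change under one pair creation. A strict pair at a symmetric mode `u ∈ P_L` multiplies the weight by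
`x α(0)(α(0)-1)/N²` with `x = (ρ λ_u)²`. As long as few particles leave the condensate, the
occupation of `u` is therefore nearly geometric, with mean `x/(1-x) = bogF`. In units of `√ρ` the
momenta form a lattice of spacing `h = 2π ρ^{13/24}`, and `h³ ∑ bogF` is a Riemann sum for `π
(4g₀)^{3/2}/3` (`integral_bogF_norm`, `tendsto_low_sum`). Since `h³ |Λ| ρ^{3/2} = (2π)³`, the number
of excited particles is `|Λ| g₀^{3/2} ρ^{3/2}/(3π²)` to leading order.

The set `M` is not a product, but only removal of pairs is needed. Pair creations commute, so a
suitable earlier one can be treated as the last without leaving `M` (`InM.exists_strict_part`,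
`InM.exists_soft_removal`, `InM.exists_low_removal`). With `tsum_le_of_transfer` this turns weight
ratios into inequalities between expectations. A low mode with symmetric mean `T` satisfies `T ≤ x
(T + 1)` (`symOcc_le`), and the reverse holds up to small errors by creating a pair (`le_symOcc`).
Particles outside `P_0 ∪ P_L` are controlled by an absorption argument (`expect_occIn_le`). Every
soft pair marks one asymmetric low mode; a given mode is asymmetric with probability `O(ρ^{1/2})`,
while `P_L` has only `O(h⁻³ ρ^{-5η})` elements, so soft pairs are negligible.

For `Q(0,0)` the lower bound is Jensen's inequality. The upper bound needs the second moment of `N -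
α(0)` to be small against `N |Λ| ρ^{3/2}`: the low modes are bounded deterministically by the
cutoff, and the other excited particles number at most `N` and have small mean. -/

noncomputable section

namespace BoseGas

/-! ### The Bogoliubov occupation profile -/

/-- The dimensionless dispersion factor `√(1 + c / r²)`. -/
def bogS (c r : ℝ) : ℝ := Real.sqrt (1 + c / r ^ 2)

/-- The ratio of the weights of two consecutive occupation numbers of a low mode. -/
def bogX (c r : ℝ) : ℝ := ((bogS c r - 1) / (bogS c r + 1)) ^ 2

/-- The mean occupation number `x / (1 - x)` of a low mode. -/
def bogF (c r : ℝ) : ℝ := (bogS c r - 1) ^ 2 / (4 * bogS c r)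

lemma one_le_bogS {c : ℝ} (hc : 0 ≤ c) (r : ℝ) : 1 ≤ bogS c r := by
  rw [bogS, Real.one_le_sqrt]
  have : 0 ≤ c / r ^ 2 := by positivity
  linarith

lemma bogX_nonneg (c r : ℝ) : 0 ≤ bogX c r := sq_nonneg _

lemma bogX_lt_one {c : ℝ} (hc : 0 ≤ c) (r : ℝ) : bogX c r < 1 := by
  have h := one_le_bogS hc r
  have h1 : (bogS c r - 1) / (bogS c r + 1) < 1 := by
    rw [div_lt_one (by linarith)]; linarith
  have h0 : 0 ≤ (bogS c r - 1) / (bogS c r + 1) := div_nonneg (by linarith) (by linarith)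
  rw [bogX]
  nlinarith

lemma bogF_nonneg {c : ℝ} (hc : 0 ≤ c) (r : ℝ) : 0 ≤ bogF c r := by
  have := one_le_bogS hc r
  rw [bogF]; positivity

lemma bogF_eq {c : ℝ} (hc : 0 ≤ c) (r : ℝ) : bogX c r = bogF c r * (1 - bogX c r) := by
  have := one_le_bogS hc r
  have h1 : bogS c r + 1 ≠ 0 := by positivity
  have h2 : bogS c r ≠ 0 := by positivity
  rw [bogX, bogF]
  field_simp
  ring

/-- The product equals `4 s² / (s + 1)²`. This bounds `1 / (1 - x)` by `s`, the price of solving `T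
(1 - x) ≥ x - err` for `T`. -/
lemma one_le_bogS_mul {c : ℝ} (hc : 0 ≤ c) (r : ℝ) : 1 ≤ bogS c r * (1 - bogX c r) := by
  have := one_le_bogS hc r
  have h : bogS c r * (1 - bogX c r) = 4 * bogS c r ^ 2 / (bogS c r + 1) ^ 2 := by
    rw [bogX]; field_simp; ring
  rw [h, le_div_iff₀ (by positivity)]
  nlinarith

lemma bogS_anti {c r r' : ℝ} (hc : 0 ≤ c) (hr : 0 < r) (h : r ≤ r') : bogS c r' ≤ bogS c r := by
  rw [bogS, bogS]
  gcongr

lemma bogF_anti {c r r' : ℝ} (hc : 0 ≤ c) (hr : 0 < r) (h : r ≤ r') : bogF c r' ≤ bogF c r := by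
  have h1 := bogS_anti hc hr h
  have h2 := one_le_bogS hc r'
  rw [bogF, bogF, div_le_div_iff₀ (by linarith) (by linarith)]
  nlinarith [mul_nonneg (sub_nonneg.2 h1) (sub_nonneg.2 (by nlinarith : 1 ≤ bogS c r * bogS c r'))]

lemma bogX_anti {c r r' : ℝ} (hc : 0 ≤ c) (hr : 0 < r) (h : r ≤ r') : bogX c r' ≤ bogX c r := by
  have h1 := bogS_anti hc hr h
  have h2 := one_le_bogS hc r'
  rw [bogX, bogX]
  have h0 : 0 ≤ (bogS c r' - 1) / (bogS c r' + 1) := div_nonneg (by linarith) (by linarith)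
  refine pow_le_pow_left₀ h0 ?_ 2
  rw [div_le_div_iff₀ (by linarith) (by linarith)]
  nlinarith

lemma bogS_le {c r : ℝ} (hc : 0 ≤ c) (hr : 0 < r) : bogS c r ≤ 1 + Real.sqrt c / r := by
  rw [bogS]
  refine Real.sqrt_le_iff.2 ⟨by positivity, ?_⟩
  have : (1 + Real.sqrt c / r) ^ 2 = 1 + c / r ^ 2 + 2 * (Real.sqrt c / r) := by
    have := Real.sq_sqrt hc
    field_simp
    rw [add_sq, this]; ring
  rw [this]
  have : 0 ≤ Real.sqrt c / r := by positivity
  linarith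

lemma continuousOn_bogS (c : ℝ) : ContinuousOn (bogS c) (Set.Ioi 0) := by
  unfold bogS
  refine ContinuousOn.sqrt (continuousOn_const.add (continuousOn_const.div (by fun_prop) ?_))
  intro x hx
  exact pow_ne_zero _ (ne_of_gt hx)

lemma continuousOn_bogF {c : ℝ} (hc : 0 ≤ c) : ContinuousOn (bogF c) (Set.Ioi 0) := by
  unfold bogF
  have := continuousOn_bogS c
  refine ContinuousOn.div (by fun_prop) (by fun_prop) ?_
  intro x hx
  have := one_le_bogS hc x
  positivity

/-- An antiderivative of `r² F(r)`. -/
def bogPrim (c r : ℝ) : ℝ :=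
  (2 / 3 * Real.sqrt (r ^ 2 + c) ^ 3 - c * Real.sqrt (r ^ 2 + c) - 2 / 3 * r ^ 3) / 4

lemma hasDerivAt_bogPrim {c r : ℝ} (hc : 0 ≤ c) (hr : 0 < r) :
    HasDerivAt (bogPrim c) (r ^ 2 * bogF c r) r := by
  have hpos : 0 < r ^ 2 + c := by positivity
  have hq : HasDerivAt (fun r : ℝ => Real.sqrt (r ^ 2 + c)) (2 * r / (2 * Real.sqrt (r ^ 2 + c))) r := by
    refine HasDerivAt.sqrt ?_ hpos.ne'
    simpa using (hasDerivAt_pow 2 r).add_const c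
  have hd := ((((hq.pow 3).const_mul (2 / 3)).sub (hq.const_mul c)).sub
    ((hasDerivAt_pow 3 r).const_mul (2 / 3))).div_const 4
  refine hd.congr_deriv ?_
  have hs : bogS c r = Real.sqrt (r ^ 2 + c) / r := by
    rw [bogS, show 1 + c / r ^ 2 = (r ^ 2 + c) / r ^ 2 by field_simp, Real.sqrt_div hpos.le,
      Real.sqrt_sq hr.le]
  have hsq := Real.sq_sqrt hpos.le
  have hq0 : 0 < Real.sqrt (r ^ 2 + c) := Real.sqrt_pos.2 hpos
  rw [bogF, hs]
  set q := Real.sqrt (r ^ 2 + c)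
  have hcq : c = q ^ 2 - r ^ 2 := by linarith
  rw [hcq]
  norm_num
  field_simp
  ring

lemma tendsto_bogPrim {c : ℝ} (hc : 0 ≤ c) : Tendsto (bogPrim c) atTop (𝓝 0) := by
  have hlim : Tendsto (fun r : ℝ => c ^ 2 / 6 * r⁻¹) atTop (𝓝 0) := by
    have := tendsto_inv_atTop_zero.const_mul (b := c ^ 2 / 6)
    rwa [mul_zero] at this
  refine squeeze_zero_norm' ?_ hlim
  filter_upwards [eventually_gt_atTop 0] with r hr
  have hpos : 0 < r ^ 2 + c := by positivity
  have hsq := Real.sq_sqrt hpos.le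
  have hq0 : 0 < Real.sqrt (r ^ 2 + c) := Real.sqrt_pos.2 hpos
  have hqr : r ≤ Real.sqrt (r ^ 2 + c) := Real.le_sqrt_of_sq_le (by linarith)
  rw [bogPrim]
  set q := Real.sqrt (r ^ 2 + c)
  have hcq : c = (q - r) * (q + r) := by linarith [hsq, (by ring : (q - r) * (q + r) = q ^ 2 - r ^ 2)]
  -- With `c = (q - r)(q + r)` the cubic terms cancel explicitly, and what remains is `O(c² / r)`.
  have e : (2 / 3 * q ^ 3 - c * q - 2 / 3 * r ^ 3) / 4 = - ((q - r) ^ 2 * (q + 2 * r) / 12) := by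
    rw [hcq]; ring
  rw [e, norm_neg, Real.norm_of_nonneg (by have := sq_nonneg (q - r); positivity)]
  have h1 : c ^ 2 / 6 * r⁻¹ = (q - r) ^ 2 * ((q + r) ^ 2 / (6 * r)) := by
    rw [hcq]; field_simp
  rw [h1, mul_div_assoc]
  refine mul_le_mul_of_nonneg_left ?_ (sq_nonneg _)
  rw [div_le_div_iff₀ (by norm_num) (by positivity)]
  nlinarith

lemma continuous_bogPrim (c : ℝ) : Continuous (bogPrim c) := by unfold bogPrim; fun_prop

lemma bogF_radial {c : ℝ} (hc : 0 ≤ c) :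
    IntegrableOn (fun r => r ^ 2 * bogF c r) (Set.Ioi 0) ∧
      ∫ r in Set.Ioi 0, r ^ 2 * bogF c r = c ^ (3 / 2 : ℝ) / 12 := by
  have hd : ∀ r ∈ Set.Ioi (0 : ℝ), HasDerivAt (bogPrim c) (r ^ 2 * bogF c r) r :=
    fun r hr => hasDerivAt_bogPrim hc hr
  have hn : ∀ r ∈ Set.Ioi (0 : ℝ), 0 ≤ r ^ 2 * bogF c r :=
    fun r _ => mul_nonneg (sq_nonneg _) (bogF_nonneg hc r)
  have hcont := (continuous_bogPrim c).continuousWithinAt (s := Set.Ici 0) (x := 0)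
  refine ⟨integrableOn_Ioi_deriv_of_nonneg hcont hd hn (tendsto_bogPrim hc), ?_⟩
  rw [integral_Ioi_of_hasDerivAt_of_nonneg hcont hd hn (tendsto_bogPrim hc)]
  have h3 : c ^ (3 / 2 : ℝ) = Real.sqrt c ^ 3 := by
    rw [Real.sqrt_eq_rpow, ← Real.rpow_natCast, ← Real.rpow_mul hc]; norm_num
  have hsq := Real.sq_sqrt hc
  -- Only the lower limit contributes: `bogPrim c 0 = -c^{3/2} / 12`.
  rw [h3, bogPrim]
  norm_num
  have : Real.sqrt c ^ 3 = c * Real.sqrt c := by rw [pow_succ, hsq]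
  rw [this]; ring

lemma integrable_bogF_norm {c : ℝ} (hc : 0 ≤ c) :
    Integrable (fun y : Space => bogF c ‖y‖) := by
  have := (integrable_fun_norm_addHaar (E := Space) volume (f := bogF c)).2
  refine this ?_
  simpa using (bogF_radial hc).1

lemma integral_bogF_norm {c : ℝ} (hc : 0 ≤ c) :
    ∫ y : Space, bogF c ‖y‖ = Real.pi * c ^ (3 / 2 : ℝ) / 3 := by
  rw [integral_fun_norm_addHaar (E := Space) volume (bogF c)]
  have hv : (volume : Measure Space).real (Metric.ball 0 1) = Real.pi * 4 / 3 := by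
    rw [Measure.real, EuclideanSpace.volume_ball_fin_three]
    simp [Real.pi_pos.le, div_nonneg]
  have h := (bogF_radial hc).2
  simp only [finrank_euclideanSpace, Fintype.card_fin, smul_eq_mul, nsmul_eq_mul, hv]
  norm_num at h ⊢
  rw [h]; ring

/-! ### Lattice sums as integrals -/

/-- The point of the unit lattice with label `n`. -/
def latt (n : Mode) : Space := WithLp.toLp 2 (fun i => (n i : ℝ))

/-- The label of the unit cell that contains a point. -/
def floorMode (y : Space) : Mode := fun i => ⌊y i⌋

lemma measurable_floorMode : Measurable floorMode := by
  unfold floorMode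
  refine measurable_pi_lambda _ fun i => Int.measurable_floor.comp ?_
  fun_prop

/-- Every unit cell has volume one. Hence a sum over the lattice is the integral of a step function,
and Riemann sums become a matter of dominated convergence. -/
lemma map_floorMode : (volume : Measure Space).map floorMode = Measure.count := by
  refine Measure.ext_of_singleton fun n => ?_
  rw [Measure.map_apply measurable_floorMode (measurableSet_singleton n), Measure.count_singleton]
  have h := (PiLp.volume_preserving_ofLp (Fin 3)).measure_preimage
    (s := Set.pi Set.univ fun i => Set.Ico (n i : ℝ) (n i + 1))
    (MeasurableSet.univ_pi fun i => measurableSet_Ico).nullMeasurableSet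
  have e : floorMode ⁻¹' {n} =
      WithLp.ofLp ⁻¹' (Set.pi Set.univ fun i => Set.Ico (n i : ℝ) (n i + 1)) := by
    ext y
    simp [floorMode, funext_iff, Int.floor_eq_iff]
  rw [e, h, volume_pi_pi]
  simp

lemma summable_of_integrable_floorMode {f : Mode → ℝ}
    (hf : Integrable fun z : Space => f (floorMode z)) : Summable f := by
  have : Integrable f (Measure.count : Measure Mode) := by
    rw [← map_floorMode, integrable_map_measure (measurable_of_countable f).aestronglyMeasurable
      measurable_floorMode.aemeasurable]
    exact hf
  exact (integrable_count_iff.1 this).of_norm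

lemma tsum_eq_integral_floorMode {f : Mode → ℝ} (hf : Summable f) :
    ∑' n, f n = ∫ z : Space, f (floorMode z) := by
  have hi : Integrable f (Measure.count : Measure Mode) := integrable_count_iff.2 hf.norm
  rw [← integral_map measurable_floorMode.aemeasurable
    (measurable_of_countable f).aestronglyMeasurable, map_floorMode, integral_countable hi]
  simp [Measure.real]

lemma measurable_comp_floorMode (f : Mode → ℝ) (h : ℝ) :
    Measurable fun y : Space => f (floorMode (h⁻¹ • y)) :=
  (measurable_of_countable f).comp (measurable_floorMode.comp (measurable_const_smul h⁻¹))

lemma summable_of_bound {f : Mode → ℝ} {h : ℝ} (hh : 0 < h) {bound : Space → ℝ}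
    (hb : Integrable bound) (hf : ∀ y, |f (floorMode (h⁻¹ • y))| ≤ bound y) :
    Summable f ∧ h ^ 3 * ∑' n, f n = ∫ y : Space, f (floorMode (h⁻¹ • y)) := by
  have hi : Integrable fun y : Space => f (floorMode (h⁻¹ • y)) :=
    hb.mono' (measurable_comp_floorMode f h).aestronglyMeasurable (ae_of_all _ hf)
  have hs : Summable f := by
    apply summable_of_integrable_floorMode
    exact (integrable_comp_smul_iff volume (fun z : Space => f (floorMode z))
      (inv_ne_zero hh.ne')).1 hi
  refine ⟨hs, ?_⟩
  rw [tsum_eq_integral_floorMode hs,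
    Measure.integral_comp_smul volume (fun z : Space => f (floorMode z))]
  simp [abs_of_pos hh]

/-- A cell of side `h` has diagonal `√3 h`, rounded up to `2 h`. -/
lemma norm_latt_floorMode_sub_le {h : ℝ} (hh : 0 < h) (y : Space) :
    ‖h • latt (floorMode (h⁻¹ • y)) - y‖ ≤ 2 * h := by
  have hc : ∀ i, |(h • latt (floorMode (h⁻¹ • y)) - y) i| ≤ h := by
    intro i
    have e : (h • latt (floorMode (h⁻¹ • y)) - y) i = - (h * Int.fract (h⁻¹ * y i)) := by
      simp only [latt, floorMode, PiLp.sub_apply, PiLp.smul_apply, smul_eq_mul, Int.fract]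
      field_simp
      ring
    rw [e, abs_neg, abs_mul, abs_of_pos hh, abs_of_nonneg (Int.fract_nonneg _)]
    exact mul_le_of_le_one_right hh.le (Int.fract_lt_one _).le
  rw [EuclideanSpace.norm_eq]
  refine Real.sqrt_le_iff.2 ⟨by positivity, ?_⟩
  simp only [Real.norm_eq_abs, sq_abs, Fin.sum_univ_three]
  have h2 : ∀ i, ((h • latt (floorMode (h⁻¹ • y)) - y) i) ^ 2 ≤ h ^ 2 := fun i =>
    sq_le_sq' (abs_le.1 (hc i)).1 (abs_le.1 (hc i)).2
  nlinarith [h2 0, h2 1, h2 2]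

lemma abs_norm_latt_sub_le {h : ℝ} (hh : 0 < h) (y : Space) :
    |h * ‖latt (floorMode (h⁻¹ • y))‖ - ‖y‖| ≤ 2 * h := by
  have := abs_norm_sub_norm_le (h • latt (floorMode (h⁻¹ • y))) y
  rw [norm_smul, Real.norm_of_nonneg hh.le] at this
  exact this.trans (norm_latt_floorMode_sub_le hh y)

lemma radial_inv_pow_four {a : ℝ} (ha : 0 < a) :
    Integrable (fun y : Space => (Set.Ioi a).indicator (fun r : ℝ => (r ^ 4)⁻¹) ‖y‖) ∧
      ∫ y : Space, (Set.Ioi a).indicator (fun r : ℝ => (r ^ 4)⁻¹) ‖y‖ = 4 * Real.pi / a := by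
  have hd : ∀ r ∈ Set.Ici a, HasDerivAt (fun r : ℝ => -r⁻¹) ((r ^ 2)⁻¹) r := by
    intro r hr
    have hr0 : r ≠ 0 := (ha.trans_le hr).ne'
    exact (hasDerivAt_inv hr0).neg.congr_deriv (neg_neg _)
  have hn : ∀ r ∈ Set.Ioi a, (0 : ℝ) ≤ (r ^ 2)⁻¹ := fun r _ => by positivity
  have hl : Tendsto (fun r : ℝ => -r⁻¹) atTop (𝓝 0) := by
    have := (tendsto_inv_atTop_zero (𝕜 := ℝ)).neg
    rwa [neg_zero] at this
  have hi := integrableOn_Ioi_deriv_of_nonneg' hd hn hl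
  have hv := integral_Ioi_of_hasDerivAt_of_nonneg' hd hn hl
  have e : (fun r : ℝ => r ^ 2 * (Set.Ioi a).indicator (fun r : ℝ => (r ^ 4)⁻¹) r) =
      (Set.Ioi a).indicator (fun r : ℝ => (r ^ 2)⁻¹) := by
    funext r
    by_cases hr : r ∈ Set.Ioi a
    · have hr0 : r ≠ 0 := (ha.trans hr).ne'
      simp only [Set.indicator_of_mem hr]
      field_simp
    · simp [Set.indicator_of_notMem hr]
  have hsub : Set.Ioi a ∩ Set.Ioi 0 = Set.Ioi a := by
    ext r; simp only [Set.mem_inter_iff, Set.mem_Ioi, and_iff_left_iff_imp]; exact ha.trans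
  constructor
  · rw [integrable_fun_norm_addHaar (E := Space) volume]
    simp only [finrank_euclideanSpace, Fintype.card_fin, smul_eq_mul]
    norm_num only
    rw [e]
    exact ((integrable_indicator_iff measurableSet_Ioi).2 hi).integrableOn
  · rw [integral_fun_norm_addHaar (E := Space) volume]
    have hb : (volume : Measure Space).real (Metric.ball 0 1) = Real.pi * 4 / 3 := by
      rw [Measure.real, EuclideanSpace.volume_ball_fin_three]
      simp [Real.pi_pos.le, div_nonneg]
    simp only [finrank_euclideanSpace, Fintype.card_fin, smul_eq_mul, nsmul_eq_mul, hb]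
    norm_num only
    rw [e, setIntegral_indicator measurableSet_Ioi, Set.inter_comm, hsub, hv]
    simp only [sub_neg_eq_add, zero_add]
    field_simp

open Classical in
/-- Sums of `|y|⁻⁴` over the points of a fine lattice outside a ball. -/
lemma lattice_sum_inv_pow_four {h a : ℝ} (hh : 0 < h) (ha : 4 * h ≤ a) :
    Summable (fun n : Mode => if a ≤ h * ‖latt n‖ then ((h * ‖latt n‖) ^ 4)⁻¹ else 0) ∧
    h ^ 3 * ∑' n : Mode, (if a ≤ h * ‖latt n‖ then ((h * ‖latt n‖) ^ 4)⁻¹ else 0) ≤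
      192 * Real.pi / a := by
  have ha0 : 0 < a := by linarith
  obtain ⟨hi, hv⟩ := radial_inv_pow_four (a := a / 3) (by positivity)
  set f : Mode → ℝ := fun n => if a ≤ h * ‖latt n‖ then ((h * ‖latt n‖) ^ 4)⁻¹ else 0 with hfdef
  have hb : ∀ y : Space, f (floorMode (h⁻¹ • y)) ≤
      16 * (Set.Ioi (a / 3)).indicator (fun r : ℝ => (r ^ 4)⁻¹) ‖y‖ := by
    intro y
    have hy := abs_le.1 (abs_norm_latt_sub_le hh y)
    simp only [hfdef]
    split_ifs with hc
    -- Since `2h ≤ a/2`, a point `y` in the cell of a lattice point of norm `r ≥ a` satisfies `r/2 ≤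
    -- ‖y‖ ≤ 3r/2`. This accounts for the radius `a / 3` and the factor `16`.
    · have h1 : a / 3 < ‖y‖ := by linarith [hy.1, hy.2]
      have h0 : 0 < ‖y‖ := by linarith
      rw [Set.indicator_of_mem (show ‖y‖ ∈ Set.Ioi (a / 3) from h1)]
      have h2 : ‖y‖ / 2 ≤ h * ‖latt (floorMode (h⁻¹ • y))‖ := by linarith [hy.1, hy.2]
      calc ((h * ‖latt (floorMode (h⁻¹ • y))‖) ^ 4)⁻¹ ≤ ((‖y‖ / 2) ^ 4)⁻¹ := by gcongr
        _ = 16 * (‖y‖ ^ 4)⁻¹ := by rw [div_pow, inv_div]; norm_num; ring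
    · refine mul_nonneg (by norm_num) (Set.indicator_nonneg (fun r _ => by positivity) _)
  have hf0 : ∀ n, 0 ≤ f n := by
    intro n; simp only [hfdef]; split_ifs <;> positivity
  obtain ⟨hs, hint⟩ := summable_of_bound hh (hi.const_mul 16) (f := f)
    (fun y => by rw [abs_of_nonneg (hf0 _)]; exact hb y)
  refine ⟨hs, ?_⟩
  rw [hint]
  calc ∫ y : Space, f (floorMode (h⁻¹ • y))
      ≤ ∫ y : Space, 16 * (Set.Ioi (a / 3)).indicator (fun r : ℝ => (r ^ 4)⁻¹) ‖y‖ :=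
        integral_mono_of_nonneg (ae_of_all _ fun y => hf0 _) (hi.const_mul 16) (ae_of_all _ hb)
    _ = 192 * Real.pi / a := by rw [integral_const_mul, hv]; field_simp; norm_num

/-- Riemann sums over lattices of vanishing spacing converge under a domination hypothesis. -/
lemma tendsto_riemann_sum {l : Filter ℝ} [l.IsCountablyGenerated] {h : ℝ → ℝ}
    (hpos : ∀ᶠ ρ in l, 0 < h ρ) {f : ℝ → Mode → ℝ}
    {bound lim : Space → ℝ} (hb : Integrable bound)
    (hfb : ∀ᶠ ρ in l, ∀ y, |f ρ (floorMode ((h ρ)⁻¹ • y))| ≤ bound y)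
    (hlim : ∀ y ≠ 0, Tendsto (fun ρ => f ρ (floorMode ((h ρ)⁻¹ • y))) l (𝓝 (lim y))) :
    Tendsto (fun ρ => h ρ ^ 3 * ∑' n, f ρ n) l (𝓝 (∫ y, lim y)) := by
  have h1 : Tendsto (fun ρ => ∫ y : Space, f ρ (floorMode ((h ρ)⁻¹ • y))) l (𝓝 (∫ y, lim y)) := by
    refine tendsto_integral_filter_of_dominated_convergence bound ?_ ?_ hb ?_
    · exact Eventually.of_forall fun ρ => (measurable_comp_floorMode _ _).aestronglyMeasurable
    · filter_upwards [hfb] with ρ hρ using ae_of_all _ hρ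
    · have : ∀ᵐ y : Space, y ≠ 0 := by simp [ae_iff]
      filter_upwards [this] with y hy using hlim y hy
  refine h1.congr' ?_
  filter_upwards [hpos, hfb] with ρ h0 hρ
  exact (summable_of_bound h0 hb hρ).2.symm

/-- Riemann sums of a family of radial functions dominated by `bogF`, over lattice points in an
annulus which exhausts the space. -/
lemma tendsto_annulus_sum {l : Filter ℝ} [l.IsCountablyGenerated] {c : ℝ} (hc : 0 ≤ c)
    {h lo hi : ℝ → ℝ} (hpos : ∀ᶠ ρ in l, 0 < h ρ) (hh : Tendsto h l (𝓝 0))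
    (hlo : Tendsto lo l (𝓝 0)) (hhi : Tendsto hi l atTop) (hlh : ∀ᶠ ρ in l, 4 * h ρ ≤ lo ρ)
    (S : ℝ → Set Mode) [∀ ρ n, Decidable (n ∈ S ρ)]
    (hS : ∀ᶠ ρ in l, ∀ n, n ∈ S ρ ↔ lo ρ ≤ h ρ * ‖latt n‖ ∧ h ρ * ‖latt n‖ ≤ hi ρ)
    {Φ : ℝ → ℝ → ℝ} (hΦ0 : ∀ ρ r, 0 ≤ Φ ρ r) (hΦ1 : ∀ ρ r, Φ ρ r ≤ bogF c r)
    (hΦ : ∀ (r : ℝ) (s : ℝ → ℝ), 0 < r → Tendsto s l (𝓝 r) →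
      Tendsto (fun ρ => Φ ρ (s ρ)) l (𝓝 (bogF c r))) :
    Tendsto (fun ρ => h ρ ^ 3 * ∑' n, if n ∈ S ρ then Φ ρ (h ρ * ‖latt n‖) else 0) l
      (𝓝 (Real.pi * c ^ (3 / 2 : ℝ) / 3)) := by
  rw [← integral_bogF_norm hc]
  -- A lattice point in the annulus has norm at least `4h`, hence at least `‖y‖ / 2` for every `y`
  -- in its cell. As `bogF` is decreasing, its value at `‖y‖ / 2` dominates.
  have hI : Integrable fun y : Space => bogF c ‖(2⁻¹ : ℝ) • y‖ :=
    (integrable_bogF_norm hc).comp_smul (by norm_num)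
  refine tendsto_riemann_sum hpos hI ?_ ?_
  · filter_upwards [hpos, hlh, hS] with ρ h0 h4 hSρ y
    have hy := abs_le.1 (abs_norm_latt_sub_le h0 y)
    split_ifs with hm
    · rw [abs_of_nonneg (hΦ0 _ _)]
      have := ((hSρ _).1 hm).1
      refine (hΦ1 _ _).trans (bogF_anti hc ?_ ?_)
      · rw [norm_smul]
        exact mul_pos (by norm_num) (by linarith [hy.1, hy.2])
      · rw [norm_smul]; norm_num; linarith [hy.1, hy.2]
    · simpa using bogF_nonneg hc _
  · intro y hy
    have hy0 : 0 < ‖y‖ := norm_pos_iff.2 hy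
    have hs : Tendsto (fun ρ => h ρ * ‖latt (floorMode ((h ρ)⁻¹ • y))‖) l (𝓝 ‖y‖) := by
      rw [tendsto_iff_dist_tendsto_zero]
      refine squeeze_zero' (Eventually.of_forall fun _ => dist_nonneg) ?_
        (by simpa using hh.const_mul 2)
      filter_upwards [hpos] with ρ h0
      rw [Real.dist_eq]
      exact abs_norm_latt_sub_le h0 y
    refine (hΦ _ _ hy0 hs).congr' ?_
    filter_upwards [hS, hlo.eventually_lt_const (half_pos hy0), hhi.eventually_gt_atTop (2 * ‖y‖),
      hs.eventually_const_lt (half_lt_self hy0),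
      hs.eventually_lt_const (show ‖y‖ < 2 * ‖y‖ by linarith)] with ρ h1 h2 h3 h4 h5
    rw [if_pos ((h1 _).2 ⟨by linarith, by linarith⟩)]

/-! ### Regions of momenta -/

lemma boxLength_pos {ρ : ℝ} (hρ : 0 < ρ) : 0 < boxLength ρ := Real.rpow_pos_of_pos hρ _

lemma boxVolume_pos {ρ : ℝ} (hρ : 0 < ρ) : 0 < boxVolume ρ := pow_pos (boxLength_pos hρ) 3

lemma norm_momentum {ρ : ℝ} (hρ : 0 < ρ) (n : Mode) :
    ‖momentum ρ n‖ = 2 * Real.pi / boxLength ρ * ‖latt n‖ := by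
  have := boxLength_pos hρ
  rw [momentum, norm_smul, Real.norm_of_nonneg (by positivity)]; rfl

lemma momentum_neg (ρ : ℝ) (n : Mode) : momentum ρ (-n) = -momentum ρ n := by
  ext i; simp [momentum]

lemma norm_momentum_neg (ρ : ℝ) (n : Mode) : ‖momentum ρ (-n)‖ = ‖momentum ρ n‖ := by
  rw [momentum_neg, norm_neg]

lemma norm_momentum_zero (ρ : ℝ) : ‖momentum ρ 0‖ = 0 := by
  rw [norm_eq_zero]; ext i; simp [momentum]

/-- The momenta outside the condensate and the low region. -/
def PIH (ρ : ℝ) : Set Mode := PI ρ ∪ PH ρ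

lemma neg_mem_PL {ρ : ℝ} {n : Mode} : -n ∈ PL ρ ↔ n ∈ PL ρ := by
  simp [PL, norm_momentum_neg]

lemma neg_mem_PIH {ρ : ℝ} {n : Mode} : -n ∈ PIH ρ ↔ n ∈ PIH ρ := by
  simp [PIH, PI, PH, norm_momentum_neg]

lemma zero_notMem_PL {ρ : ℝ} (hρ : 0 < ρ) : (0 : Mode) ∉ PL ρ := by
  intro h
  have h1 := h.1
  rw [norm_momentum_zero, epsL] at h1
  have : 0 < ρ ^ eta * ρ ^ (1 / 2 : ℝ) := by positivity
  linarith

lemma low_edge_eq {ρ : ℝ} (hρ : 0 < ρ) :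
    (etaL ρ)⁻¹ * ρ ^ (1 / 2 : ℝ) = ρ ^ (-eta) * ρ ^ (1 / 2 : ℝ) := by
  rw [etaL, Real.rpow_neg hρ.le]

lemma low_edge_le {ρ : ℝ} (hρ : 0 < ρ) (h1 : ρ < 1) : (etaL ρ)⁻¹ * ρ ^ (1 / 2 : ℝ) ≤ epsH ρ := by
  rw [low_edge_eq hρ, epsH, ← Real.rpow_add hρ]
  exact Real.rpow_le_rpow_of_exponent_ge hρ h1.le (by norm_num [eta])

lemma mem_PIH {ρ : ℝ} (hρ : 0 < ρ) (h1 : ρ < 1) {n : Mode} :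
    n ∈ PIH ρ ↔ (etaL ρ)⁻¹ * ρ ^ (1 / 2 : ℝ) < ‖momentum ρ n‖ := by
  have := low_edge_le hρ h1
  simp only [PIH, PI, PH, Set.mem_union, Set.mem_ofPred_eq]
  constructor
  · rintro (h | h)
    · exact h.1
    · linarith
  · intro h
    rcases le_or_gt ‖momentum ρ n‖ (epsH ρ) with h' | h'
    · exact Or.inl ⟨h, h'⟩
    · exact Or.inr h'

lemma zero_notMem_PIH {ρ : ℝ} (hρ : 0 < ρ) (h1 : ρ < 1) : (0 : Mode) ∉ PIH ρ := by
  rw [mem_PIH hρ h1, norm_momentum_zero, low_edge_eq hρ]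
  have : 0 < ρ ^ (-eta) * ρ ^ (1 / 2 : ℝ) := by positivity
  linarith

lemma notMem_PIH_of_PL {ρ : ℝ} (hρ : 0 < ρ) (h1 : ρ < 1) {n : Mode} (h : n ∈ PL ρ) :
    n ∉ PIH ρ := by
  rw [mem_PIH hρ h1]; exact not_lt.2 h.2

lemma PH_subset_PIH {ρ : ℝ} {n : Mode} (h : n ∈ PH ρ) : n ∈ PIH ρ := Or.inr h

lemma mem_PAll {ρ : ℝ} {n : Mode} : n ∈ PAll ρ ↔ n = 0 ∨ n ∈ PL ρ ∨ n ∈ PIH ρ := by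
  simp only [PAll, P0, PIH, Set.mem_union, Set.mem_singleton_iff]; tauto

lemma finite_norm_momentum_le {ρ : ℝ} (hρ : 0 < ρ) (R : ℝ) :
    {n : Mode | ‖momentum ρ n‖ ≤ R}.Finite := by
  have hL := boxLength_pos hρ
  set K : ℝ := R / (2 * Real.pi / boxLength ρ)
  refine (Set.finite_Icc (fun _ => -⌈K⌉ : Mode) (fun _ => ⌈K⌉)).subset fun n hn => ?_
  have hn' : ‖latt n‖ ≤ K := by
    rw [le_div_iff₀ (by positivity), mul_comm, ← norm_momentum hρ]; exact hn
  have h2 : ∀ i, |(n i : ℝ)| ≤ ⌈K⌉ := fun i =>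
    ((PiLp.norm_apply_le (latt n) i).trans hn').trans (Int.le_ceil K)
  constructor <;> intro i <;> have := abs_le.1 (h2 i) <;> [exact_mod_cast this.1; exact_mod_cast this.2]

lemma finite_PL {ρ : ℝ} (hρ : 0 < ρ) : (PL ρ).Finite :=
  (finite_norm_momentum_le hρ _).subset fun _ h => h.2

lemma mode_ne_neg {k : Mode} (hk : k ≠ 0) : k ≠ -k := fun h => hk (self_eq_neg.1 h)

/-! ### Pair creations, pointwise -/

section steps
variable {ρ : ℝ} {N : ℕ} {α β : Occ} {k u p q : Mode}

lemma IsStrictPair.apply_zero (h : IsStrictPair k α β) : β 0 + 2 = α 0 := by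
  have := DFunLike.congr_fun h.2 0
  simpa [Finsupp.single_apply, h.1] using this

lemma IsStrictPair.apply_of_ne (h : IsStrictPair k α β) {j : Mode} (hj : j ≠ 0) :
    β j = α j + (if k = j then 1 else 0) + (if -k = j then 1 else 0) := by
  have := DFunLike.congr_fun h.2 j
  simpa [Finsupp.single_apply, hj.symm] using this

lemma IsStrictPair.apply_self (h : IsStrictPair k α β) : β k = α k + 1 := by
  rw [h.apply_of_ne h.1]; simp [(mode_ne_neg h.1).symm]

lemma IsStrictPair.apply_neg (h : IsStrictPair k α β) : β (-k) = α (-k) + 1 := by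
  rw [h.apply_of_ne (neg_ne_zero.2 h.1)]; simp [mode_ne_neg h.1]

lemma IsStrictPair.apply_other (h : IsStrictPair k α β) {j : Mode} (hj : j ≠ 0) (h1 : j ≠ k)
    (h2 : j ≠ -k) : β j = α j := by
  rw [h.apply_of_ne hj]; simp [h1.symm, h2.symm]

lemma IsStrictPair.neg (h : IsStrictPair k α β) : IsStrictPair (-k) α β :=
  ⟨neg_ne_zero.2 h.1, by rw [neg_neg, h.2]; abel⟩

lemma IsSoftPair.apply_zero (hρ : 0 < ρ) (h1 : ρ < 1) (h : IsSoftPair ρ u p q α β) :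
    β 0 + 1 = α 0 := by
  have hu : u ≠ 0 := fun e => zero_notMem_PL hρ (e ▸ h.1)
  have hp : p ≠ 0 := fun e => zero_notMem_PIH hρ h1 (e ▸ PH_subset_PIH h.2.1)
  have hq : q ≠ 0 := fun e => zero_notMem_PIH hρ h1 (e ▸ PH_subset_PIH h.2.2.1)
  have := DFunLike.congr_fun h.2.2.2.2 0
  simpa [Finsupp.single_apply, hu, hp, hq] using this

lemma IsSoftPair.apply_PL (hρ : 0 < ρ) (h1 : ρ < 1) (h : IsSoftPair ρ u p q α β) {j : Mode}
    (hj : j ∈ PL ρ) : β j + (if u = j then 1 else 0) = α j := by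
  have hj0 : (0 : Mode) ≠ j := fun e => zero_notMem_PL hρ (e ▸ hj)
  have hp : p ≠ j := fun e => notMem_PIH_of_PL hρ h1 hj (e ▸ PH_subset_PIH h.2.1)
  have hq : q ≠ j := fun e => notMem_PIH_of_PL hρ h1 hj (e ▸ PH_subset_PIH h.2.2.1)
  have := DFunLike.congr_fun h.2.2.2.2 j
  simpa [Finsupp.single_apply, hj0, hp, hq] using this

lemma IsSoftPair.apply_PIH (hρ : 0 < ρ) (h1 : ρ < 1) (h : IsSoftPair ρ u p q α β) {j : Mode}
    (hj : j ∈ PIH ρ) : β j = α j + (if p = j then 1 else 0) + (if q = j then 1 else 0) := by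
  have hj0 : (0 : Mode) ≠ j := fun e => zero_notMem_PIH hρ h1 (e ▸ hj)
  have hu : u ≠ j := fun e => notMem_PIH_of_PL hρ h1 h.1 (e ▸ hj)
  have := DFunLike.congr_fun h.2.2.2.2 j
  simpa [Finsupp.single_apply, hj0, hu] using this

end steps

/-! ### Total occupation numbers -/

lemma mem_AllConfig {ρ : ℝ} {N : ℕ} {α : Occ} :
    α ∈ AllConfig ρ N ↔ (∀ k, α k ≠ 0 → k ∈ PAll ρ) ∧ α.degree = N := by
  simp [AllConfig, Finsupp.degree_apply]

/-- Number of particles with momenta in a set. -/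
def occIn (S : Set Mode) : Occ →+ ℕ := by
  classical
  exact Finsupp.degree.comp (Finsupp.filterAddHom (· ∈ S))

open Classical in
lemma occIn_apply (S : Set Mode) (α : Occ) : occIn S α = (α.filter (· ∈ S)).degree := rfl

open Classical in
lemma occIn_single (S : Set Mode) (k : Mode) (m : ℕ) :
    occIn S (Finsupp.single k m) = if k ∈ S then m else 0 := by
  rw [occIn_apply]
  split_ifs with h
  · rw [Finsupp.filter_single_of_pos _ h, Finsupp.degree_single]
  · rw [Finsupp.filter_single_of_neg _ h, map_zero]

open Classical in
lemma occIn_eq_sum (S : Set Mode) (α : Occ) :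
    occIn S α = ∑ k ∈ α.support with k ∈ S, α k := by
  rw [occIn_apply, Finsupp.degree_apply,
    Finsupp.support_filter]
  refine Finset.sum_congr rfl fun k hk => ?_
  rw [Finsupp.filter_apply_pos _ _ (Finset.mem_filter.1 hk).2]

/-! ### The structure of the set `M` -/

section structureM
variable {ρ kc : ℝ} {N : ℕ} {α β γ : Occ} {k u v p q p' q' : Mode}

lemma exists_strictPair (hk : k ≠ 0) (h : 2 ≤ α 0) : ∃ β, IsStrictPair k α β := by
  refine ⟨α - Finsupp.single 0 2 + Finsupp.single k 1 + Finsupp.single (-k) 1, hk, ?_⟩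
  have : Finsupp.single 0 2 ≤ α := Finsupp.single_le_iff.2 h
  conv_rhs => rw [← tsub_add_cancel_of_le this]
  ac_rfl

lemma exists_softPair (hρ : 0 < ρ) (hu : u ∈ PL ρ) (hp : p ∈ PH ρ) (hq : q ∈ PH ρ)
    (hpq : p + q = u) (h0 : 1 ≤ α 0) (h1 : 1 ≤ α u) : ∃ β, IsSoftPair ρ u p q α β := by
  refine ⟨α - (Finsupp.single 0 1 + Finsupp.single u 1) + Finsupp.single p 1 + Finsupp.single q 1,
    hu, hp, hq, hpq, ?_⟩
  have hu0 : u ≠ 0 := fun e => zero_notMem_PL hρ (e ▸ hu)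
  have : Finsupp.single 0 1 + Finsupp.single u 1 ≤ α := by
    intro j
    by_cases hj : j = 0
    · subst hj; simpa [Finsupp.single_apply, hu0] using h0
    · by_cases hj' : u = j
      · subst hj'; simpa [Finsupp.single_apply, hu0.symm] using h1
      · simp [Ne.symm hj, hj']
  conv_rhs => rw [← tsub_add_cancel_of_le this]
  ac_rfl

lemma IsStrictPair.mem_AllConfig (h : IsStrictPair k α β) (hk : k ∈ PL ρ ∪ PIH ρ)
    (hα : α ∈ AllConfig ρ N) : β ∈ AllConfig ρ N := by
  rw [BoseGas.mem_AllConfig] at hα ⊢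
  constructor
  · intro j hj
    by_cases hj0 : j = 0
    · exact mem_PAll.2 (Or.inl hj0)
    by_cases h1 : j = k
    · subst h1; exact mem_PAll.2 (Or.inr hk)
    by_cases h2 : j = -k
    · subst h2
      refine mem_PAll.2 (Or.inr ?_)
      rw [neg_mem_PL, neg_mem_PIH]; exact hk
    · rw [h.apply_other hj0 h1 h2] at hj
      exact hα.1 j hj
  · have := congrArg Finsupp.degree h.2
    simp only [map_add, Finsupp.degree_single] at this
    omega

lemma IsSoftPair.mem_AllConfig (h : IsSoftPair ρ u p q α β)
    (hα : α ∈ AllConfig ρ N) : β ∈ AllConfig ρ N := by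
  rw [BoseGas.mem_AllConfig] at hα ⊢
  constructor
  · intro j hj
    by_cases h1 : j = p
    · subst h1; exact mem_PAll.2 (Or.inr (Or.inr (PH_subset_PIH h.2.1)))
    by_cases h2 : j = q
    · subst h2; exact mem_PAll.2 (Or.inr (Or.inr (PH_subset_PIH h.2.2.1)))
    · refine hα.1 j ?_
      have := DFunLike.congr_fun h.2.2.2.2 j
      simp only [Finsupp.add_apply, Finsupp.single_apply, Ne.symm h1, Ne.symm h2, if_false] at this
      omega
  · have := congrArg Finsupp.degree h.2.2.2.2
    simp only [map_add, Finsupp.degree_single] at this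
    omega

/-- Pair creations are additive in the occupation numbers, so their order is immaterial. This and
the next three lemmas carry a removable pair past a later creation in the inductions on `InM`. -/
lemma IsStrictPair.comm_strict {α' : Occ} (h : IsStrictPair k α' α) (hβ : IsStrictPair u α β)
    (hγ : IsStrictPair u α' γ) : IsStrictPair k γ β := by
  refine ⟨h.1, ?_⟩
  ext j
  have h1 := DFunLike.congr_fun h.2 j
  have h2 := DFunLike.congr_fun hβ.2 j
  have h3 := DFunLike.congr_fun hγ.2 j
  simp only [Finsupp.add_apply] at h1 h2 h3 ⊢
  omega

lemma IsStrictPair.comm_soft {α' : Occ} (h : IsStrictPair k α' α) (hβ : IsSoftPair ρ u p q α β)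
    (hγ : IsSoftPair ρ u p q α' γ) : IsStrictPair k γ β := by
  refine ⟨h.1, ?_⟩
  ext j
  have h1 := DFunLike.congr_fun h.2 j
  have h2 := DFunLike.congr_fun hβ.2.2.2.2 j
  have h3 := DFunLike.congr_fun hγ.2.2.2.2 j
  simp only [Finsupp.add_apply] at h1 h2 h3 ⊢
  omega

lemma IsSoftPair.comm_strict {α' : Occ} (h : IsSoftPair ρ u p q α' α) (hβ : IsStrictPair k α β)
    (hγ : IsStrictPair k α' γ) : IsSoftPair ρ u p q γ β := by
  refine ⟨h.1, h.2.1, h.2.2.1, h.2.2.2.1, ?_⟩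
  ext j
  have h1 := DFunLike.congr_fun h.2.2.2.2 j
  have h2 := DFunLike.congr_fun hβ.2 j
  have h3 := DFunLike.congr_fun hγ.2 j
  simp only [Finsupp.add_apply] at h1 h2 h3 ⊢
  omega

lemma IsSoftPair.comm_soft {α' : Occ} (h : IsSoftPair ρ u p q α' α)
    (hβ : IsSoftPair ρ v p' q' α β) (hγ : IsSoftPair ρ v p' q' α' γ) :
    IsSoftPair ρ u p q γ β := by
  refine ⟨h.1, h.2.1, h.2.2.1, h.2.2.2.1, ?_⟩
  ext j
  have h1 := DFunLike.congr_fun h.2.2.2.2 j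
  have h2 := DFunLike.congr_fun hβ.2.2.2.2 j
  have h3 := DFunLike.congr_fun hγ.2.2.2.2 j
  simp only [Finsupp.add_apply] at h1 h2 h3 ⊢
  omega

/-- A strict pair outside `P_L` does not change the occupation of `P_L`. -/
lemma IsStrictPair.apply_PL_of_PIH (hρ : 0 < ρ) (h1 : ρ < 1) (h : IsStrictPair k α β)
    (hk : k ∈ PIH ρ) (hv : v ∈ PL ρ) : β v = α v := by
  refine h.apply_other (fun e => zero_notMem_PL hρ (e ▸ hv)) ?_ ?_
  · rintro rfl; exact notMem_PIH_of_PL hρ h1 hv hk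
  · rintro rfl; exact notMem_PIH_of_PL hρ h1 hv (neg_mem_PIH.2 hk)

lemma IsStrictPair.apply_PIH_of_PL (hρ : 0 < ρ) (h1 : ρ < 1) (h : IsStrictPair k α β)
    (hk : k ∈ PL ρ) (hv : v ∈ PIH ρ) : β v = α v := by
  refine h.apply_other (fun e => zero_notMem_PIH hρ h1 (e ▸ hv)) ?_ ?_
  · rintro rfl; exact notMem_PIH_of_PL hρ h1 hk hv
  · rintro rfl; exact notMem_PIH_of_PL hρ h1 hk (neg_mem_PIH.1 hv)

/-- The occupation of `v` and of `-v` change by the same amount under a strict pair creation. -/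
lemma IsStrictPair.apply_symm (h : IsStrictPair k α β) (hv : v ≠ 0) :
    β v + α (-v) = β (-v) + α v := by
  rw [h.apply_of_ne hv, h.apply_of_ne (neg_ne_zero.2 hv)]
  have e1 : (k = -v) ↔ (-k = v) := by rw [neg_eq_iff_eq_neg]
  have e2 : (-k = -v) ↔ (k = v) := neg_inj
  simp only [e1, e2]
  omega

lemma InM.mem_AllConfig (h : InM ρ kc N α) : α ∈ AllConfig ρ N := by
  cases h with
  | free =>
    rw [BoseGas.mem_AllConfig]
    refine ⟨fun k hk => mem_PAll.2 (Or.inl ?_), Finsupp.degree_single _ _⟩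
    by_contra h
    exact hk (by simp [Ne.symm h])
  | strict_high _ _ _ h => exact h
  | strict_low _ _ _ _ h => exact h
  | soft _ _ _ _ _ _ _ _ h => exact h

lemma InM.strict_high' (h : InM ρ kc N α) (hu : u ∈ PIH ρ) (hs : IsStrictPair u α β) :
    InM ρ kc N β :=
  h.strict_high hu hs (hs.mem_AllConfig (Or.inr hu) h.mem_AllConfig)

lemma InM.strict_low' (h : InM ρ kc N α) (hu : u ∈ PL ρ)
    (hc : ((max (α u) (α (-u)) : ℕ) : ℝ) < mCut ρ) (hs : IsStrictPair u α β) :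
    InM ρ kc N β :=
  h.strict_low hu hc hs (hs.mem_AllConfig (Or.inl hu) h.mem_AllConfig)

open Classical in
lemma mem_asymModes : u ∈ asymModes ρ α ↔ u ∈ PL ρ ∧ α (-u) = α u + 1 := by
  unfold asymModes occMax
  rw [Finset.mem_filter]
  rw [Finset.mem_image]
  simp only [Finsupp.mem_support_iff]
  constructor
  · rintro ⟨_, h1, h2⟩
    exact ⟨h1, by omega⟩
  · rintro ⟨h1, h2⟩
    exact ⟨⟨-u, by omega, neg_neg u⟩, h1, by omega⟩

lemma asymModes_strict (hρ : 0 < ρ) (h : IsStrictPair k α β) :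
    asymModes ρ β = asymModes ρ α := by
  ext v
  rw [mem_asymModes, mem_asymModes]
  refine and_congr_right fun hv => ?_
  have := h.apply_symm (v := v) (fun e => zero_notMem_PL hρ (e ▸ hv))
  omega

lemma notMem_asymModes (h : α u = α (-u)) : u ∉ asymModes ρ α := by
  rw [mem_asymModes]; omega

-- A soft pair takes a particle from `u` but not from `-u`, and its products lie in `P_H`; so among
-- the low modes only the balance of `±u` changes.
open Classical in
lemma asymModes_soft (hρ : 0 < ρ) (h1 : ρ < 1) (h : IsSoftPair ρ u p q α β)
    (hs : α u = α (-u)) : asymModes ρ β = insert u (asymModes ρ α) := by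
  ext v
  rw [Finset.mem_insert, mem_asymModes, mem_asymModes]
  have hu0 : u ≠ 0 := fun e => zero_notMem_PL hρ (e ▸ h.1)
  by_cases hv : v ∈ PL ρ
  · have e1 := h.apply_PL hρ h1 hv
    have e2 := h.apply_PL hρ h1 (neg_mem_PL.2 hv)
    by_cases c1 : u = v
    · subst c1
      simp only [mode_ne_neg hu0, if_true, if_false] at e1 e2
      simp only [hv, true_and, true_or, iff_true]
      omega
    · by_cases c2 : u = -v
      · subst c2
        rw [neg_neg] at hs
        simp only [if_true, c1, if_false] at e1 e2
        simp only [hv, true_and, Ne.symm c1, false_or]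
        omega
      · simp only [c1, c2, if_false, add_zero] at e1 e2
        rw [e1, e2]
        simp [Ne.symm c1]
  · have : v ≠ u := by rintro rfl; exact hv h.1
    simp [hv, this]

lemma occIn_strict (h : IsStrictPair k α β) (hk : k ∈ PIH ρ) (hρ : 0 < ρ) (h1 : ρ < 1) :
    occIn (PIH ρ) β = occIn (PIH ρ) α + 2 := by
  have := congrArg (occIn (PIH ρ)) h.2
  simpa [occIn_single, zero_notMem_PIH hρ h1, hk, neg_mem_PIH.2 hk] using this

lemma occIn_strict_low (h : IsStrictPair k α β) (hk : k ∈ PL ρ) (hρ : 0 < ρ) (h1 : ρ < 1) :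
    occIn (PIH ρ) β = occIn (PIH ρ) α := by
  have hk' := notMem_PIH_of_PL hρ h1 hk
  have := congrArg (occIn (PIH ρ)) h.2
  simpa [occIn_single, zero_notMem_PIH hρ h1, hk', neg_mem_PIH] using this

lemma occIn_soft (h : IsSoftPair ρ u p q α β) (hρ : 0 < ρ) (h1 : ρ < 1) :
    occIn (PIH ρ) β = occIn (PIH ρ) α + 2 := by
  have := congrArg (occIn (PIH ρ)) h.2.2.2.2
  simpa [occIn_single, zero_notMem_PIH hρ h1, notMem_PIH_of_PL hρ h1 h.1, PH_subset_PIH h.2.1,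
    PH_subset_PIH h.2.2.1] using this

/-- The particles outside `P_0 ∪ P_L` come in strict pairs, each of which can be removed without
leaving `M`, and in soft pairs, whose number is the number of asymmetric low modes. -/
lemma InM.exists_strict_part (hρ : 0 < ρ) (h1 : ρ < 1) (h : InM ρ kc N α) :
    ∃ τ : Occ, (∀ k, τ k ≠ 0 → k ∈ PIH ρ) ∧ τ ≤ α ∧
      occIn (PIH ρ) α = 2 * τ.degree + 2 * (asymModes ρ α).card ∧
      ∀ k, τ k ≠ 0 → ∃ α', InM ρ kc N α' ∧ IsStrictPair k α' α := by
  induction h with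
  | free =>
    refine ⟨0, by simp, zero_le, ?_, by simp⟩
    have : asymModes ρ (Finsupp.single 0 N) = ∅ := by
      refine Finset.eq_empty_of_forall_notMem fun u hu => ?_
      rw [mem_asymModes] at hu
      have hu0 : u ≠ 0 := fun e => zero_notMem_PL hρ (e ▸ hu.1)
      have := hu.2
      simp [hu0.symm, (neg_ne_zero.2 hu0).symm] at this
    simp [this, occIn_single, zero_notMem_PIH hρ h1]
  | @strict_high α β u hα hu hs hβ ih =>
    obtain ⟨τ, t1, t2, t3, t4⟩ := ih
    -- Each strict pair is recorded in `τ` by one of its two momenta, whence the factor `2` in the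
    -- count.
    refine ⟨τ + Finsupp.single u 1, ?_, ?_, ?_, ?_⟩
    · intro k hk
      by_cases e : u = k
      · exact e ▸ hu
      · exact t1 k (by simpa [Finsupp.single_apply, e] using hk)
    · intro j
      have hj := t2 j
      by_cases e : u = j
      · subst e; simp [hs.apply_self]; exact hj
      · simp only [Finsupp.add_apply, Finsupp.single_apply, e, if_false, add_zero]
        by_cases hj0 : j = 0
        · subst hj0
          have : τ 0 = 0 := by
            by_contra h0; exact zero_notMem_PIH hρ h1 (t1 0 h0)
          omega
        · rw [hs.apply_of_ne hj0]; omega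
    · rw [occIn_strict hs hu hρ h1, asymModes_strict hρ hs, map_add, Finsupp.degree_single]
      omega
    · intro k hk
      by_cases e : u = k
      · subst e; exact ⟨α, hα, hs⟩
      · obtain ⟨α', hα', hs'⟩ := t4 k (by simpa [Finsupp.single_apply, e] using hk)
        have h0 := hs'.apply_zero
        obtain ⟨γ, hγ⟩ := exists_strictPair (α := α') hs.1 (by omega)
        exact ⟨γ, hα'.strict_high' hu hγ, hs'.comm_strict hs hγ⟩
  | @strict_low α β u hα hu hc hs hβ ih =>
    obtain ⟨τ, t1, t2, t3, t4⟩ := ih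
    refine ⟨τ, t1, ?_, ?_, ?_⟩
    · intro j
      by_cases hj : τ j = 0
      · rw [hj]; exact Nat.zero_le _
      · rw [hs.apply_PIH_of_PL hρ h1 hu (t1 j hj)]; exact t2 j
    · rw [occIn_strict_low hs hu hρ h1, asymModes_strict hρ hs, t3]
    · intro k hk
      obtain ⟨α', hα', hs'⟩ := t4 k hk
      have h0 := hs'.apply_zero
      obtain ⟨γ, hγ⟩ := exists_strictPair (α := α') hs.1 (by omega)
      refine ⟨γ, hα'.strict_low' hu ?_ hγ, hs'.comm_strict hs hγ⟩
      rwa [← hs'.apply_PL_of_PIH hρ h1 (t1 k hk) hu,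
        ← hs'.apply_PL_of_PIH hρ h1 (t1 k hk) (neg_mem_PL.2 hu)]
  | @soft α β u p q hα hu hsym hs hp1 hp2 hq1 hq2 hβ ih =>
    classical
    obtain ⟨τ, t1, t2, t3, t4⟩ := ih
    refine ⟨τ, t1, ?_, ?_, ?_⟩
    · intro j
      by_cases hj : τ j = 0
      · rw [hj]; exact Nat.zero_le _
      · rw [hs.apply_PIH hρ h1 (t1 j hj)]
        have := t2 j
        omega
    -- The two new particles are matched by the new asymmetric mode `u`, which was symmetric before
    -- and so is counted for the first time.
    · rw [occIn_soft hs hρ h1, asymModes_soft hρ h1 hs hsym,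
        Finset.card_insert_of_notMem (notMem_asymModes hsym), t3]
      omega
    · intro k hk
      obtain ⟨α', hα', hs'⟩ := t4 k hk
      have h0 := hs'.apply_zero
      have e1 := hs'.apply_PL_of_PIH hρ h1 (t1 k hk) hu
      have e2 := hs'.apply_PL_of_PIH hρ h1 (t1 k hk) (neg_mem_PL.2 hu)
      have e3 := hs.apply_PL hρ h1 hu
      rw [if_pos rfl] at e3
      obtain ⟨γ, hγ⟩ := exists_softPair hρ hu hs.2.1 hs.2.2.1 hs.2.2.2.1 (α := α') (by omega)
        (by omega)
      exact ⟨γ, hα'.soft hu (by omega) hγ hp1 hp2 hq1 hq2 (hγ.mem_AllConfig hα'.mem_AllConfig),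
        hs'.comm_soft hs hγ⟩

/-- The soft pair creation that made a low mode asymmetric can be undone inside `M`. -/
lemma InM.exists_soft_removal (hρ : 0 < ρ) (h1 : ρ < 1) (h : InM ρ kc N α) (hu : u ∈ PL ρ)
    (hasym : α (-u) = α u + 1) :
    ∃ α' p q, InM ρ kc N α' ∧ α' u = α' (-u) ∧ IsSoftPair ρ u p q α' α := by
  have hu0 : u ≠ 0 := fun e => zero_notMem_PL hρ (e ▸ hu)
  induction h with
  | free =>
    simp [hu0.symm, (neg_ne_zero.2 hu0).symm] at hasym
  | @strict_high α β v hα hv hs hβ ih =>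
    have e1 := hs.apply_symm hu0
    obtain ⟨α', p, q, hα', hsym, hs'⟩ := ih (by omega)
    have h0 := hs'.apply_zero hρ h1
    have h0' := hs.apply_zero
    obtain ⟨γ, hγ⟩ := exists_strictPair (α := α') hs.1 (by omega)
    have e2 := hγ.apply_symm hu0
    exact ⟨γ, p, q, hα'.strict_high' hv hγ, by omega, hs'.comm_strict hs hγ⟩
  | @strict_low α β v hα hv hc hs hβ ih =>
    have e1 := hs.apply_symm hu0
    obtain ⟨α', p, q, hα', hsym, hs'⟩ := ih (by omega)
    have h0 := hs'.apply_zero hρ h1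
    have h0' := hs.apply_zero
    obtain ⟨γ, hγ⟩ := exists_strictPair (α := α') hs.1 (by omega)
    have e2 := hγ.apply_symm hu0
    refine ⟨γ, p, q, hα'.strict_low' hv ?_ hγ, by omega, hs'.comm_strict hs hγ⟩
    have a1 := hs'.apply_PL hρ h1 hv
    have a2 := hs'.apply_PL hρ h1 (neg_mem_PL.2 hv)
    have a3 := hs'.apply_PL hρ h1 hu
    rw [if_pos rfl] at a3
    -- Undoing the soft pair at `u` raises the smaller of the two occupations at `±u` to the larger
    -- one. The maximum, which is what the cutoff tests, stays the same.
    have hmax : max (α' v) (α' (-v)) = max (α v) (α (-v)) := by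
      by_cases c1 : u = v
      · subst c1
        rw [if_neg (mode_ne_neg hu0)] at a2
        omega
      · by_cases c2 : u = -v
        · subst c2
          rw [neg_neg] at hsym
          rw [if_neg c1] at a1
          omega
        · rw [if_neg c1] at a1; rw [if_neg c2] at a2; omega
    rwa [hmax]
  | @soft α β v p' q' hα hv hsym hs hp1 hp2 hq1 hq2 hβ ih =>
    have b1 := hs.apply_PL hρ h1 hu
    have b2 := hs.apply_PL hρ h1 (neg_mem_PL.2 hu)
    by_cases c1 : v = u
    · subst c1; exact ⟨α, p', q', hα, hsym, hs⟩
    by_cases c2 : v = -u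
    · subst c2
      rw [neg_neg] at hsym
      rw [if_neg c1] at b1
      rw [if_pos rfl] at b2
      omega
    rw [if_neg c1] at b1
    rw [if_neg c2] at b2
    obtain ⟨α', p, q, hα', hsym', hs'⟩ := ih (by omega)
    have h0 := hs'.apply_zero hρ h1
    have a1 := hs'.apply_PL hρ h1 hv
    have a2 := hs'.apply_PL hρ h1 (neg_mem_PL.2 hv)
    rw [if_neg (Ne.symm c1)] at a1
    rw [if_neg (fun e => c2 (by rw [e, neg_neg]))] at a2
    have b3 := hs.apply_PL hρ h1 hv
    rw [if_pos rfl] at b3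
    obtain ⟨γ, hγ⟩ := exists_softPair hρ hv hs.2.1 hs.2.2.1 hs.2.2.2.1 (α := α') (by omega)
      (by omega)
    have d1 := hγ.apply_PL hρ h1 hu
    have d2 := hγ.apply_PL hρ h1 (neg_mem_PL.2 hu)
    rw [if_neg c1] at d1
    rw [if_neg c2] at d2
    exact ⟨γ, p, q, hα'.soft hv (by omega) hγ hp1 hp2 hq1 hq2
      (hγ.mem_AllConfig hα'.mem_AllConfig), by omega, hs'.comm_soft hs hγ⟩

lemma mCut_pos (hρ : 0 < ρ) : 0 < mCut ρ := Real.rpow_pos_of_pos hρ _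

/-- Occupation numbers of opposite low modes differ by at most one and respect the cutoff. -/
lemma InM.low_bounds (hρ : 0 < ρ) (h1 : ρ < 1) (h : InM ρ kc N α) (hu : u ∈ PL ρ) :
    α (-u) ≤ α u + 1 ∧ (α u : ℝ) < mCut ρ + 1 := by
  have hm := mCut_pos hρ
  induction h generalizing u with
  | free =>
    have hu0 : u ≠ 0 := fun e => zero_notMem_PL hρ (e ▸ hu)
    simp only [Finsupp.single_apply, hu0.symm, (neg_ne_zero.2 hu0).symm, if_false]
    exact ⟨by omega, by push_cast; linarith⟩
  | @strict_high α β v hα hv hs hβ ih =>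
    rw [hs.apply_PL_of_PIH hρ h1 hv hu, hs.apply_PL_of_PIH hρ h1 hv (neg_mem_PL.2 hu)]
    exact ih hu
  | @strict_low α β v hα hv hc hs hβ ih =>
    have hu0 : u ≠ 0 := fun e => zero_notMem_PL hρ (e ▸ hu)
    -- The cutoff is tested before the pair is created, so the occupation may exceed `m_c`, but by
    -- less than one.
    refine ⟨by have := hs.apply_symm hu0; have := (ih hu).1; omega, ?_⟩
    have c1 : (α v : ℝ) < mCut ρ :=
      lt_of_le_of_lt (by exact_mod_cast le_max_left _ _) hc
    have c2 : (α (-v) : ℝ) < mCut ρ :=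
      lt_of_le_of_lt (by exact_mod_cast le_max_right _ _) hc
    by_cases e1 : u = v
    · subst e1; rw [hs.apply_self]; push_cast; linarith
    by_cases e2 : u = -v
    · subst e2; rw [hs.apply_neg]; push_cast; linarith
    · rw [hs.apply_other hu0 e1 e2]; exact (ih hu).2
  | @soft α β v p q hα hv hsym hs hp1 hp2 hq1 hq2 hβ ih =>
    have hu0 : u ≠ 0 := fun e => zero_notMem_PL hρ (e ▸ hu)
    have b1 := hs.apply_PL hρ h1 hu
    have b2 := hs.apply_PL hρ h1 (neg_mem_PL.2 hu)
    obtain ⟨i1, i2⟩ := ih hu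
    constructor
    · by_cases c1 : v = u
      · subst c1
        rw [if_neg (mode_ne_neg hu0)] at b2
        rw [if_pos rfl] at b1
        omega
      · rw [if_neg c1] at b1; omega
    · refine lt_of_le_of_lt ?_ i2
      exact_mod_cast (by omega : β u ≤ α u)

/-- A strict pair in a symmetric low mode can be removed inside `M`. -/
lemma InM.exists_low_removal (hρ : 0 < ρ) (h1 : ρ < 1) (h : InM ρ kc N α) (hu : u ∈ PL ρ)
    (hsym : α u = α (-u)) (hpos : 1 ≤ α u) :
    ∃ α', InM ρ kc N α' ∧ IsStrictPair u α' α := by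
  have hu0 : u ≠ 0 := fun e => zero_notMem_PL hρ (e ▸ hu)
  induction h with
  | free =>
    simp [hu0.symm] at hpos
  | @strict_high α β v hα hv hs hβ ih =>
    rw [hs.apply_PL_of_PIH hρ h1 hv hu] at hsym hpos
    rw [hs.apply_PL_of_PIH hρ h1 hv (neg_mem_PL.2 hu)] at hsym
    obtain ⟨α', hα', hs'⟩ := ih hsym hpos
    have h0 := hs'.apply_zero
    obtain ⟨γ, hγ⟩ := exists_strictPair (α := α') hs.1 (by omega)
    exact ⟨γ, hα'.strict_high' hv hγ, hs'.comm_strict hs hγ⟩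
  | @strict_low α β v hα hv hc hs hβ ih =>
    by_cases e1 : u = v
    · subst e1; exact ⟨α, hα, hs⟩
    by_cases e2 : u = -v
    · subst e2; exact ⟨α, hα, hs.neg⟩
    have e3 : -u ≠ v := fun e => e2 (by rw [← e, neg_neg])
    rw [hs.apply_other hu0 e1 e2] at hsym hpos
    rw [hs.apply_other (neg_ne_zero.2 hu0) e3 (fun e => e1 (neg_inj.1 e))] at hsym
    obtain ⟨α', hα', hs'⟩ := ih hsym hpos
    have h0 := hs'.apply_zero
    obtain ⟨γ, hγ⟩ := exists_strictPair (α := α') hs.1 (by omega)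
    refine ⟨γ, hα'.strict_low' hv ?_ hγ, hs'.comm_strict hs hγ⟩
    rwa [← hs'.apply_other hs.1 (Ne.symm e1) (Ne.symm e3),
      ← hs'.apply_other (neg_ne_zero.2 hs.1) (Ne.symm e2) (fun e => e1 (neg_inj.1 e).symm)]
  | @soft α β v p q hα hv hsymv hs hp1 hp2 hq1 hq2 hβ ih =>
    have hv0 : v ≠ 0 := fun e => zero_notMem_PL hρ (e ▸ hv)
    have b1 := hs.apply_PL hρ h1 hu
    have b2 := hs.apply_PL hρ h1 (neg_mem_PL.2 hu)
    have b3 := hs.apply_PL hρ h1 hv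
    rw [if_pos rfl] at b3
    -- A soft pair at `u` or `-u` would have left their occupations unequal.
    have c1 : v ≠ u := by
      rintro rfl
      rw [if_pos rfl] at b1
      rw [if_neg (mode_ne_neg hu0)] at b2
      omega
    have c2 : v ≠ -u := by
      rintro rfl
      rw [neg_neg] at hsymv
      rw [if_neg c1] at b1
      rw [if_pos rfl] at b2
      omega
    rw [if_neg c1] at b1
    rw [if_neg c2] at b2
    obtain ⟨α', hα', hs'⟩ := ih (by omega) (by omega)
    have h0 := hs'.apply_zero
    have a1 := hs'.apply_other hv0 c1 c2
    have a2 := hs'.apply_other (neg_ne_zero.2 hv0) (fun e => c2 (by rw [← e, neg_neg]))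
      (fun e => c1 (neg_inj.1 e))
    obtain ⟨γ, hγ⟩ := exists_softPair hρ hv hs.2.1 hs.2.2.1 hs.2.2.2.1 (α := α') (by omega)
      (by omega)
    exact ⟨γ, hα'.soft hv (by omega) hγ hp1 hp2 hq1 hq2 (hγ.mem_AllConfig hα'.mem_AllConfig),
      hs'.comm_soft hs hγ⟩

/-- Every configuration of `M` other than the free one arises from another one by a strict pair
creation at a symmetric mode or by a soft pair creation. -/
lemma InM.eq_free_or_exists_pred (hρ : 0 < ρ) (h1 : ρ < 1) (h : InM ρ kc N α) :
    α = Finsupp.single 0 N ∨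
    (∃ k α', InM ρ kc N α' ∧ k ∈ PL ρ ∪ PIH ρ ∧ (k ∈ PL ρ → α' k = α' (-k)) ∧
      IsStrictPair k α' α) ∨
    (∃ u p q α', InM ρ kc N α' ∧ α' u = α' (-u) ∧ IsSoftPair ρ u p q α' α) := by
  have hα := h
  cases h with
  | free => exact Or.inl rfl
  | @strict_high α' _ k hα' hk hs _ =>
    exact Or.inr (Or.inl ⟨k, α', hα', Or.inr hk,
      fun h => absurd hk (notMem_PIH_of_PL hρ h1 h), hs⟩)
  | @strict_low α' _ k hα' hk _ hs _ =>
    by_cases hsym : α' k = α' (-k)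
    · exact Or.inr (Or.inl ⟨k, α', hα', Or.inl hk, fun _ => hsym, hs⟩)
    -- A strict pair at an asymmetric mode also changes the factor `occMax`, so `rawCoeff_strict`
    -- does not apply. The soft pair that caused the asymmetry is undone instead.
    · have hk' := neg_mem_PL.2 hk
      have e := hs.apply_symm hs.1
      have b1 := (hα'.low_bounds hρ h1 hk).1
      have b2 := (hα'.low_bounds hρ h1 hk').1
      rw [neg_neg] at b2
      rcases lt_or_gt_of_ne hsym with hlt | hlt
      · obtain ⟨γ, p, q, g1, g2, g3⟩ := hα.exists_soft_removal hρ h1 hk (by omega)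
        exact Or.inr (Or.inr ⟨k, p, q, γ, g1, g2, g3⟩)
      · obtain ⟨γ, p, q, g1, g2, g3⟩ := hα.exists_soft_removal hρ h1 hk' (by rw [neg_neg]; omega)
        exact Or.inr (Or.inr ⟨-k, p, q, γ, g1, g2, g3⟩)
  | soft hα' _ hsym hs _ _ _ _ _ => exact Or.inr (Or.inr ⟨_, _, _, _, hα', hsym, hs⟩)

end structureM

/-! ### Weights of configurations -/

lemma norm_csqrt_sq (x : ℝ) : ‖csqrt x‖ ^ 2 = |x| := by
  unfold csqrt
  split_ifs with h
  · rw [norm_mul, Complex.norm_I, mul_one, Complex.norm_real,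
      Real.norm_of_nonneg (Real.sqrt_nonneg _), Real.sq_sqrt (abs_nonneg x)]
  · rw [Complex.norm_real, Real.norm_of_nonneg (Real.sqrt_nonneg _),
      Real.sq_sqrt (not_lt.1 h), abs_of_nonneg (not_lt.1 h)]

section weights
variable {V w : Space → ℝ} {ρ kc : ℝ} {N : ℕ} {α β : Occ} {k u p q : Mode}

/-- `|λ_k|`, with the value `1` on the condensate. -/
def lamAbs (V w : Space → ℝ) (ρ : ℝ) (k : Mode) : ℝ := if k = 0 then 1 else |lam V w ρ k|

lemma lamAbs_of_ne (h : k ≠ 0) : lamAbs V w ρ k = |lam V w ρ k| := if_neg h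

/-- The contribution of the excited particles to the weight, as a multiplicative function. -/
def occWeight (V w : Space → ℝ) (ρ : ℝ) (α : Occ) : ℝ := α.prod fun k n => lamAbs V w ρ k ^ n

lemma occWeight_add (α β : Occ) :
    occWeight V w ρ (α + β) = occWeight V w ρ α * occWeight V w ρ β :=
  Finsupp.prod_add_index' (fun _ => pow_zero _) (fun _ _ _ => pow_add _ _ _)

lemma occWeight_single (k : Mode) (n : ℕ) :
    occWeight V w ρ (Finsupp.single k n) = lamAbs V w ρ k ^ n :=
  Finsupp.prod_single_index (pow_zero _)

lemma occWeight_single_zero (n : ℕ) : occWeight V w ρ (Finsupp.single 0 n) = 1 := by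
  rw [occWeight_single, lamAbs, if_pos rfl, one_pow]

/-- The contribution of the asymmetric low modes to the weight. -/
def asymWeight (V w : Space → ℝ) (ρ : ℝ) (α : Occ) : ℝ :=
  ∏ u ∈ asymModes ρ α, (4 * (occMax α u : ℝ) * |lam V w ρ u| / boxVolume ρ)

lemma rawCoeff_sq (hρ : 0 < ρ) (α : Occ) :
    ‖rawCoeff V w ρ α‖ ^ 2 =
      boxVolume ρ ^ (α 0) / (Nat.factorial (α 0) : ℝ) * occWeight V w ρ α *
        asymWeight V w ρ α := by
  have hB := boxVolume_pos hρ
  rw [rawCoeff, norm_mul, norm_mul, mul_pow, mul_pow, norm_prod, norm_prod,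
    ← Finset.prod_pow, ← Finset.prod_pow, Complex.norm_real,
    Real.norm_of_nonneg (Real.sqrt_nonneg _), Real.sq_sqrt (by positivity)]
  congr 1
  · congr 1
    rw [occWeight, Finsupp.prod]
    have h0 : ∀ k ∈ α.support, k ∉ α.support.erase 0 → lamAbs V w ρ k ^ α k = 1 := by
      intro k hk hk'
      have : k = 0 := by
        by_contra h; exact hk' (Finset.mem_erase.2 ⟨h, hk⟩)
      subst this
      rw [lamAbs, if_pos rfl, one_pow]
    rw [← Finset.prod_subset (Finset.erase_subset 0 α.support) h0]
    refine Finset.prod_congr rfl fun k hk => ?_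
    rw [norm_pow, ← pow_mul, mul_comm, pow_mul, norm_csqrt_sq,
      lamAbs_of_ne (Finset.ne_of_mem_erase hk)]
  · refine Finset.prod_congr rfl fun u _ => ?_
    rw [norm_csqrt_sq, abs_div, abs_mul, abs_of_pos hB,
      abs_of_nonneg (by positivity : (0 : ℝ) ≤ 4 * (occMax α u : ℝ))]

lemma asymWeight_strict (hρ : 0 < ρ) (h : IsStrictPair k α β)
    (hsym : k ∈ PL ρ → α k = α (-k)) : asymWeight V w ρ β = asymWeight V w ρ α := by
  rw [asymWeight, asymWeight, asymModes_strict hρ h]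
  refine Finset.prod_congr rfl fun v hv => ?_
  rw [mem_asymModes] at hv
  have hv0 : v ≠ 0 := fun e => zero_notMem_PL hρ (e ▸ hv.1)
  have c1 : v ≠ k := by
    rintro rfl; have := hsym hv.1; omega
  have c2 : v ≠ -k := by
    rintro rfl; have := hsym (neg_mem_PL.1 hv.1); rw [neg_neg] at hv; omega
  rw [occMax, occMax, h.apply_other hv0 c1 c2, h.apply_other (neg_ne_zero.2 hv0)
    (fun e => c2 (by rw [← e, neg_neg])) (fun e => c1 (neg_inj.1 e))]

lemma asymWeight_soft (hρ : 0 < ρ) (h1 : ρ < 1) (h : IsSoftPair ρ u p q α β)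
    (hsym : α u = α (-u)) : asymWeight V w ρ β =
      (4 * (α u : ℝ) * |lam V w ρ u| / boxVolume ρ) * asymWeight V w ρ α := by
  classical
  have hu0 : u ≠ 0 := fun e => zero_notMem_PL hρ (e ▸ h.1)
  rw [asymWeight, asymModes_soft hρ h1 h hsym, Finset.prod_insert (notMem_asymModes hsym)]
  have e1 := h.apply_PL hρ h1 h.1
  have e2 := h.apply_PL hρ h1 (neg_mem_PL.2 h.1)
  rw [if_pos rfl] at e1
  rw [if_neg (mode_ne_neg hu0)] at e2
  congr 1
  · rw [occMax, show max (β u) (β (-u)) = α u by omega]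
  · refine Finset.prod_congr rfl fun v hv => ?_
    rw [mem_asymModes] at hv
    have d1 := h.apply_PL hρ h1 hv.1
    have d2 := h.apply_PL hρ h1 (neg_mem_PL.2 hv.1)
    have c1 : u ≠ v := by rintro rfl; omega
    have c2 : u ≠ -v := by rintro rfl; rw [neg_neg] at hsym; omega
    rw [if_neg c1] at d1
    rw [if_neg c2] at d2
    rw [occMax, occMax, show max (β v) (β (-v)) = max (α v) (α (-v)) by omega]

lemma pow_div_factorial_succ (B : ℝ) (hB : 0 < B) (n : ℕ) :
    B ^ n / (Nat.factorial n : ℝ) =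
      B ^ (n + 1) / (Nat.factorial (n + 1) : ℝ) * (((n + 1 : ℕ) : ℝ) / B) := by
  rw [Nat.factorial_succ]
  push_cast
  have : (Nat.factorial n : ℝ) ≠ 0 := by positivity
  field_simp
  ring

/-- The weight ratio of a strict pair creation. -/
lemma rawCoeff_strict (hρ : 0 < ρ) (h : IsStrictPair k α β)
    (hsym : k ∈ PL ρ → α k = α (-k)) :
    ‖rawCoeff V w ρ β‖ ^ 2 =
      (α 0 * (α 0 - 1) / boxVolume ρ ^ 2 * (|lam V w ρ k| * |lam V w ρ (-k)|)) *
        ‖rawCoeff V w ρ α‖ ^ 2 := by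
  have hB := boxVolume_pos hρ
  rw [rawCoeff_sq hρ, rawCoeff_sq hρ, asymWeight_strict hρ h hsym]
  have hw := congrArg (occWeight V w ρ) h.2
  simp only [occWeight_add, occWeight_single_zero] at hw
  rw [occWeight_single, occWeight_single, lamAbs_of_ne h.1, lamAbs_of_ne (neg_ne_zero.2 h.1)] at hw
  simp only [mul_one, pow_one] at hw
  rw [hw, ← h.apply_zero, pow_div_factorial_succ _ hB (β 0), pow_div_factorial_succ _ hB (β 0 + 1)]
  push_cast
  ring

/-- The weight ratio of a soft pair creation. -/
lemma rawCoeff_soft (hρ : 0 < ρ) (h1 : ρ < 1) (h : IsSoftPair ρ u p q α β)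
    (hsym : α u = α (-u)) :
    ‖rawCoeff V w ρ β‖ ^ 2 =
      (4 * α u * α 0 / boxVolume ρ ^ 2 * (|lam V w ρ p| * |lam V w ρ q|)) *
        ‖rawCoeff V w ρ α‖ ^ 2 := by
  have hB := boxVolume_pos hρ
  have hu : u ≠ 0 := fun e => zero_notMem_PL hρ (e ▸ h.1)
  have hp : p ≠ 0 := fun e => zero_notMem_PIH hρ h1 (e ▸ PH_subset_PIH h.2.1)
  have hq : q ≠ 0 := fun e => zero_notMem_PIH hρ h1 (e ▸ PH_subset_PIH h.2.2.1)
  rw [rawCoeff_sq hρ, rawCoeff_sq hρ, asymWeight_soft hρ h1 h hsym]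
  have hw := congrArg (occWeight V w ρ) h.2.2.2.2
  simp only [occWeight_add, occWeight_single_zero] at hw
  rw [occWeight_single, occWeight_single, occWeight_single, lamAbs_of_ne hu, lamAbs_of_ne hp,
    lamAbs_of_ne hq] at hw
  simp only [mul_one, pow_one] at hw
  rw [← h.apply_zero hρ h1, pow_div_factorial_succ _ hB (β 0)]
  push_cast
  -- The factor `|λ_u|` of the new asymmetric mode replaces that of the particle removed from `u`.
  -- They are matched without division, because `λ_u = 0` when `g₀ = 0`.
  calc _ = boxVolume ρ ^ (β 0 + 1) / ((β 0 + 1).factorial : ℝ) * ((β 0 + 1) / boxVolume ρ) *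
        (occWeight V w ρ β * |lam V w ρ u|) * (4 * α u / boxVolume ρ * asymWeight V w ρ α) := by
        ring
    _ = _ := by rw [hw]; ring

lemma rawCoeff_free_pos (hρ : 0 < ρ) : 0 < ‖rawCoeff V w ρ (Finsupp.single 0 N)‖ ^ 2 := by
  have hB := boxVolume_pos hρ
  have : asymModes ρ (Finsupp.single 0 N) = ∅ := by
    refine Finset.eq_empty_of_forall_notMem fun u hu => ?_
    rw [mem_asymModes] at hu
    have hu0 : u ≠ 0 := fun e => zero_notMem_PL hρ (e ▸ hu.1)
    have := hu.2
    simp [hu0.symm, (neg_ne_zero.2 hu0).symm] at this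
  rw [rawCoeff_sq hρ, asymWeight, this, occWeight_single_zero, Finset.prod_empty]
  positivity

/-! ### Size of the coefficients -/

lemma g0_eq (V w : Space → ℝ) : g0 V w = ∫ x, V x * (1 - w x) := by
  have := Real.pi_ne_zero
  rw [g0, scatteringLength]; field_simp

lemma potential_mul_nonneg (hV : IsPotential V) (hw : IsScatteringSolution V w) (x : Space) :
    0 ≤ V x * (1 - w x) := mul_nonneg (hV.nonneg x) (by linarith [hw.lt_one x])

lemma g0_nonneg (hV : IsPotential V) (hw : IsScatteringSolution V w) : 0 ≤ g0 V w := by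
  rw [g0_eq]; exact integral_nonneg (potential_mul_nonneg hV hw)

lemma abs_wHat_le (hV : IsPotential V) (hw : IsScatteringSolution V w) (x : Space) :
    |wHat V w x| ≤ g0 V w / ‖x‖ ^ 2 := by
  rw [wHat, abs_div, abs_of_nonneg (sq_nonneg ‖x‖)]
  gcongr
  refine (Complex.abs_re_le_norm _).trans ?_
  rw [fourier, g0_eq]
  refine (norm_integral_le_integral_norm _).trans (le_of_eq ?_)
  congr 1
  ext y
  rw [norm_mul, Complex.norm_real, Real.norm_of_nonneg (potential_mul_nonneg hV hw y),
    Complex.norm_exp]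
  simp

/-- The momentum in units of `√ρ`. -/
def scaled (ρ : ℝ) (k : Mode) : ℝ := ‖momentum ρ k‖ / ρ ^ (1 / 2 : ℝ)

lemma scaled_neg (ρ : ℝ) (k : Mode) : scaled ρ (-k) = scaled ρ k := by
  rw [scaled, scaled, norm_momentum_neg]

lemma norm_momentum_sq (hρ : 0 < ρ) (k : Mode) : ‖momentum ρ k‖ ^ 2 = scaled ρ k ^ 2 * ρ := by
  have h : (ρ ^ (1 / 2 : ℝ)) ^ 2 = ρ := by
    rw [← Real.rpow_natCast, ← Real.rpow_mul hρ.le]; norm_num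
  have h0 : ρ ^ (1 / 2 : ℝ) ≠ 0 := (Real.rpow_pos_of_pos hρ _).ne'
  rw [scaled, div_pow, h]; field_simp

lemma mem_PL_iff (hρ : 0 < ρ) :
    k ∈ PL ρ ↔ ρ ^ eta ≤ scaled ρ k ∧ scaled ρ k ≤ ρ ^ (-eta) := by
  have h0 : 0 < ρ ^ (1 / 2 : ℝ) := Real.rpow_pos_of_pos hρ _
  rw [scaled, le_div_iff₀ h0, div_le_iff₀ h0, PL, low_edge_eq hρ]; rfl

lemma mem_PIH_iff (hρ : 0 < ρ) (h1 : ρ < 1) : k ∈ PIH ρ ↔ ρ ^ (-eta) < scaled ρ k := by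
  have h0 : 0 < ρ ^ (1 / 2 : ℝ) := Real.rpow_pos_of_pos hρ _
  rw [scaled, lt_div_iff₀ h0, mem_PIH hρ h1, low_edge_eq hρ]

lemma lam_PL_sq (hρ : 0 < ρ) (hk : k ∈ PL ρ) :
    |lam V w ρ k| * |lam V w ρ (-k)| = bogX (4 * g0 V w) (scaled ρ k) / ρ ^ 2 := by
  have hk' := neg_mem_PL.2 hk
  rw [lam, lam, if_pos hk, if_pos hk', norm_momentum_neg, ← abs_mul, norm_momentum_sq hρ,
    show 4 * ρ * g0 V w / (scaled ρ k ^ 2 * ρ) = 4 * g0 V w / scaled ρ k ^ 2 by field_simp,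
    bogX, bogS, abs_of_nonneg (mul_self_nonneg _)]
  rw [← sq, mul_pow, ← neg_sub, neg_div, neg_sq, inv_pow, div_eq_mul_inv _ (ρ ^ 2),
    add_comm 1 (Real.sqrt _)]

open Classical in
/-- Upper bound `(ρ w_k)²` for the squared coefficients outside `P_L`. -/
def tailWeight (V w : Space → ℝ) (ρ : ℝ) (k : Mode) : ℝ :=
  if k ∈ PIH ρ then (g0 V w / scaled ρ k ^ 2) ^ 2 else 0

lemma tailWeight_nonneg (k : Mode) : 0 ≤ tailWeight V w ρ k := by
  unfold tailWeight; split_ifs <;> positivity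

lemma tailWeight_neg (k : Mode) : tailWeight V w ρ (-k) = tailWeight V w ρ k := by
  by_cases hk : k ∈ PIH ρ <;> simp [tailWeight, neg_mem_PIH, scaled_neg, hk]

lemma lam_PIH_sq_le (hV : IsPotential V) (hw : IsScatteringSolution V w) (hρ : 0 < ρ)
    (h1 : ρ < 1) (hk : k ∈ PIH ρ) : lam V w ρ k ^ 2 ≤ tailWeight V w ρ k / ρ ^ 2 := by
  have hk' : k ∉ PL ρ := fun h => notMem_PIH_of_PL hρ h1 h hk
  rw [lam, if_neg hk', tailWeight, if_pos hk, neg_sq, ← sq_abs, ← div_pow]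
  refine pow_le_pow_left₀ (abs_nonneg _) ((abs_wHat_le hV hw _).trans (le_of_eq ?_)) 2
  rw [norm_momentum_sq hρ, div_div]

/-- The arithmetic-geometric mean inequality separates the two momenta of a pair, so that for fixed
`u` the sum over `p` with `q = u - p` is just `tailSum`. -/
lemma lam_mul_PIH_le (hV : IsPotential V) (hw : IsScatteringSolution V w) (hρ : 0 < ρ)
    (h1 : ρ < 1) (hp : p ∈ PIH ρ) (hq : q ∈ PIH ρ) :
    |lam V w ρ p| * |lam V w ρ q| ≤
      (tailWeight V w ρ p + tailWeight V w ρ q) / 2 / ρ ^ 2 := by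
  have e1 := lam_PIH_sq_le hV hw hρ h1 hp
  have e2 := lam_PIH_sq_le hV hw hρ h1 hq
  have e3 := two_mul_le_add_sq |lam V w ρ p| |lam V w ρ q|
  rw [sq_abs, sq_abs] at e3
  have : (tailWeight V w ρ p + tailWeight V w ρ q) / 2 / ρ ^ 2 =
    (tailWeight V w ρ p / ρ ^ 2 + tailWeight V w ρ q / ρ ^ 2) / 2 := by ring
  rw [this]; linarith

lemma tailWeight_le (hρ : 0 < ρ) (h1 : ρ < 1) (k : Mode) :
    tailWeight V w ρ k ≤ (g0 V w * ρ ^ (2 * eta)) ^ 2 := by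
  unfold tailWeight
  split_ifs with hk
  · rw [mem_PIH_iff hρ h1] at hk
    have h0 : 0 < ρ ^ (-eta) := Real.rpow_pos_of_pos hρ _
    rw [div_eq_mul_inv, mul_pow, mul_pow]
    gcongr
    rw [two_mul, Real.rpow_add hρ, ← sq]
    refine inv_le_of_inv_le₀ (by positivity) ?_
    rw [← inv_pow, ← Real.rpow_neg hρ.le]
    gcongr
  · positivity

end weights

/-! ### Comparison of sums along partial maps -/

/-- Choosing a preimage for each `a` gives an injection, since `T` recovers `a`; no uniqueness of
the preimage is required. In the applications `T` performs or undoes a pair move, so the pair to be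
removed may be chosen freely. -/
lemma tsum_le_of_transfer {A K : Type*} {φ : A → ℝ} {ψ : K → ℝ} (hφ : ∀ a, 0 ≤ φ a)
    (hψ : ∀ k, 0 ≤ ψ k) (hs : Summable ψ) (T : K → A)
    (h : ∀ a, φ a ≠ 0 → ∃ k, T k = a ∧ φ a ≤ ψ k) :
    Summable φ ∧ ∑' a, φ a ≤ ∑' k, ψ k := by
  classical
  have key : ∀ s : Finset A, ∑ a ∈ s, φ a ≤ ∑' k, ψ k := by
    intro s
    choose g hg1 hg2 using h
    set s' := s.filter (fun a => φ a ≠ 0) with hs'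
    have hmem : ∀ a : {x // x ∈ s'}, φ a.1 ≠ 0 := fun a => (Finset.mem_filter.1 a.2).2
    have e : ∑ a ∈ s, φ a = ∑ a ∈ s', φ a := (Finset.sum_filter_ne_zero s).symm
    rw [e, ← Finset.sum_attach]
    have hinj : Set.InjOn (fun a : {x // x ∈ s'} => g a.1 (hmem a)) s'.attach := by
      intro a _ b _ hab
      have := congrArg T hab
      simp only [hg1] at this
      exact Subtype.ext this
    calc ∑ a ∈ s'.attach, φ a.1 ≤ ∑ a ∈ s'.attach, ψ (g a.1 (hmem a)) :=
          Finset.sum_le_sum fun a _ => hg2 _ _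
      _ = ∑ k ∈ s'.attach.image (fun a => g a.1 (hmem a)), ψ k := (Finset.sum_image hinj).symm
      _ ≤ ∑' k, ψ k := hs.sum_le_tsum _ fun k _ => hψ k
  exact ⟨summable_of_sum_le hφ key, Real.tsum_le_of_sum_le hφ key⟩

/-! ### Expectations for discrete probability weights -/

section expectation
variable {P : Occ → ℝ} {φ ψ : Occ → ℝ}

/-- Expectation of `φ` for the weights `P`. -/
def expect (P φ : Occ → ℝ) : ℝ := ∑' α, φ α * P α

/-- `φ` is bounded on the support of `P`. -/
def BddOn (P φ : Occ → ℝ) : Prop := ∃ C, ∀ α, P α ≠ 0 → |φ α| ≤ C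

lemma BddOn.add (h : BddOn P φ) (h' : BddOn P ψ) : BddOn P fun α => φ α + ψ α := by
  obtain ⟨C, hC⟩ := h
  obtain ⟨D, hD⟩ := h'
  exact ⟨C + D, fun α hα => (abs_add_le _ _).trans (add_le_add (hC α hα) (hD α hα))⟩

lemma BddOn.const (c : ℝ) : BddOn P fun _ => c := ⟨|c|, fun _ _ => le_rfl⟩

lemma BddOn.mul (h : BddOn P φ) (h' : BddOn P ψ) : BddOn P fun α => φ α * ψ α := by
  obtain ⟨C, hC⟩ := h
  obtain ⟨D, hD⟩ := h'
  refine ⟨C * D, fun α hα => ?_⟩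
  rw [abs_mul]
  exact mul_le_mul (hC α hα) (hD α hα) (abs_nonneg _) ((abs_nonneg _).trans (hC α hα))

lemma BddOn.const_mul (c : ℝ) (h : BddOn P φ) : BddOn P fun α => c * φ α :=
  (BddOn.const c).mul h

lemma BddOn.ite (p : Occ → Prop) [DecidablePred p] (h : BddOn P φ) :
    BddOn P fun α => if p α then φ α else 0 := by
  obtain ⟨C, hC⟩ := h
  refine ⟨C, fun α hα => ?_⟩
  dsimp only
  split_ifs
  · exact hC α hα
  · rw [abs_zero]; exact (abs_nonneg _).trans (hC α hα)

lemma BddOn.sum {ι : Type*} (s : Finset ι) {f : ι → Occ → ℝ} (h : ∀ i ∈ s, BddOn P (f i)) :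
    BddOn P fun α => ∑ i ∈ s, f i α := by
  classical
  induction s using Finset.induction_on with
  | empty => simpa using BddOn.const 0
  | insert i s hi ih =>
    simp only [Finset.sum_insert hi]
    exact (h i (Finset.mem_insert_self _ _)).add (ih fun j hj => h j (Finset.mem_insert_of_mem hj))

lemma summable_expect (hP0 : ∀ α, 0 ≤ P α) (hP : HasSum P 1) (h : BddOn P φ) :
    Summable fun α => φ α * P α := by
  obtain ⟨C, hC⟩ := h
  refine Summable.of_norm_bounded (hP.summable.mul_left C) fun α => ?_
  rw [Real.norm_eq_abs, abs_mul, abs_of_nonneg (hP0 α)]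
  by_cases hα : P α = 0
  · simp [hα]
  · exact mul_le_mul_of_nonneg_right (hC α hα) (hP0 α)

lemma expect_add (hP0 : ∀ α, 0 ≤ P α) (hP : HasSum P 1) (h : BddOn P φ) (h' : BddOn P ψ) :
    expect P (fun α => φ α + ψ α) = expect P φ + expect P ψ := by
  unfold expect
  rw [← (summable_expect hP0 hP h).tsum_add (summable_expect hP0 hP h')]
  simp only [add_mul]

lemma expect_const_mul (c : ℝ) : expect P (fun α => c * φ α) = c * expect P φ := by
  unfold expect
  rw [← tsum_mul_left]
  simp only [mul_assoc]

lemma expect_const (hP : HasSum P 1) (c : ℝ) : expect P (fun _ => c) = c := by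
  unfold expect
  rw [tsum_mul_left, hP.tsum_eq, mul_one]

lemma expect_mono (hP0 : ∀ α, 0 ≤ P α) (hP : HasSum P 1) (h : BddOn P φ) (h' : BddOn P ψ)
    (hle : ∀ α, P α ≠ 0 → φ α ≤ ψ α) : expect P φ ≤ expect P ψ := by
  refine (summable_expect hP0 hP h).tsum_le_tsum (fun α => ?_) (summable_expect hP0 hP h')
  by_cases hα : P α = 0
  · simp [hα]
  · exact mul_le_mul_of_nonneg_right (hle α hα) (hP0 α)

lemma expect_congr (h : ∀ α, P α ≠ 0 → φ α = ψ α) : expect P φ = expect P ψ := by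
  unfold expect
  congr 1
  ext α
  by_cases hα : P α = 0
  · simp [hα]
  · rw [h α hα]

lemma expect_nonneg (hP0 : ∀ α, 0 ≤ P α) (h : ∀ α, 0 ≤ φ α) : 0 ≤ expect P φ :=
  tsum_nonneg fun α => mul_nonneg (h α) (hP0 α)

lemma expect_sum (hP0 : ∀ α, 0 ≤ P α) (hP : HasSum P 1) {ι : Type*} (s : Finset ι)
    {f : ι → Occ → ℝ} (h : ∀ i ∈ s, BddOn P (f i)) :
    expect P (fun α => ∑ i ∈ s, f i α) = ∑ i ∈ s, expect P (f i) := by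
  unfold expect
  rw [← Summable.tsum_finsetSum fun i hi => summable_expect hP0 hP (h i hi)]
  simp only [Finset.sum_mul]

/-- Interchange of the expectation with the sum over all momenta. -/
lemma hasSum_expect_apply (hP0 : ∀ α, 0 ≤ P α) (hP : HasSum P 1) {τ : Occ → Occ}
    (h : BddOn P fun α => ((τ α).degree : ℝ)) :
    HasSum (fun k => expect P fun α => (τ α k : ℝ)) (expect P fun α => ((τ α).degree : ℝ)) := by
  have hrow : ∀ α, HasSum (fun k => (τ α k : ℝ) * P α) (((τ α).degree : ℝ) * P α) := by
    intro α
    refine HasSum.mul_right _ ?_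
    rw [Finsupp.degree_apply, Nat.cast_sum]
    exact hasSum_sum_of_ne_finset_zero fun k hk => by
      rw [Finsupp.notMem_support_iff.1 hk, Nat.cast_zero]
  have hs : Summable fun x : Occ × Mode => (τ x.1 x.2 : ℝ) * P x.1 := by
    rw [summable_prod_of_nonneg fun x => mul_nonneg (Nat.cast_nonneg _) (hP0 _)]
    refine ⟨fun α => (hrow α).summable, ?_⟩
    simp only [(hrow _).tsum_eq]
    exact summable_expect hP0 hP h
  have hs' : Summable fun x : Mode × Occ => (τ x.2 x.1 : ℝ) * P x.2 := hs.prod_symm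
  have h1 := hs'.hasSum.prod_fiberwise fun k => (hs'.prod_factor k).hasSum
  have e : ∑' x : Mode × Occ, (τ x.2 x.1 : ℝ) * P x.2 = expect P fun α => ((τ α).degree : ℝ) := by
    rw [← (Equiv.prodComm Occ Mode).tsum_eq]
    simp only [Equiv.prodComm_apply, Prod.fst_swap, Prod.snd_swap]
    rw [hs.tsum_prod' fun α => (hrow α).summable]
    simp only [(hrow _).tsum_eq]
    rfl
  rw [e] at h1
  exact h1

end expectation

/-! ### Normalizability of the trial state -/

section model
variable {V w : Space → ℝ} {ρ kc : ℝ} {N : ℕ} {α β : Occ} {k u p q : Mode}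

lemma InM.apply_le (h : InM ρ kc N α) (k : Mode) : α k ≤ N := by
  rw [← (BoseGas.mem_AllConfig.1 h.mem_AllConfig).2]
  exact Finsupp.le_degree k α

open Classical in
/-- The squared coefficients of occupied momenta. -/
def lamSq (V w : Space → ℝ) (ρ : ℝ) (k : Mode) : ℝ :=
  if k ∈ PL ρ ∪ PIH ρ then lam V w ρ k ^ 2 else 0

lemma lamSq_nonneg (k : Mode) : 0 ≤ lamSq V w ρ k := by unfold lamSq; split_ifs <;> positivity

lemma summable_lamSq (hV : IsPotential V) (hw : IsScatteringSolution V w) (hρ : 0 < ρ)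
    (h1 : ρ < 1) (hS : Summable (tailWeight V w ρ)) : Summable (lamSq V w ρ) := by
  have hfin : Summable fun k => (PL ρ).indicator (fun k => lam V w ρ k ^ 2) k :=
    summable_of_hasFiniteSupport ((finite_PL hρ).subset Set.support_indicator_subset)
  refine Summable.of_nonneg_of_le lamSq_nonneg (fun k => ?_) (hfin.add (hS.div_const (ρ ^ 2)))
  by_cases hk : k ∈ PL ρ
  · have := tailWeight_nonneg (V := V) (w := w) (ρ := ρ) k
    simp only [lamSq, Set.mem_union, hk, true_or, if_true, Set.indicator_of_mem]
    have : 0 ≤ tailWeight V w ρ k / ρ ^ 2 := by positivity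
    linarith
  · rw [Set.indicator_of_notMem hk, zero_add]
    by_cases hk' : k ∈ PIH ρ
    · simp only [lamSq, Set.mem_union, hk', or_true, if_true]
      exact lam_PIH_sq_le hV hw hρ h1 hk'
    · simp only [lamSq, Set.mem_union, hk, hk', or_self, if_false]
      exact div_nonneg (tailWeight_nonneg k) (sq_nonneg ρ)

/-- Moving a particle of momentum `0` and one of momentum `u` to the momenta `p` and `u - p`. -/
def pairMap (u p : Mode) (α : Occ) : Occ :=
  α + Finsupp.single p 1 + Finsupp.single (u - p) 1 - (Finsupp.single 0 1 + Finsupp.single u 1)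

lemma IsStrictPair.pairMap_eq (h : IsStrictPair k α β) : pairMap 0 k α = β := by
  rw [pairMap, zero_sub, ← h.2, ← Finsupp.single_add, add_tsub_cancel_right]

lemma IsSoftPair.pairMap_eq (h : IsSoftPair ρ u p q α β) : pairMap u p α = β := by
  have hq : u - p = q := by rw [← h.2.2.2.1]; abel
  rw [pairMap, hq, ← h.2.2.2.2, add_assoc, add_tsub_cancel_right]

lemma abs_mul_le_lamSq (hp : p ∈ PL ρ ∪ PIH ρ) (hq : q ∈ PL ρ ∪ PIH ρ) :
    |lam V w ρ p| * |lam V w ρ q| ≤ lamSq V w ρ p + lamSq V w ρ q := by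
  rw [lamSq, lamSq, if_pos hp, if_pos hq]
  have := two_mul_le_add_sq |lam V w ρ p| |lam V w ρ q|
  rw [sq_abs, sq_abs] at this
  have h2 : 0 ≤ |lam V w ρ p| * |lam V w ρ q| := by positivity
  linarith

-- `P_H` is unbounded and `M` may be infinite, so normalizability has to be proved. The induction is
-- on the allowed number `n` of excited particles: every configuration except the free one comes
-- from one with fewer, at a cost summable over the created momenta.
open Classical in
lemma summable_level (hV : IsPotential V) (hw : IsScatteringSolution V w) (hρ : 0 < ρ)
    (h1 : ρ < 1) (hS : Summable (tailWeight V w ρ)) (kc : ℝ) (N n : ℕ) :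
    Summable fun α => if InM ρ kc N α ∧ N ≤ α 0 + n then ‖rawCoeff V w ρ α‖ ^ 2 else 0 := by
  have hB := boxVolume_pos hρ
  set K : ℝ := 4 * N ^ 2 / boxVolume ρ ^ 2 with hK
  have hK0 : 0 ≤ K := by positivity
  have hl := summable_lamSq hV hw hρ h1 hS
  -- The first entry is the total momentum of the pair: `0` stands for a strict pair, an element of
  -- `P_L` for a soft one. The constant `K` crudely bounds both occupation prefactors.
  set c : Mode × Mode → ℝ := fun x => if x.1 ∈ insert 0 (PL ρ) then
    K * (lamSq V w ρ x.2 + lamSq V w ρ (x.1 - x.2)) else 0 with hc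
  have hc0 : ∀ x, 0 ≤ c x := by
    intro x
    have := lamSq_nonneg (V := V) (w := w) (ρ := ρ) x.2
    have := lamSq_nonneg (V := V) (w := w) (ρ := ρ) (x.1 - x.2)
    simp only [hc]; split_ifs <;> positivity
  have hcs : Summable c := by
    rw [summable_prod_of_nonneg hc0]
    constructor
    · intro u
      by_cases hu : u ∈ insert 0 (PL ρ)
      · simp only [hc, hu, if_true]
        exact (hl.add ((Equiv.subLeft u).summable_iff.2 hl)).mul_left K
      · simp only [hc, hu, if_false]; exact summable_zero
    · refine summable_of_hasFiniteSupport (((finite_PL hρ).insert 0).subset fun u hu => ?_)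
      by_contra hu'
      refine hu ?_
      simp only [hc, hu', if_false, tsum_zero]
  have hfree : ∀ f : Occ → ℝ, Summable (fun α => if α = Finsupp.single 0 N then 0 else f α) →
      Summable f := by
    intro f hf
    have h2 : Summable fun α : Occ => if α = Finsupp.single 0 N then f (Finsupp.single 0 N) else 0 :=
      (hasSum_ite_eq _ _).summable
    refine (hf.add h2).congr fun α => ?_
    split_ifs with h
    · rw [h, zero_add]
    · rw [add_zero]
  induction n with
  | zero =>
    apply hfree
    refine summable_zero.congr fun α => ?_
    split_ifs with h2 h3
    · rfl
    · exfalso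
      apply h2
      obtain ⟨hm, h0⟩ := h3
      have hd := (mem_AllConfig.1 hm.mem_AllConfig).2
      have h0' := hm.apply_le 0
      have hz : α 0 = N := by omega
      have hsplit := Finsupp.single_add_erase 0 α
      have : (α.erase 0).degree = 0 := by
        have := congrArg Finsupp.degree hsplit
        rw [map_add, Finsupp.degree_single] at this
        omega
      rw [Finsupp.degree_eq_zero_iff] at this
      rw [this, add_zero, hz] at hsplit
      exact hsplit.symm
    · rfl
  | succ n ih =>
    apply hfree
    have hprod := ih.mul_of_nonneg hcs (fun α => by simp only [Pi.zero_apply]; split_ifs <;> positivity) hc0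
    refine (tsum_le_of_transfer (fun α => by split_ifs <;> positivity)
      (fun x => mul_nonneg (by split_ifs <;> positivity) (hc0 _)) hprod
      (fun x => pairMap x.2.1 x.2.2 x.1) fun α hα => ?_).1
    split_ifs at hα with h2 h3
    · exact absurd rfl hα
    · rw [if_neg h2, if_pos h3]
      obtain ⟨hm, hn⟩ := h3
      rcases hm.eq_free_or_exists_pred hρ h1 with h | ⟨k, α', hα', hk, hsym, hs⟩ |
        ⟨u, p, q, α', hα', hsym, hs⟩
      · exact absurd h h2
      · have h0 := hs.apply_zero
        refine ⟨(α', (0, k)), hs.pairMap_eq, ?_⟩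
        simp only
        rw [if_pos ⟨hα', by omega⟩, rawCoeff_strict hρ hs hsym, mul_comm]
        refine mul_le_mul_of_nonneg_left ?_ (sq_nonneg _)
        simp only [hc, Set.mem_insert_iff, true_or, if_true, zero_sub, hK]
        have hk' : -k ∈ PL ρ ∪ PIH ρ := by
          rcases hk with h | h
          · exact Or.inl (neg_mem_PL.2 h)
          · exact Or.inr (neg_mem_PIH.2 h)
        have e1 : (α' 0 : ℝ) ≤ N := by exact_mod_cast hα'.apply_le 0
        have e2 : (2 : ℝ) ≤ α' 0 := by exact_mod_cast (by omega : 2 ≤ α' 0)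
        refine mul_le_mul (div_le_div_of_nonneg_right ?_ (by positivity))
          (abs_mul_le_lamSq hk hk') (by positivity) (by positivity)
        nlinarith
      · have h0 := hs.apply_zero hρ h1
        have hq : u - p = q := by rw [← hs.2.2.2.1]; abel
        refine ⟨(α', (u, p)), hs.pairMap_eq, ?_⟩
        simp only
        rw [if_pos ⟨hα', by omega⟩, rawCoeff_soft hρ h1 hs hsym, mul_comm]
        refine mul_le_mul_of_nonneg_left ?_ (sq_nonneg _)
        simp only [hc, Set.mem_insert_iff, hs.1, or_true, if_true, hq, hK]
        have e1 : (α' 0 : ℝ) ≤ N := by exact_mod_cast hα'.apply_le 0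
        have e2 : (α' u : ℝ) ≤ N := by exact_mod_cast hα'.apply_le u
        refine mul_le_mul (div_le_div_of_nonneg_right ?_ (by positivity))
          (abs_mul_le_lamSq (Or.inr (PH_subset_PIH hs.2.1))
          (Or.inr (PH_subset_PIH hs.2.2.1))) (by positivity) (by positivity)
        calc (4 : ℝ) * α' u * α' 0 ≤ 4 * N * N := by gcongr
          _ = 4 * N ^ 2 := by ring
    · exact absurd rfl hα

lemma summable_rawState (hV : IsPotential V) (hw : IsScatteringSolution V w) (hρ : 0 < ρ)
    (h1 : ρ < 1) (hS : Summable (tailWeight V w ρ)) (kc : ℝ) (N : ℕ) :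
    Summable fun α => ‖rawState V w ρ kc N α‖ ^ 2 := by
  classical
  refine (summable_level hV hw hρ h1 hS kc N N).congr fun α => ?_
  rw [rawState]
  by_cases h : InM ρ kc N α
  · rw [if_pos ⟨h, by omega⟩, if_pos h]
  · rw [if_neg (fun h' => h h'.1), if_neg h]; simp

lemma tsum_rawState_pos (hV : IsPotential V) (hw : IsScatteringSolution V w) (hρ : 0 < ρ)
    (h1 : ρ < 1) (hS : Summable (tailWeight V w ρ)) (kc : ℝ) (N : ℕ) :
    0 < ∑' α, ‖rawState V w ρ kc N α‖ ^ 2 := by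
  refine (summable_rawState hV hw hρ h1 hS kc N).tsum_pos (fun _ => sq_nonneg _)
    (Finsupp.single 0 N) ?_
  rw [rawState, if_pos InM.free]
  exact rawCoeff_free_pos hρ

/-- The probability of a configuration in the trial state. -/
def prob (V w : Space → ℝ) (ρ kc : ℝ) (N : ℕ) (α : Occ) : ℝ := ‖trialState V w ρ kc N α‖ ^ 2

lemma prob_nonneg (α : Occ) : 0 ≤ prob V w ρ kc N α := sq_nonneg _

lemma prob_eq (α : Occ) : prob V w ρ kc N α =
    normConst V w ρ kc N ^ 2 * ‖rawState V w ρ kc N α‖ ^ 2 := by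
  rw [prob, trialState, norm_mul, mul_pow, Complex.norm_real, Real.norm_eq_abs, sq_abs]

lemma hasSum_prob (hV : IsPotential V) (hw : IsScatteringSolution V w) (hρ : 0 < ρ)
    (h1 : ρ < 1) (hS : Summable (tailWeight V w ρ)) (kc : ℝ) (N : ℕ) :
    HasSum (prob V w ρ kc N) 1 := by
  have h := (summable_rawState hV hw hρ h1 hS kc N).hasSum.mul_left (normConst V w ρ kc N ^ 2)
  have hp := tsum_rawState_pos hV hw hρ h1 hS kc N
  have e : normConst V w ρ kc N ^ 2 * ∑' α, ‖rawState V w ρ kc N α‖ ^ 2 = 1 := by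
    rw [normConst, div_pow, one_pow, Real.sq_sqrt hp.le, one_div, inv_mul_cancel₀ hp.ne']
  rw [e] at h
  exact (funext fun α => prob_eq α : prob V w ρ kc N = _) ▸ h

lemma InM.of_prob (h : prob V w ρ kc N α ≠ 0) : InM ρ kc N α := by
  by_contra h'
  refine h ?_
  rw [prob_eq, rawState, if_neg h']; simp

lemma prob_ratio (hα : InM ρ kc N α) (hβ : InM ρ kc N β) {r : ℝ}
    (h : ‖rawCoeff V w ρ β‖ ^ 2 = r * ‖rawCoeff V w ρ α‖ ^ 2) :
    prob V w ρ kc N β = r * prob V w ρ kc N α := by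
  rw [prob_eq, prob_eq, rawState, rawState, if_pos hα, if_pos hβ, h]; ring

end model

/-! ### Occupation number estimates -/

section estimates
variable {V w : Space → ℝ} {ρ kc : ℝ} {N : ℕ} {α β : Occ} {k u p q : Mode}

/-- The low momenta as a finite set. -/
def lowModes (hρ : 0 < ρ) : Finset Mode := (finite_PL hρ).toFinset

lemma mem_lowModes (hρ : 0 < ρ) : u ∈ lowModes hρ ↔ u ∈ PL ρ := Set.Finite.mem_toFinset _

/-- The sum of `(ρ w_k)²` outside `P_L`, up to a constant factor. -/
def tailSum (V w : Space → ℝ) (ρ : ℝ) : ℝ := ∑' k, tailWeight V w ρ k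

lemma tailSum_nonneg : 0 ≤ tailSum V w ρ := tsum_nonneg tailWeight_nonneg

/-- Upper bound for the probability that a low mode is asymmetric. -/
def asymBound (V w : Space → ℝ) (ρ : ℝ) (N : ℕ) : ℝ := 4 * (mCut ρ + 1) * tailSum V w ρ / N

lemma asymBound_nonneg (hρ : 0 < ρ) : 0 ≤ asymBound V w ρ N := by
  have := mCut_pos hρ
  have := tailSum_nonneg (V := V) (w := w) (ρ := ρ)
  unfold asymBound; positivity

lemma occIn_le_degree (S : Set Mode) (α : Occ) : occIn S α ≤ α.degree := by
  classical
  have h := congrArg Finsupp.degree (Finsupp.filter_add_filter_not α (· ∈ S))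
  rw [map_add] at h
  rw [occIn_apply]
  omega

lemma bddOn_apply (k : Mode) : BddOn (prob V w ρ kc N) fun α => (α k : ℝ) :=
  ⟨N, fun α h => by
    rw [Nat.abs_cast]; exact_mod_cast (InM.of_prob h).apply_le k⟩

lemma bddOn_occIn (S : Set Mode) : BddOn (prob V w ρ kc N) fun α => (occIn S α : ℝ) :=
  ⟨N, fun α h => by
    rw [Nat.abs_cast]
    have h1 := occIn_le_degree S α
    rw [(mem_AllConfig.1 (InM.of_prob h).mem_AllConfig).2] at h1
    exact_mod_cast h1⟩

/-! ### Transition probabilities of single pair creations -/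

lemma prob_strict_PIH_le (hV : IsPotential V) (hw : IsScatteringSolution V w) (hρ : 0 < ρ)
    (h1 : ρ < 1) (hN : (N : ℝ) = ρ * boxVolume ρ) (hα : InM ρ kc N α) (hβ : InM ρ kc N β)
    (h : IsStrictPair k α β) (hk : k ∈ PIH ρ) :
    prob V w ρ kc N β ≤ tailWeight V w ρ k * prob V w ρ kc N α := by
  have hB := boxVolume_pos hρ
  rw [prob_ratio hα hβ (rawCoeff_strict hρ h fun h' => absurd hk (notMem_PIH_of_PL hρ h1 h'))]
  refine mul_le_mul_of_nonneg_right ?_ (prob_nonneg α)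
  have e1 : (α 0 : ℝ) ≤ N := by exact_mod_cast hα.apply_le 0
  have e2 : (2 : ℝ) ≤ α 0 := by
    have := h.apply_zero; exact_mod_cast (by omega : 2 ≤ α 0)
  have e3 := lam_mul_PIH_le hV hw hρ h1 hk (neg_mem_PIH.2 hk)
  rw [tailWeight_neg] at e3
  calc (α 0 : ℝ) * (α 0 - 1) / boxVolume ρ ^ 2 * (|lam V w ρ k| * |lam V w ρ (-k)|)
      ≤ (N : ℝ) ^ 2 / boxVolume ρ ^ 2 *
        ((tailWeight V w ρ k + tailWeight V w ρ k) / 2 / ρ ^ 2) := by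
        refine mul_le_mul (div_le_div_of_nonneg_right ?_ (by positivity)) e3 (by positivity)
          (by positivity)
        nlinarith
    _ = tailWeight V w ρ k := by rw [hN]; field_simp; ring

lemma prob_strict_PL (hρ : 0 < ρ) (hN : (N : ℝ) = ρ * boxVolume ρ) (hα : InM ρ kc N α)
    (hβ : InM ρ kc N β) (h : IsStrictPair u α β) (hu : u ∈ PL ρ) (hsym : α u = α (-u)) :
    prob V w ρ kc N β = bogX (4 * g0 V w) (scaled ρ u) * ((α 0 * (α 0 - 1) / (N : ℝ) ^ 2) *
      prob V w ρ kc N α) := by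
  have hB := boxVolume_pos hρ
  rw [prob_ratio hα hβ (rawCoeff_strict hρ h fun _ => hsym), lam_PL_sq hρ hu, hN]
  field_simp

lemma prob_strict_PL_le (hρ : 0 < ρ) (hN : (N : ℝ) = ρ * boxVolume ρ) (hα : InM ρ kc N α)
    (hβ : InM ρ kc N β) (h : IsStrictPair u α β) (hu : u ∈ PL ρ) (hsym : α u = α (-u)) :
    prob V w ρ kc N β ≤ bogX (4 * g0 V w) (scaled ρ u) * prob V w ρ kc N α := by
  rw [prob_strict_PL hρ hN hα hβ h hu hsym]
  refine mul_le_mul_of_nonneg_left ?_ (bogX_nonneg _ _)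
  refine mul_le_of_le_one_left (prob_nonneg α) ?_
  have e1 : (α 0 : ℝ) ≤ N := by exact_mod_cast hα.apply_le 0
  have e2 : (2 : ℝ) ≤ α 0 := by
    have := h.apply_zero; exact_mod_cast (by omega : 2 ≤ α 0)
  rw [div_le_one (by nlinarith)]
  nlinarith

lemma prob_soft_le (hV : IsPotential V) (hw : IsScatteringSolution V w) (hρ : 0 < ρ)
    (h1 : ρ < 1) (hN : (N : ℝ) = ρ * boxVolume ρ) (hα : InM ρ kc N α) (hβ : InM ρ kc N β)
    (h : IsSoftPair ρ u p q α β) (hsym : α u = α (-u)) :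
    prob V w ρ kc N β ≤ prob V w ρ kc N α *
      (4 * (mCut ρ + 1) / N * ((tailWeight V w ρ p + tailWeight V w ρ q) / 2)) := by
  have hB := boxVolume_pos hρ
  have hm := mCut_pos hρ
  rw [prob_ratio hα hβ (rawCoeff_soft hρ h1 h hsym), mul_comm]
  refine mul_le_mul_of_nonneg_left ?_ (prob_nonneg α)
  have e1 : (α 0 : ℝ) ≤ N := by exact_mod_cast hα.apply_le 0
  have e2 := (hα.low_bounds hρ h1 h.1).2.le
  have e3 := lam_mul_PIH_le hV hw hρ h1 (PH_subset_PIH h.2.1) (PH_subset_PIH h.2.2.1)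
  calc 4 * (α u : ℝ) * α 0 / boxVolume ρ ^ 2 * (|lam V w ρ p| * |lam V w ρ q|)
      ≤ 4 * (mCut ρ + 1) * N / boxVolume ρ ^ 2 *
        ((tailWeight V w ρ p + tailWeight V w ρ q) / 2 / ρ ^ 2) := by
        refine mul_le_mul (div_le_div_of_nonneg_right ?_ (by positivity)) e3 (by positivity)
          (by positivity)
        gcongr
    _ = _ := by rw [hN]; field_simp

/-- An asymmetric configuration is the image of one that is symmetric at `u`, under a soft pair with
some momentum `p`. Summing the transition bound over all `p` gives `4 (m_c + 1) tailSum / N`. -/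
lemma expect_asym_le (hV : IsPotential V) (hw : IsScatteringSolution V w) (hρ : 0 < ρ)
    (h1 : ρ < 1) (hS : Summable (tailWeight V w ρ)) (hN : (N : ℝ) = ρ * boxVolume ρ)
    (hu : u ∈ PL ρ) :
    expect (prob V w ρ kc N) (fun α => if α (-u) = α u + 1 then 1 else 0) ≤
      asymBound V w ρ N := by
  have hm := mCut_pos hρ
  have hP := hasSum_prob hV hw hρ h1 hS kc N
  have hS' : HasSum (fun p => tailWeight V w ρ (u - p)) (tailSum V w ρ) :=
    (Equiv.subLeft u).hasSum_iff.2 hS.hasSum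
  have hc := ((hS.hasSum.add hS').div_const 2).mul_left (4 * (mCut ρ + 1) / (N : ℝ))
  have hc0 : ∀ p, 0 ≤ 4 * (mCut ρ + 1) / (N : ℝ) *
      ((tailWeight V w ρ p + tailWeight V w ρ (u - p)) / 2) := by
    intro p
    have := tailWeight_nonneg (V := V) (w := w) (ρ := ρ) p
    have := tailWeight_nonneg (V := V) (w := w) (ρ := ρ) (u - p)
    positivity
  have hs := hP.summable.mul_of_nonneg hc.summable prob_nonneg hc0
  have htot := hP.mul hc hs
  refine (tsum_le_of_transfer (fun α => mul_nonneg (by split_ifs <;> norm_num) (prob_nonneg α))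
    (fun x => mul_nonneg (prob_nonneg _) (hc0 _)) hs (fun x => pairMap u x.2 x.1)
    fun α hα => ?_).2.trans (le_of_eq ?_)
  · have ha : α (-u) = α u + 1 := by
      by_contra h; simp [h] at hα
    have hM : InM ρ kc N α := InM.of_prob (right_ne_zero_of_mul hα)
    obtain ⟨α', p, q, hα', hsym, hs'⟩ := hM.exists_soft_removal hρ h1 hu ha
    refine ⟨(α', p), hs'.pairMap_eq, ?_⟩
    have hq : u - p = q := by rw [← hs'.2.2.2.1]; abel
    rw [if_pos ha, one_mul]
    simp only [hq]
    exact prob_soft_le hV hw hρ h1 hN hα' hM hs' hsym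
  · rw [htot.tsum_eq, asymBound, tailSum]; ring

/-- Removing the pair lowers the occupation of `k` by one and costs a factor `tailWeight`. It is
applied to the component at `k` of the strict part `τ`, which is positive only where such a pair can
be removed. -/
lemma expect_removable_le (hV : IsPotential V) (hw : IsScatteringSolution V w) (hρ : 0 < ρ)
    (h1 : ρ < 1) (hS : Summable (tailWeight V w ρ)) (hN : (N : ℝ) = ρ * boxVolume ρ)
    (hk : k ∈ PIH ρ) {f : Occ → ℝ} (hf0 : ∀ α, 0 ≤ f α)
    (hf1 : ∀ α, InM ρ kc N α → f α ≤ α k)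
    (hf2 : ∀ α, InM ρ kc N α → f α ≠ 0 → ∃ α', InM ρ kc N α' ∧ IsStrictPair k α' α) :
    expect (prob V w ρ kc N) f ≤
      tailWeight V w ρ k * (expect (prob V w ρ kc N) (fun α => (α k : ℝ)) + 1) := by
  have hP := hasSum_prob hV hw hρ h1 hS kc N
  have hb : BddOn (prob V w ρ kc N) fun α => (α k : ℝ) + 1 := (bddOn_apply k).add (BddOn.const 1)
  have e : expect (prob V w ρ kc N) (fun α => (α k : ℝ)) + 1 =
      expect (prob V w ρ kc N) (fun α => (α k : ℝ) + 1) := by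
    rw [expect_add prob_nonneg hP (bddOn_apply k) (BddOn.const 1), expect_const hP]
  rw [e, ← expect_const_mul]
  refine (tsum_le_of_transfer (fun α => mul_nonneg (hf0 α) (prob_nonneg α))
    (fun α => mul_nonneg (mul_nonneg (tailWeight_nonneg k) (by positivity)) (prob_nonneg α))
    (summable_expect prob_nonneg hP (hb.const_mul _)) (pairMap 0 k) fun α hα => ?_).2
  have hM : InM ρ kc N α := InM.of_prob (right_ne_zero_of_mul hα)
  obtain ⟨α', hα', hs⟩ := hf2 α hM (left_ne_zero_of_mul hα)
  refine ⟨α', hs.pairMap_eq, ?_⟩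
  have hle := hf1 α hM
  rw [hs.apply_self] at hle
  push_cast at hle
  calc f α * prob V w ρ kc N α
      ≤ ((α' k : ℝ) + 1) * (tailWeight V w ρ k * prob V w ρ kc N α') :=
        mul_le_mul hle (prob_strict_PIH_le hV hw hρ h1 hN hα' hM hs hk) (prob_nonneg α)
          (by positivity)
    _ = _ := by ring

lemma card_asymModes (hρ : 0 < ρ) (α : Occ) :
    ((asymModes ρ α).card : ℝ) =
      ∑ u ∈ lowModes hρ, if α (-u) = α u + 1 then (1 : ℝ) else 0 := by
  rw [Finset.sum_boole]
  congr 2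
  ext u
  rw [mem_asymModes, Finset.mem_filter, mem_lowModes]

/-- With `I` the mean number of particles outside `P_0 ∪ P_L`, removal of strict pairs and
`tailWeight ≤ 1/4` give `E|τ| ≤ I/4 + tailSum`. As `I` is `2 E|τ|` plus twice the mean number of
asymmetric modes, the term `I/2` is absorbed on the left. -/
lemma expect_occIn_le (hV : IsPotential V) (hw : IsScatteringSolution V w) (hρ : 0 < ρ)
    (h1 : ρ < 1) (hS : Summable (tailWeight V w ρ)) (hN : (N : ℝ) = ρ * boxVolume ρ)
    (hr : (g0 V w * ρ ^ (2 * eta)) ^ 2 ≤ 1 / 4) :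
    expect (prob V w ρ kc N) (fun α => (occIn (PIH ρ) α : ℝ)) ≤
      4 * tailSum V w ρ + 4 * (lowModes hρ).card * asymBound V w ρ N := by
  classical
  set μ := prob V w ρ kc N with hμ
  have hP : HasSum μ 1 := hasSum_prob hV hw hρ h1 hS kc N
  have hP0 : ∀ α, 0 ≤ μ α := prob_nonneg
  -- A strict part is chosen for all configurations at once, with the value `0` outside `M`, where
  -- the probability vanishes.
  have hex : ∀ α, ∃ τ : Occ, InM ρ kc N α → (∀ k, τ k ≠ 0 → k ∈ PIH ρ) ∧ τ ≤ α ∧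
      occIn (PIH ρ) α = 2 * τ.degree + 2 * (asymModes ρ α).card ∧
      ∀ k, τ k ≠ 0 → ∃ α', InM ρ kc N α' ∧ IsStrictPair k α' α := by
    intro α
    by_cases h : InM ρ kc N α
    · obtain ⟨τ, hτ⟩ := h.exists_strict_part hρ h1
      exact ⟨τ, fun _ => hτ⟩
    · exact ⟨0, fun h' => absurd h' h⟩
  choose τ hτ using hex
  have hbI : BddOn μ fun α => (occIn (PIH ρ) α : ℝ) := bddOn_occIn _
  have hbτ : BddOn μ fun α => ((τ α).degree : ℝ) := by
    refine ⟨N, fun α h => ?_⟩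
    have hM := InM.of_prob h
    rw [Nat.abs_cast]
    have e1 := (hτ α hM).2.2.1
    have e2 := occIn_le_degree (PIH ρ) α
    rw [(mem_AllConfig.1 hM.mem_AllConfig).2] at e2
    exact_mod_cast (by omega : (τ α).degree ≤ N)
  have hsτ := hasSum_expect_apply hP0 hP hbτ
  have hsI := hasSum_expect_apply hP0 hP (τ := fun α => α.filter (· ∈ PIH ρ)) hbI
  have hτle : expect μ (fun α => ((τ α).degree : ℝ)) ≤
      1 / 4 * expect μ (fun α => (occIn (PIH ρ) α : ℝ)) + tailSum V w ρ := by
    refine hasSum_le (fun k => ?_) hsτ ((hsI.mul_left (1 / 4)).add hS.hasSum)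
    by_cases hk : k ∈ PIH ρ
    · have e := expect_removable_le hV hw hρ h1 hS hN hk (kc := kc) (N := N)
        (f := fun α => if InM ρ kc N α then (τ α k : ℝ) else 0)
        (fun α => by split_ifs <;> positivity)
        (fun α h => by rw [if_pos h]; exact_mod_cast (hτ α h).2.1 k)
        (fun α h h' => (hτ α h).2.2.2 k (by rw [if_pos h] at h'; exact_mod_cast h'))
      rw [expect_congr (ψ := fun α => (τ α k : ℝ))
        (fun α h => if_pos (InM.of_prob h))] at e
      simp only [Finsupp.filter_apply_pos (· ∈ PIH ρ) _ hk]
      have e2 := (tailWeight_le (V := V) (w := w) hρ h1 k).trans hr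
      have e3 : 0 ≤ expect μ (fun α => (α k : ℝ)) := expect_nonneg hP0 fun _ => Nat.cast_nonneg _
      nlinarith
    · have e : expect μ (fun α => (τ α k : ℝ)) = expect μ (fun _ => 0) := by
        refine expect_congr fun α h => ?_
        have := (hτ α (InM.of_prob h)).1 k
        have : τ α k = 0 := by by_contra h'; exact hk (this h')
        rw [this, Nat.cast_zero]
      rw [e, expect_const hP]
      have e3 : 0 ≤ expect μ (fun α => ((α.filter (· ∈ PIH ρ)) k : ℝ)) :=
        expect_nonneg hP0 fun _ => Nat.cast_nonneg _
      have e4 := tailWeight_nonneg (V := V) (w := w) (ρ := ρ) k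
      linarith
  have hba : ∀ u : Mode, BddOn μ fun α => if α (-u) = α u + 1 then (1 : ℝ) else 0 :=
    fun u => (BddOn.const 1).ite _
  have hI : expect μ (fun α => (occIn (PIH ρ) α : ℝ)) =
      2 * expect μ (fun α => ((τ α).degree : ℝ)) +
      2 * ∑ u ∈ lowModes hρ, expect μ (fun α => if α (-u) = α u + 1 then (1 : ℝ) else 0) := by
    rw [← expect_sum hP0 hP _ fun u _ => hba u, ← expect_const_mul, ← expect_const_mul,
      ← expect_add hP0 hP (hbτ.const_mul 2) ((BddOn.sum _ fun u _ => hba u).const_mul 2)]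
    refine expect_congr fun α h => ?_
    rw [(hτ α (InM.of_prob h)).2.2.1, ← card_asymModes hρ]
    push_cast; rfl
  have hsum : ∑ u ∈ lowModes hρ, expect μ (fun α => if α (-u) = α u + 1 then (1 : ℝ) else 0) ≤
      (lowModes hρ).card * asymBound V w ρ N := by
    rw [← nsmul_eq_mul]
    exact Finset.sum_le_card_nsmul _ _ _ fun u hu =>
      expect_asym_le hV hw hρ h1 hS hN ((mem_lowModes hρ).1 hu)
  linarith

/-! ### Mean occupation of a single low mode -/

/-- The expected occupation of a low mode on the configurations in which it is symmetric. -/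
def symOcc (V w : Space → ℝ) (ρ kc : ℝ) (N : ℕ) (u : Mode) : ℝ :=
  expect (prob V w ρ kc N) fun α => if α u = α (-u) then (α u : ℝ) else 0

lemma symOcc_nonneg : 0 ≤ symOcc V w ρ kc N u :=
  expect_nonneg prob_nonneg fun α => by split_ifs <;> positivity

/-- Comparison of symmetric configurations with those that have one pair less. -/
lemma expect_sym_le (hV : IsPotential V) (hw : IsScatteringSolution V w) (hρ : 0 < ρ)
    (h1 : ρ < 1) (hS : Summable (tailWeight V w ρ)) (hN : (N : ℝ) = ρ * boxVolume ρ)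
    (hu : u ∈ PL ρ) {f : ℕ → ℝ} (hf : ∀ n, 0 ≤ f n) (hf0 : f 0 = 0)
    (hb : BddOn (prob V w ρ kc N) fun α => f (α u + 1)) :
    expect (prob V w ρ kc N) (fun α => if α u = α (-u) then f (α u) else 0) ≤
      bogX (4 * g0 V w) (scaled ρ u) *
        expect (prob V w ρ kc N) (fun α => if α u = α (-u) then f (α u + 1) else 0) := by
  have hP := hasSum_prob hV hw hρ h1 hS kc N
  rw [← expect_const_mul]
  refine (tsum_le_of_transfer (fun α => mul_nonneg ?_ (prob_nonneg α))
    (fun α => mul_nonneg (mul_nonneg (bogX_nonneg _ _) ?_) (prob_nonneg α))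
    (summable_expect prob_nonneg hP ((hb.ite _).const_mul _)) (pairMap 0 u) fun α hα => ?_).2
  · split_ifs <;> [exact hf _; exact le_rfl]
  · split_ifs <;> [exact hf _; exact le_rfl]
  have hM : InM ρ kc N α := InM.of_prob (right_ne_zero_of_mul hα)
  have hα1 := left_ne_zero_of_mul hα
  have hsym : α u = α (-u) := by
    by_contra h; rw [if_neg h] at hα1; exact hα1 rfl
  rw [if_pos hsym] at hα1 ⊢
  have hpos : 1 ≤ α u := by
    by_contra h
    rw [show α u = 0 by omega] at hα1
    exact hα1 hf0
  obtain ⟨α', hα', hs⟩ := hM.exists_low_removal hρ h1 hu hsym hpos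
  have e1 := hs.apply_self
  have e2 := hs.apply_neg
  refine ⟨α', hs.pairMap_eq, ?_⟩
  rw [if_pos (by omega), e1]
  calc f (α' u + 1) * prob V w ρ kc N α
      ≤ f (α' u + 1) * (bogX (4 * g0 V w) (scaled ρ u) * prob V w ρ kc N α') :=
        mul_le_mul_of_nonneg_left (prob_strict_PL_le hρ hN hα' hM hs hu (by omega)) (hf _)
    _ = _ := by ring

/-- Removing one pair gives `T ≤ x (T + 1)`, and `bogF = x / (1 - x)` is the fixed point. -/
lemma symOcc_le (hV : IsPotential V) (hw : IsScatteringSolution V w) (hρ : 0 < ρ)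
    (h1 : ρ < 1) (hS : Summable (tailWeight V w ρ)) (hN : (N : ℝ) = ρ * boxVolume ρ)
    (hu : u ∈ PL ρ) : symOcc V w ρ kc N u ≤ bogF (4 * g0 V w) (scaled ρ u) := by
  have hP := hasSum_prob hV hw hρ h1 hS kc N
  have hg : 0 ≤ 4 * g0 V w := by have := g0_nonneg hV hw; positivity
  have hb : BddOn (prob V w ρ kc N) fun α => (α u : ℝ) + 1 := (bddOn_apply u).add (BddOn.const 1)
  have h := expect_sym_le hV hw hρ h1 hS hN hu (kc := kc) (N := N) (f := fun n => (n : ℝ))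
    (fun n => Nat.cast_nonneg n) Nat.cast_zero (by push_cast; exact hb)
  have h2 : expect (prob V w ρ kc N)
      (fun α => if α u = α (-u) then ((α u + 1 : ℕ) : ℝ) else 0) ≤ symOcc V w ρ kc N u + 1 := by
    rw [symOcc, ← expect_const hP 1, ← expect_add prob_nonneg hP ((bddOn_apply u).ite _)
      (BddOn.const 1)]
    push_cast
    refine expect_mono prob_nonneg hP (hb.ite _) (((bddOn_apply u).ite _).add (BddOn.const 1))
      fun α _ => ?_
    split_ifs <;> norm_num
  have hx := bogX_lt_one hg (scaled ρ u)
  have hF := bogF_eq hg (scaled ρ u)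
  have h3 : symOcc V w ρ kc N u ≤
      bogX (4 * g0 V w) (scaled ρ u) * (symOcc V w ρ kc N u + 1) :=
    h.trans (mul_le_mul_of_nonneg_left h2 (bogX_nonneg _ _))
  have h4 : symOcc V w ρ kc N u * (1 - bogX (4 * g0 V w) (scaled ρ u)) ≤
      bogF (4 * g0 V w) (scaled ρ u) * (1 - bogX (4 * g0 V w) (scaled ρ u)) := by
    rw [← hF]; linarith
  exact le_of_mul_le_mul_right h4 (by linarith)

/-- Geometric tail: each removal of a pair costs a factor `x`. This makes it unlikely that the
cutoff `m_c` is reached. -/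
lemma expect_sym_ge_le_pow (hV : IsPotential V) (hw : IsScatteringSolution V w) (hρ : 0 < ρ)
    (h1 : ρ < 1) (hS : Summable (tailWeight V w ρ)) (hN : (N : ℝ) = ρ * boxVolume ρ)
    (hu : u ∈ PL ρ) (j : ℕ) :
    expect (prob V w ρ kc N)
      (fun α => if α u = α (-u) then (if j ≤ α u then (1 : ℝ) else 0) else 0) ≤
      bogX (4 * g0 V w) (scaled ρ u) ^ j := by
  have hP := hasSum_prob hV hw hρ h1 hS kc N
  induction j with
  | zero =>
    rw [pow_zero]
    refine (expect_mono prob_nonneg hP (((BddOn.const 1).ite _).ite _) (BddOn.const 1)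
      fun α _ => ?_).trans (expect_const hP 1).le
    split_ifs <;> norm_num
  | succ j ih =>
    have h := expect_sym_le hV hw hρ h1 hS hN hu (kc := kc) (N := N)
      (f := fun n => if j + 1 ≤ n then (1 : ℝ) else 0)
      (fun n => by split_ifs <;> norm_num) (by simp) ((BddOn.const 1).ite _)
    refine h.trans ?_
    rw [pow_succ']
    refine mul_le_mul_of_nonneg_left ?_ (bogX_nonneg _ _)
    simp only [add_le_add_iff_right]
    exact ih

/-- The expected number of particles outside the condensate. -/
def excited (V w : Space → ℝ) (ρ kc : ℝ) (N : ℕ) : ℝ :=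
  expect (prob V w ρ kc N) fun α => (N : ℝ) - α 0

lemma bddOn_excited : BddOn (prob V w ρ kc N) fun α => (N : ℝ) - α 0 := by
  have := (BddOn.const (P := prob V w ρ kc N) (N : ℝ)).add ((bddOn_apply 0).const_mul (-1))
  simpa [sub_eq_add_neg] using this

lemma excited_nonneg : 0 ≤ excited V w ρ kc N := by
  refine tsum_nonneg fun α => ?_
  by_cases h : prob V w ρ kc N α = 0
  · simp [h]
  · have : (α 0 : ℝ) ≤ N := by exact_mod_cast (InM.of_prob h).apply_le 0
    exact mul_nonneg (by linarith) (prob_nonneg α)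

/-- Creating a pair, instead of removing one, nearly reverses the inequality `T ≤ x (T + 1)`. What
is lost comes from the cutoff, from the depletion of the condensate in `α(0)(α(0)-1)/N²`, and from
asymmetric configurations. -/
lemma le_symOcc (hV : IsPotential V) (hw : IsScatteringSolution V w) (hρ : 0 < ρ)
    (h1 : ρ < 1) (hS : Summable (tailWeight V w ρ)) (hN : (N : ℝ) = ρ * boxVolume ρ)
    (hN0 : 0 < N) (hu : u ∈ PL ρ) :
    bogF (4 * g0 V w) (scaled ρ u) - bogS (4 * g0 V w) (scaled ρ u) *
      ((mCut ρ + 2) * bogX (4 * g0 V w) (scaled ρ u) ^ ⌈mCut ρ⌉₊ +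
        ((mCut ρ + 2) * ((2 * excited V w ρ kc N + 1) / N) + 2 * asymBound V w ρ N)) ≤
      symOcc V w ρ kc N u := by
  have hP := hasSum_prob hV hw hρ h1 hS kc N
  have hm := mCut_pos hρ
  have hN' : (0 : ℝ) < N := by exact_mod_cast hN0
  have hg : 0 ≤ 4 * g0 V w := by have := g0_nonneg hV hw; positivity
  set μ := prob V w ρ kc N with hμ
  have hP0 : ∀ α, 0 ≤ μ α := prob_nonneg
  set x := bogX (4 * g0 V w) (scaled ρ u)
  set T := symOcc V w ρ kc N u
  -- The occupation after one more pair, times the condensate factor of the transition, restricted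
  -- to the configurations in which the pair may be created.
  set gf : Occ → ℝ := fun α => if α u = α (-u) ∧ (α u : ℝ) < mCut ρ then
    ((α u : ℝ) + 1) * (α 0 * (α 0 - 1) / (N : ℝ) ^ 2) else 0 with hgf
  have hgf0 : ∀ α, 0 ≤ gf α := by
    intro α
    simp only [hgf]
    split_ifs
    · have : (0 : ℝ) ≤ α 0 * (α 0 - 1) := by
        rcases Nat.eq_zero_or_pos (α 0) with h | h
        · simp [h]
        · have : (1 : ℝ) ≤ α 0 := by exact_mod_cast h
          nlinarith
      positivity
    · exact le_rfl
  have hbu : BddOn μ fun α => (α u : ℝ) := bddOn_apply u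
  have hb0 : BddOn μ fun α => (α 0 : ℝ) := bddOn_apply 0
  have hbg : BddOn μ gf := by
    refine BddOn.ite _ ((hbu.add (BddOn.const 1)).mul ?_)
    have := (hb0.mul (hb0.add (BddOn.const (-1)))).mul (BddOn.const (((N : ℝ) ^ 2)⁻¹))
    exact this
  have hbT : BddOn μ fun α => if α u = α (-u) then (α u : ℝ) else 0 := hbu.ite _
  have hraise : x * expect μ gf ≤ T := by
    rw [← expect_const_mul]
    refine (tsum_le_of_transfer (K := Occ)
      (fun α => mul_nonneg (mul_nonneg (bogX_nonneg _ _) (hgf0 α)) (hP0 α))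
      (fun β => mul_nonneg (by split_ifs <;> positivity) (hP0 β))
      (summable_expect hP0 hP hbT)
      (fun β => β + Finsupp.single 0 2 - (Finsupp.single u 1 + Finsupp.single (-u) 1))
      fun α hα => ?_).2
    have hM : InM ρ kc N α := InM.of_prob (right_ne_zero_of_mul hα)
    have hα1 := right_ne_zero_of_mul (left_ne_zero_of_mul hα)
    have hc : α u = α (-u) ∧ (α u : ℝ) < mCut ρ := by
      by_contra h; simp only [hgf] at hα1; rw [if_neg h] at hα1; exact hα1 rfl
    -- The factor `α(0)(α(0)-1)` vanishes when fewer than two particles are left in the condensate.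
    have h2 : 2 ≤ α 0 := by
      by_contra h
      simp only [hgf] at hα1
      rw [if_pos hc] at hα1
      have h' : α 0 = 0 ∨ α 0 = 1 := by omega
      rcases h' with h' | h' <;> simp [h'] at hα1
    have hu0 : u ≠ 0 := fun e => zero_notMem_PL hρ (e ▸ hu)
    obtain ⟨β, hβ⟩ := exists_strictPair hu0 h2
    have hMβ : InM ρ kc N β := hM.strict_low' hu (by rw [← hc.1, max_self]; exact hc.2) hβ
    refine ⟨β, by rw [hβ.2, add_assoc, add_tsub_cancel_right], le_of_eq ?_⟩
    have e1 := hβ.apply_self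
    have e2 := hβ.apply_neg
    rw [if_pos (by omega), hμ, prob_strict_PL hρ hN hM hMβ hβ hu hc.1, e1]
    simp only [hgf]
    rw [if_pos hc]
    push_cast
    ring
  set J := ⌈mCut ρ⌉₊
  set A : Mode → Occ → ℝ := fun v α => if α (-v) = α v + 1 then (1 : ℝ) else 0 with hA
  have hbA : ∀ v, BddOn μ (A v) := fun v => (BddOn.const 1).ite _
  set Gt : Occ → ℝ := fun α => if α u = α (-u) then (if J ≤ α u then (1 : ℝ) else 0) else 0
    with hGt
  have hbG : BddOn μ Gt := ((BddOn.const 1).ite _).ite _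
  have hbn : BddOn μ fun α => (N : ℝ) - α 0 := bddOn_excited
  -- This holds pointwise: below the cutoff the depletion term makes up for the condensate factor;
  -- at the cutoff `Gt = 1` and `α u + 1 < m_c + 2`; an asymmetric configuration has `A u + A (-u) ≥
  -- 1`.
  have hmain : T + 1 ≤ expect μ gf + ((mCut ρ + 2) * expect μ Gt +
      (((mCut ρ + 2) / N) * (2 * excited V w ρ kc N + 1) + (expect μ (A u) + expect μ (A (-u))))) := by
    have hb2 : BddOn μ fun α => 2 * ((N : ℝ) - α 0) := hbn.const_mul 2
    have hb3 : BddOn μ fun α => 2 * ((N : ℝ) - α 0) + 1 := hb2.add (BddOn.const 1)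
    have hb4 := hb3.const_mul ((mCut ρ + 2) / N)
    have hb5 := (hbA u).add (hbA (-u))
    have hb6 := hbG.const_mul (mCut ρ + 2)
    have eL : T + 1 = expect μ (fun α => (if α u = α (-u) then (α u : ℝ) else 0) + 1) := by
      rw [expect_add hP0 hP hbT (BddOn.const 1), expect_const hP]; rfl
    have eR : expect μ gf + ((mCut ρ + 2) * expect μ Gt +
      (((mCut ρ + 2) / N) * (2 * excited V w ρ kc N + 1) + (expect μ (A u) + expect μ (A (-u))))) =
      expect μ (fun α => gf α + ((mCut ρ + 2) * Gt α +
        (((mCut ρ + 2) / N) * (2 * ((N : ℝ) - α 0) + 1) + (A u α + A (-u) α)))) := by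
      rw [expect_add hP0 hP hbg (hb6.add (hb4.add hb5)), expect_add hP0 hP hb6 (hb4.add hb5),
        expect_add hP0 hP hb4 hb5, expect_add hP0 hP (hbA u) (hbA (-u)), expect_const_mul,
        expect_const_mul, expect_add hP0 hP hb2 (BddOn.const 1), expect_const_mul,
        expect_const hP]
      rfl
    rw [eL, eR]
    refine expect_mono hP0 hP (hbT.add (BddOn.const 1))
      (hbg.add (hb6.add (hb4.add hb5))) fun α hα => ?_
    have hM := InM.of_prob hα
    have hA0 : ∀ v, 0 ≤ A v α := fun v => by simp only [hA]; split_ifs <;> norm_num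
    have hG0 : 0 ≤ Gt α := by simp only [hGt]; split_ifs <;> norm_num
    have hn0 : (0 : ℝ) ≤ N - α 0 := by
      have : (α 0 : ℝ) ≤ N := by exact_mod_cast hM.apply_le 0
      linarith
    have hn1 : 0 ≤ ((mCut ρ + 2) / N) * (2 * ((N : ℝ) - α 0) + 1) := by positivity
    have hG1 : 0 ≤ (mCut ρ + 2) * Gt α := by positivity
    by_cases hsym : α u = α (-u)
    · rw [if_pos hsym]
      by_cases hlt : (α u : ℝ) < mCut ρ
      · have eg : gf α = ((α u : ℝ) + 1) * (α 0 * (α 0 - 1) / (N : ℝ) ^ 2) := if_pos ⟨hsym, hlt⟩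
        have e1 : 1 - (2 * ((N : ℝ) - α 0) + 1) / N ≤ α 0 * (α 0 - 1) / (N : ℝ) ^ 2 := by
          rw [le_div_iff₀ (by positivity)]
          have : (1 - (2 * ((N : ℝ) - α 0) + 1) / N) * (N : ℝ) ^ 2 =
              (N : ℝ) ^ 2 - (2 * ((N : ℝ) - α 0) + 1) * N := by field_simp
          rw [this]
          nlinarith
        have e2 : ((α u : ℝ) + 1) * (1 - (2 * ((N : ℝ) - α 0) + 1) / N) ≤ gf α := by
          rw [eg]; exact mul_le_mul_of_nonneg_left e1 (by positivity)
        have e3 : ((α u : ℝ) + 1) * ((2 * ((N : ℝ) - α 0) + 1) / N) ≤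
            ((mCut ρ + 2) / N) * (2 * ((N : ℝ) - α 0) + 1) := by
          rw [mul_div_assoc', div_mul_eq_mul_div]
          gcongr
          linarith
        have := hA0 u
        have := hA0 (-u)
        linarith
      · have hJ : J ≤ α u := Nat.ceil_le.2 (not_lt.1 hlt)
        have eG : Gt α = 1 := by simp only [hGt]; rw [if_pos hsym, if_pos hJ]
        have := (hM.low_bounds hρ h1 hu).2
        have := hA0 u
        have := hA0 (-u)
        have := hgf0 α
        rw [eG]
        linarith
    · rw [if_neg hsym]
      have b1 := (hM.low_bounds hρ h1 hu).1
      have b2 := (hM.low_bounds hρ h1 (neg_mem_PL.2 hu)).1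
      rw [neg_neg] at b2
      have hone : 1 ≤ A u α + A (-u) α := by
        rcases lt_or_gt_of_ne hsym with h | h
        · have : A u α = 1 := if_pos (by omega)
          linarith [hA0 (-u)]
        · have : A (-u) α = 1 := if_pos (by rw [neg_neg]; omega)
          linarith [hA0 u]
      have := hgf0 α
      linarith
  have hGle : expect μ Gt ≤ x ^ J := expect_sym_ge_le_pow hV hw hρ h1 hS hN hu J
  have hA1 : expect μ (A u) ≤ asymBound V w ρ N := expect_asym_le hV hw hρ h1 hS hN hu
  have hA2 : expect μ (A (-u)) ≤ asymBound V w ρ N :=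
    expect_asym_le hV hw hρ h1 hS hN (neg_mem_PL.2 hu)
  set err := (mCut ρ + 2) * x ^ J + ((mCut ρ + 2) * ((2 * excited V w ρ kc N + 1) / N) +
    2 * asymBound V w ρ N) with herr
  have hx0 : 0 ≤ x := bogX_nonneg _ _
  have hx1 : x < 1 := bogX_lt_one hg _
  have herr0 : 0 ≤ err := by
    have := asymBound_nonneg (V := V) (w := w) (N := N) hρ
    have := excited_nonneg (V := V) (w := w) (ρ := ρ) (kc := kc) (N := N)
    positivity
  have h3 : T + 1 ≤ expect μ gf + err := by
    have e1 : (mCut ρ + 2) * expect μ Gt ≤ (mCut ρ + 2) * x ^ J :=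
      mul_le_mul_of_nonneg_left hGle (by positivity)
    have e2 : ((mCut ρ + 2) / N) * (2 * excited V w ρ kc N + 1) =
      (mCut ρ + 2) * ((2 * excited V w ρ kc N + 1) / N) := by ring
    rw [herr]; linarith
  -- Multiply `h3` by `x ≤ 1` and insert `hraise`.
  have h4 : x - err ≤ T * (1 - x) := by nlinarith [mul_le_mul_of_nonneg_left h3 hx0]
  have hF : x = bogF (4 * g0 V w) (scaled ρ u) * (1 - x) := bogF_eq hg _
  have hs : 1 ≤ bogS (4 * g0 V w) (scaled ρ u) * (1 - x) := one_le_bogS_mul hg _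
  refine le_of_mul_le_mul_right ?_ (by linarith : 0 < 1 - x)
  rw [sub_mul, ← hF]
  have : err ≤ bogS (4 * g0 V w) (scaled ρ u) * err * (1 - x) := by nlinarith
  linarith

end estimates

/-! ### The number of excited particles -/

section excitedNumber
variable {V w : Space → ℝ} {ρ kc : ℝ} {N : ℕ} {α β : Occ} {k u p q : Mode}

lemma InM.sub_apply_zero (hρ : 0 < ρ) (h1 : ρ < 1) (h : InM ρ kc N α) :
    (N : ℝ) - α 0 = (∑ u ∈ lowModes hρ, (α u : ℝ)) + occIn (PIH ρ) α := by
  classical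
  have hd := BoseGas.mem_AllConfig.1 h.mem_AllConfig
  have hN : N = α 0 + ∑ u ∈ lowModes hρ, α u + occIn (PIH ρ) α := by
    have e0 : ∑ k ∈ α.support with k = 0, α k = α 0 := by
      rw [Finset.filter_eq']
      split_ifs with h0
      · simp
      · simpa using (Finsupp.notMem_support_iff.1 h0).symm
    have e1 : ∑ k ∈ α.support with k ∈ PL ρ, α k = ∑ u ∈ lowModes hρ, α u := by
      refine Finset.sum_subset (fun k hk => (mem_lowModes hρ).2 (Finset.mem_filter.1 hk).2)
        fun k hk hk' => ?_
      by_contra h0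
      exact hk' (Finset.mem_filter.2 ⟨Finsupp.mem_support_iff.2 h0, (mem_lowModes hρ).1 hk⟩)
    rw [← e0, ← e1, occIn_eq_sum, ← hd.2, Finsupp.degree_apply, Finset.sum_filter,
      Finset.sum_filter, Finset.sum_filter, ← Finset.sum_add_distrib, ← Finset.sum_add_distrib]
    refine Finset.sum_congr rfl fun k hk => ?_
    have z1 := zero_notMem_PL hρ
    have z2 := zero_notMem_PIH hρ h1
    rcases mem_PAll.1 (hd.1 k (Finsupp.mem_support_iff.1 hk)) with h0 | h0 | h0
    · subst h0; simp [z1, z2]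
    · have : k ≠ 0 := fun e => z1 (e ▸ h0)
      simp [this, h0, notMem_PIH_of_PL hρ h1 h0]
    · have : k ≠ 0 := fun e => z2 (e ▸ h0)
      have h3 : k ∉ PL ρ := fun h' => notMem_PIH_of_PL hρ h1 h' h0
      simp [this, h0, h3]
  have : (N : ℝ) = α 0 + ∑ u ∈ lowModes hρ, (α u : ℝ) + occIn (PIH ρ) α := by
    exact_mod_cast hN
  linarith

lemma excited_eq (hV : IsPotential V) (hw : IsScatteringSolution V w) (hρ : 0 < ρ)
    (h1 : ρ < 1) (hS : Summable (tailWeight V w ρ)) :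
    excited V w ρ kc N = ∑ u ∈ lowModes hρ, expect (prob V w ρ kc N) (fun α => (α u : ℝ)) +
      expect (prob V w ρ kc N) (fun α => (occIn (PIH ρ) α : ℝ)) := by
  have hP := hasSum_prob hV hw hρ h1 hS kc N
  rw [← expect_sum prob_nonneg hP _ fun u _ => bddOn_apply u,
    ← expect_add prob_nonneg hP (BddOn.sum _ fun u _ => bddOn_apply u) (bddOn_occIn _)]
  exact expect_congr fun α h => (InM.of_prob h).sub_apply_zero hρ h1

lemma symOcc_le_expect (hV : IsPotential V) (hw : IsScatteringSolution V w) (hρ : 0 < ρ)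
    (h1 : ρ < 1) (hS : Summable (tailWeight V w ρ)) (u : Mode) :
    symOcc V w ρ kc N u ≤ expect (prob V w ρ kc N) (fun α => (α u : ℝ)) := by
  have hP := hasSum_prob hV hw hρ h1 hS kc N
  refine expect_mono prob_nonneg hP ((bddOn_apply u).ite _) (bddOn_apply u) fun α _ => ?_
  split_ifs
  · exact le_rfl
  · exact Nat.cast_nonneg _

/-- Asymmetric configurations add at most `m_c + 1` times their probability, because the cutoff
bounds the occupation. -/
lemma expect_apply_le (hV : IsPotential V) (hw : IsScatteringSolution V w) (hρ : 0 < ρ)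
    (h1 : ρ < 1) (hS : Summable (tailWeight V w ρ)) (hN : (N : ℝ) = ρ * boxVolume ρ)
    (hu : u ∈ PL ρ) :
    expect (prob V w ρ kc N) (fun α => (α u : ℝ)) ≤
      bogF (4 * g0 V w) (scaled ρ u) + 2 * (mCut ρ + 1) * asymBound V w ρ N := by
  have hP := hasSum_prob hV hw hρ h1 hS kc N
  have hm := mCut_pos hρ
  set A : Mode → Occ → ℝ := fun v α => if α (-v) = α v + 1 then (1 : ℝ) else 0 with hA
  have hbA : ∀ v, BddOn (prob V w ρ kc N) (A v) := fun v => (BddOn.const 1).ite _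
  have hbs := (bddOn_apply (V := V) (w := w) (ρ := ρ) (kc := kc) (N := N) u).ite
    (fun α => α u = α (-u))
  have hb := ((hbA u).add (hbA (-u))).const_mul (mCut ρ + 1)
  have hA0 : ∀ v α, 0 ≤ A v α := fun v α => by simp only [hA]; split_ifs <;> norm_num
  have hle : expect (prob V w ρ kc N) (fun α => (α u : ℝ)) ≤
      expect (prob V w ρ kc N) (fun α => (if α u = α (-u) then (α u : ℝ) else 0) +
        (mCut ρ + 1) * (A u α + A (-u) α)) := by
    refine expect_mono prob_nonneg hP (bddOn_apply u) (hbs.add hb) fun α hα => ?_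
    have hM := InM.of_prob hα
    have hsum : 0 ≤ A u α + A (-u) α := add_nonneg (hA0 _ _) (hA0 _ _)
    by_cases hsym : α u = α (-u)
    · rw [if_pos hsym]
      have : 0 ≤ (mCut ρ + 1) * (A u α + A (-u) α) := by positivity
      linarith
    · rw [if_neg hsym, zero_add]
      have b1 := (hM.low_bounds hρ h1 hu).1
      have b2 := (hM.low_bounds hρ h1 (neg_mem_PL.2 hu)).1
      rw [neg_neg] at b2
      have hone : 1 ≤ A u α + A (-u) α := by
        rcases lt_or_gt_of_ne hsym with h | h
        · have : A u α = 1 := if_pos (by omega)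
          linarith [hA0 (-u) α]
        · have : A (-u) α = 1 := if_pos (by rw [neg_neg]; omega)
          linarith [hA0 u α]
      have b3 := (hM.low_bounds hρ h1 hu).2
      nlinarith
  rw [expect_add prob_nonneg hP hbs hb, expect_const_mul,
    expect_add prob_nonneg hP (hbA u) (hbA (-u))] at hle
  have hA1 : expect (prob V w ρ kc N) (A u) ≤ asymBound V w ρ N :=
    expect_asym_le hV hw hρ h1 hS hN hu
  have hA2 : expect (prob V w ρ kc N) (A (-u)) ≤ asymBound V w ρ N :=
    expect_asym_le hV hw hρ h1 hS hN (neg_mem_PL.2 hu)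
  have hs : expect (prob V w ρ kc N) (fun α => if α u = α (-u) then (α u : ℝ) else 0) ≤
    bogF (4 * g0 V w) (scaled ρ u) := symOcc_le hV hw hρ h1 hS hN hu
  nlinarith

lemma excited_le (hV : IsPotential V) (hw : IsScatteringSolution V w) (hρ : 0 < ρ)
    (h1 : ρ < 1) (hS : Summable (tailWeight V w ρ)) (hN : (N : ℝ) = ρ * boxVolume ρ)
    (hr : (g0 V w * ρ ^ (2 * eta)) ^ 2 ≤ 1 / 4) :
    excited V w ρ kc N ≤ ∑ u ∈ lowModes hρ, bogF (4 * g0 V w) (scaled ρ u) +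
      ((lowModes hρ).card * (2 * (mCut ρ + 1) * asymBound V w ρ N) +
        (4 * tailSum V w ρ + 4 * (lowModes hρ).card * asymBound V w ρ N)) := by
  rw [excited_eq hV hw hρ h1 hS, ← add_assoc]
  refine add_le_add ?_ (expect_occIn_le hV hw hρ h1 hS hN hr)
  rw [← nsmul_eq_mul, ← Finset.sum_const, ← Finset.sum_add_distrib]
  exact Finset.sum_le_sum fun u hu => expect_apply_le hV hw hρ h1 hS hN ((mem_lowModes hρ).1 hu)

/-- The lower bound for the occupation of a low mode, up to uniformly small errors. -/
def lowProfile (c ρ r : ℝ) : ℝ :=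
  max 0 (bogF c r - bogS c r * ((mCut ρ + 2) * bogX c r ^ ⌈mCut ρ⌉₊))

/-- The bound contains `excited` on both sides. This is harmless since it enters the error only
through `excited / N`, which `excited_le` already makes small. -/
lemma le_excited (hV : IsPotential V) (hw : IsScatteringSolution V w) (hρ : 0 < ρ)
    (h1 : ρ < 1) (hS : Summable (tailWeight V w ρ)) (hN : (N : ℝ) = ρ * boxVolume ρ)
    (hN0 : 0 < N) :
    ∑ u ∈ lowModes hρ, lowProfile (4 * g0 V w) ρ (scaled ρ u) -
      (lowModes hρ).card * ((1 + Real.sqrt (4 * g0 V w) * ρ ^ (-eta)) *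
        ((mCut ρ + 2) * ((2 * excited V w ρ kc N + 1) / N) + 2 * asymBound V w ρ N)) ≤
      excited V w ρ kc N := by
  have hm := mCut_pos hρ
  have hg : 0 ≤ 4 * g0 V w := by have := g0_nonneg hV hw; positivity
  set rest := (mCut ρ + 2) * ((2 * excited V w ρ kc N + 1) / N) + 2 * asymBound V w ρ N
    with hrest
  have hrest0 : 0 ≤ rest := by
    have := asymBound_nonneg (V := V) (w := w) (N := N) hρ
    have := excited_nonneg (V := V) (w := w) (ρ := ρ) (kc := kc) (N := N)
    positivity
  rw [← nsmul_eq_mul, ← Finset.sum_const, ← Finset.sum_sub_distrib]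
  have hterm : ∀ u ∈ lowModes hρ, lowProfile (4 * g0 V w) ρ (scaled ρ u) -
      (1 + Real.sqrt (4 * g0 V w) * ρ ^ (-eta)) * rest ≤
      expect (prob V w ρ kc N) (fun α => (α u : ℝ)) := by
    intro u hu
    rw [mem_lowModes] at hu
    refine le_trans ?_ (symOcc_le_expect hV hw hρ h1 hS u)
    have hlow := le_symOcc hV hw hρ h1 hS hN hN0 hu (kc := kc)
    rw [← hrest] at hlow
    have hsc := ((mem_PL_iff hρ).1 hu).1
    have he : 0 < ρ ^ eta := Real.rpow_pos_of_pos hρ _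
    -- `bogS` is decreasing, so its largest value on `P_L` is controlled at the infrared edge `ρ^η`.
    have hs : bogS (4 * g0 V w) (scaled ρ u) ≤ 1 + Real.sqrt (4 * g0 V w) * ρ ^ (-eta) := by
      refine (bogS_anti hg he hsc).trans ((bogS_le hg he).trans (le_of_eq ?_))
      rw [Real.rpow_neg hρ.le, div_eq_mul_inv]
    have hs' := mul_le_mul_of_nonneg_right hs hrest0
    rcases max_cases 0 (bogF (4 * g0 V w) (scaled ρ u) - bogS (4 * g0 V w) (scaled ρ u) *
      ((mCut ρ + 2) * bogX (4 * g0 V w) (scaled ρ u) ^ ⌈mCut ρ⌉₊)) with h | h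
    · rw [lowProfile, h.1]
      have := symOcc_nonneg (V := V) (w := w) (ρ := ρ) (kc := kc) (N := N) (u := u)
      have : 0 ≤ (1 + Real.sqrt (4 * g0 V w) * ρ ^ (-eta)) * rest := by positivity
      linarith
    · rw [lowProfile, h.1]
      rw [mul_add] at hlow
      linarith
  refine (Finset.sum_le_sum hterm).trans ?_
  rw [excited_eq hV hw hρ h1 hS]
  exact le_add_of_nonneg_right (expect_nonneg prob_nonneg fun _ => Nat.cast_nonneg _)

/-- Use `(a + b)² ≤ 2a² + 2b²`: the low occupations obey the deterministic cutoff bound, and the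
square of the number of remaining particles is at most `N` times that number. -/
lemma expect_excited_sq_le (hV : IsPotential V) (hw : IsScatteringSolution V w) (hρ : 0 < ρ)
    (h1 : ρ < 1) (hS : Summable (tailWeight V w ρ)) (hN : (N : ℝ) = ρ * boxVolume ρ)
    (hr : (g0 V w * ρ ^ (2 * eta)) ^ 2 ≤ 1 / 4) :
    expect (prob V w ρ kc N) (fun α => ((N : ℝ) - α 0) * ((N : ℝ) - α 0)) ≤
      2 * ((lowModes hρ).card * (mCut ρ + 1)) ^ 2 +
        2 * N * (4 * tailSum V w ρ + 4 * (lowModes hρ).card * asymBound V w ρ N) := by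
  have hP := hasSum_prob hV hw hρ h1 hS kc N
  have hm := mCut_pos hρ
  have hI := expect_occIn_le hV hw hρ h1 hS hN hr (kc := kc)
  have hle : expect (prob V w ρ kc N) (fun α => ((N : ℝ) - α 0) * ((N : ℝ) - α 0)) ≤
      expect (prob V w ρ kc N) (fun α => 2 * ((lowModes hρ).card * (mCut ρ + 1)) ^ 2 +
        2 * N * (occIn (PIH ρ) α : ℝ)) := by
    refine expect_mono prob_nonneg hP (bddOn_excited.mul bddOn_excited)
      ((BddOn.const _).add ((bddOn_occIn _).const_mul _)) fun α hα => ?_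
    have hM := InM.of_prob hα
    rw [hM.sub_apply_zero hρ h1]
    have e1 : ∑ u ∈ lowModes hρ, (α u : ℝ) ≤ (lowModes hρ).card * (mCut ρ + 1) := by
      rw [← nsmul_eq_mul]
      exact Finset.sum_le_card_nsmul _ _ _ fun u hu =>
        (hM.low_bounds hρ h1 ((mem_lowModes hρ).1 hu)).2.le
    have e0 : 0 ≤ ∑ u ∈ lowModes hρ, (α u : ℝ) := Finset.sum_nonneg fun u _ => Nat.cast_nonneg _
    have e2 : (occIn (PIH ρ) α : ℝ) ≤ N := by
      have h2 := occIn_le_degree (PIH ρ) α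
      rw [(mem_AllConfig.1 hM.mem_AllConfig).2] at h2
      exact_mod_cast h2
    have e3 : (0 : ℝ) ≤ occIn (PIH ρ) α := Nat.cast_nonneg _
    have e4 : (∑ u ∈ lowModes hρ, (α u : ℝ)) ^ 2 ≤ ((lowModes hρ).card * (mCut ρ + 1)) ^ 2 :=
      pow_le_pow_left₀ e0 e1 2
    have e5 : (occIn (PIH ρ) α : ℝ) ^ 2 ≤ N * occIn (PIH ρ) α := by nlinarith
    nlinarith [sq_nonneg ((∑ u ∈ lowModes hρ, (α u : ℝ)) - occIn (PIH ρ) α)]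
  rw [expect_add prob_nonneg hP (BddOn.const _) ((bddOn_occIn _).const_mul _), expect_const hP,
    expect_const_mul] at hle
  have : 2 * (N : ℝ) * expect (prob V w ρ kc N) (fun α => (occIn (PIH ρ) α : ℝ)) ≤
      2 * N * (4 * tailSum V w ρ + 4 * (lowModes hρ).card * asymBound V w ρ N) :=
    mul_le_mul_of_nonneg_left hI (by positivity)
  linarith

/-! ### Condensate moments in terms of the number of excited particles -/

lemma Q_zero_eq (hV : IsPotential V) (hw : IsScatteringSolution V w) (hρ : 0 < ρ)
    (h1 : ρ < 1) (hS : Summable (tailWeight V w ρ)) :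
    Q (trialState V w ρ kc N) [0] = N - excited V w ρ kc N := by
  have hP := hasSum_prob hV hw hρ h1 hS kc N
  have e : Q (trialState V w ρ kc N) [0] = expect (prob V w ρ kc N) (fun α => (α 0 : ℝ)) := by
    simp [Q, expect, prob]
  have e2 : expect (prob V w ρ kc N) (fun α => (α 0 : ℝ)) + excited V w ρ kc N = N := by
    rw [excited, ← expect_add prob_nonneg hP (bddOn_apply 0) bddOn_excited]
    simp only [add_sub_cancel]
    exact expect_const hP _
  rw [e]; linarith

lemma Q_zero_zero_eq (hV : IsPotential V) (hw : IsScatteringSolution V w) (hρ : 0 < ρ)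
    (h1 : ρ < 1) (hS : Summable (tailWeight V w ρ)) :
    Q (trialState V w ρ kc N) [0, 0] = (N : ℝ) ^ 2 - 2 * N * excited V w ρ kc N +
      expect (prob V w ρ kc N) (fun α => ((N : ℝ) - α 0) * ((N : ℝ) - α 0)) := by
  have hP := hasSum_prob hV hw hρ h1 hS kc N
  have hb := bddOn_excited (V := V) (w := w) (ρ := ρ) (kc := kc) (N := N)
  have e : Q (trialState V w ρ kc N) [0, 0] =
      expect (prob V w ρ kc N) (fun α => (α 0 : ℝ) * α 0) := by
    simp [Q, expect, prob]
  have e2 : expect (prob V w ρ kc N) (fun α => (α 0 : ℝ) * α 0) =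
      expect (prob V w ρ kc N) (fun α => (N : ℝ) ^ 2 + ((-2 * N) * ((N : ℝ) - α 0) +
        ((N : ℝ) - α 0) * ((N : ℝ) - α 0))) := by
    congr 1; ext α; ring
  rw [e, e2, expect_add prob_nonneg hP (BddOn.const _) ((hb.const_mul _).add (hb.mul hb)),
    expect_add prob_nonneg hP (hb.const_mul _) (hb.mul hb), expect_const hP, expect_const_mul,
    ← excited]
  ring

/-- Nonnegativity of the variance, from `E (n - (N - α(0)))² ≥ 0`. -/
lemma excited_sq_le (hV : IsPotential V) (hw : IsScatteringSolution V w) (hρ : 0 < ρ)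
    (h1 : ρ < 1) (hS : Summable (tailWeight V w ρ)) :
    excited V w ρ kc N ^ 2 ≤
      expect (prob V w ρ kc N) (fun α => ((N : ℝ) - α 0) * ((N : ℝ) - α 0)) := by
  have hP := hasSum_prob hV hw hρ h1 hS kc N
  have hb := bddOn_excited (V := V) (w := w) (ρ := ρ) (kc := kc) (N := N)
  set n := excited V w ρ kc N with hn
  have h : 0 ≤ expect (prob V w ρ kc N) (fun α => n ^ 2 + ((-2 * n) * ((N : ℝ) - α 0) +
      ((N : ℝ) - α 0) * ((N : ℝ) - α 0))) := by
    refine expect_nonneg prob_nonneg fun α => ?_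
    nlinarith [sq_nonneg (n - ((N : ℝ) - α 0))]
  rw [expect_add prob_nonneg hP (BddOn.const _) ((hb.const_mul _).add (hb.mul hb)),
    expect_add prob_nonneg hP (hb.const_mul _) (hb.mul hb), expect_const hP, expect_const_mul,
    ← excited, ← hn] at h
  linarith

lemma excited_le_card (hV : IsPotential V) (hw : IsScatteringSolution V w) (hρ : 0 < ρ)
    (h1 : ρ < 1) (hS : Summable (tailWeight V w ρ)) : excited V w ρ kc N ≤ N := by
  have hP := hasSum_prob hV hw hρ h1 hS kc N
  refine (expect_mono prob_nonneg hP bddOn_excited (BddOn.const (N : ℝ)) fun α _ => ?_).trans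
    (expect_const hP _).le
  have : (0 : ℝ) ≤ α 0 := Nat.cast_nonneg _
  linarith

end excitedNumber

/-! ### Asymptotics as the density vanishes -/

section asymptotics
variable {V w : Space → ℝ} {ρ kc : ℝ} {N : ℕ} {k u : Mode}

/-- The lattice spacing in units of `√ρ`. -/
def spacing (ρ : ℝ) : ℝ := 2 * Real.pi * ρ ^ (13 / 24 : ℝ)

lemma spacing_pos (hρ : 0 < ρ) : 0 < spacing ρ := by
  have := Real.rpow_pos_of_pos hρ (13 / 24 : ℝ)
  unfold spacing; positivity

lemma scaled_eq (hρ : 0 < ρ) (k : Mode) : scaled ρ k = spacing ρ * ‖latt k‖ := by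
  rw [scaled, norm_momentum hρ, spacing, boxLength, div_eq_mul_inv, div_eq_mul_inv,
    ← Real.rpow_neg hρ.le, ← Real.rpow_neg hρ.le,
    show (13 / 24 : ℝ) = -(-(25 / 24)) + -(1 / 2) by norm_num, Real.rpow_add hρ]
  ring

lemma spacing_pow_mul (hρ : 0 < ρ) :
    spacing ρ ^ 3 * (boxVolume ρ * ρ ^ (3 / 2 : ℝ)) = (2 * Real.pi) ^ 3 := by
  rw [spacing, boxVolume, boxLength, mul_pow, mul_assoc,
    ← Real.rpow_natCast (ρ ^ (13 / 24 : ℝ)), ← Real.rpow_natCast (ρ ^ (-(25 / 24) : ℝ)), ← Real.rpow_mul hρ.le, ← Real.rpow_mul hρ.le,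
    ← Real.rpow_add hρ, ← Real.rpow_add hρ]
  norm_num

lemma rpow_eta_pow (hρ : 0 < ρ) (n : ℕ) : (ρ ^ eta) ^ n = ρ ^ (eta * n) := by
  rw [← Real.rpow_natCast, ← Real.rpow_mul hρ.le]

/-- As `η = 1/200`, the power `(ρ^η)^100` is `ρ^{1/2}`. All error terms can then be compared as
powers of the single parameter `t = ρ^η`. -/
lemma spacing_pow_mul_card (hρ : 0 < ρ) (hN : (N : ℝ) = ρ * boxVolume ρ) :
    spacing ρ ^ 3 * N * (ρ ^ eta) ^ 100 = (2 * Real.pi) ^ 3 := by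
  rw [← spacing_pow_mul hρ, rpow_eta_pow hρ, hN, mul_assoc, show (3 / 2 : ℝ) = 1 + 1 / 2 by norm_num,
    Real.rpow_add hρ, Real.rpow_one, show eta * (100 : ℕ) = 1 / 2 by norm_num [eta]]
  ring

lemma tendsto_rpow_zero {a : ℝ} (ha : 0 < a) :
    Tendsto (fun ρ : ℝ => ρ ^ a) (𝓝[>] 0) (𝓝 0) := by
  have h := (Real.continuousAt_rpow_const 0 a (Or.inr ha.le)).tendsto
  rw [Real.zero_rpow ha.ne'] at h
  exact h.mono_left nhdsWithin_le_nhds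

lemma tendsto_spacing : Tendsto spacing (𝓝[>] 0) (𝓝 0) := by
  have := (tendsto_rpow_zero (a := 13 / 24) (by norm_num)).const_mul (2 * Real.pi)
  rwa [mul_zero] at this

lemma tendsto_mCut : Tendsto mCut (𝓝[>] 0) atTop := by
  have h := (tendsto_rpow_zero (a := eta) (by norm_num [eta]))
  have h2 : Tendsto (fun ρ : ℝ => ρ ^ eta) (𝓝[>] 0) (𝓝[>] 0) := by
    refine tendsto_nhdsWithin_iff.2 ⟨h, ?_⟩
    filter_upwards [self_mem_nhdsWithin] with ρ hρ using Real.rpow_pos_of_pos hρ _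
  refine h2.inv_tendsto_nhdsGT_zero.congr' ?_
  filter_upwards [self_mem_nhdsWithin] with ρ hρ
  rw [mCut, Real.rpow_neg (le_of_lt hρ)]; rfl

lemma eventually_spacing_le : ∀ᶠ ρ in 𝓝[>] (0 : ℝ), 4 * spacing ρ ≤ ρ ^ eta := by
  have h : Tendsto (fun ρ : ℝ => 8 * Real.pi * ρ ^ (13 / 24 - eta)) (𝓝[>] 0) (𝓝 0) := by
    have := (tendsto_rpow_zero (a := 13 / 24 - eta) (by norm_num [eta])).const_mul (8 * Real.pi)
    rwa [mul_zero] at this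
  filter_upwards [h.eventually_lt_const one_pos, self_mem_nhdsWithin] with ρ h1 hρ
  have hρ' : 0 < ρ := hρ
  have he := Real.rpow_pos_of_pos hρ' eta
  have e : 4 * spacing ρ = 8 * Real.pi * ρ ^ (13 / 24 - eta) * ρ ^ eta := by
    rw [spacing, mul_assoc (8 * Real.pi), ← Real.rpow_add hρ', sub_add_cancel]; ring
  rw [e]
  nlinarith

/-- Near a fixed `r > 0` the ratio stays below a constant `x < 1`, so `(m_c + 2) x^⌈m_c⌉` vanishes.
At the infrared edge `x` tends to `1` and the cutoff error is not uniformly small; hence it is kept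
in the profile and removed by dominated convergence. -/
lemma tendsto_lowProfile {c : ℝ} (hc : 0 ≤ c) {r : ℝ} (hr : 0 < r) {s : ℝ → ℝ}
    (hs : Tendsto s (𝓝[>] 0) (𝓝 r)) :
    Tendsto (fun ρ => lowProfile c ρ (s ρ)) (𝓝[>] 0) (𝓝 (bogF c r)) := by
  have hF : Tendsto (fun ρ => bogF c (s ρ)) (𝓝[>] 0) (𝓝 (bogF c r)) :=
    ((continuousOn_bogF hc).continuousAt (Ioi_mem_nhds hr)).tendsto.comp hs
  have hr2 : 0 < r / 2 := half_pos hr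
  set x := bogX c (r / 2)
  have hx0 : 0 ≤ x := bogX_nonneg _ _
  have hx1 : x < 1 := bogX_lt_one hc _
  have htail : Tendsto (fun ρ => bogS c (s ρ) * ((mCut ρ + 2) * bogX c (s ρ) ^ ⌈mCut ρ⌉₊))
      (𝓝[>] 0) (𝓝 0) := by
    have hJ : Tendsto (fun ρ => ⌈mCut ρ⌉₊) (𝓝[>] 0) atTop :=
      tendsto_nat_ceil_atTop.comp tendsto_mCut
    have h1 := (tendsto_self_mul_const_pow_of_lt_one hx0 hx1).add
      ((tendsto_pow_atTop_nhds_zero_of_lt_one hx0 hx1).const_mul 2)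
    have h2 := (h1.comp hJ).const_mul (bogS c (r / 2))
    simp only [mul_zero, add_zero] at h2
    refine squeeze_zero' ?_ ?_ h2
    · filter_upwards [self_mem_nhdsWithin] with ρ hρ
      have := mCut_pos (ρ := ρ) hρ
      have := one_le_bogS hc (s ρ)
      have := bogX_nonneg c (s ρ)
      positivity
    · filter_upwards [hs.eventually_const_lt (half_lt_self hr), self_mem_nhdsWithin] with ρ h3 hρ
      have hm := mCut_pos (ρ := ρ) hρ
      have e1 := bogS_anti hc hr2 h3.le
      have e2 := bogX_anti hc hr2 h3.le
      have e3 := one_le_bogS hc (r / 2)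
      have e4 : mCut ρ ≤ ⌈mCut ρ⌉₊ := Nat.le_ceil _
      have e5 := bogX_nonneg c (s ρ)
      have e6 := one_le_bogS hc (s ρ)
      simp only [Function.comp_apply]
      rw [← add_mul]
      gcongr
  have h := hF.sub htail
  rw [sub_zero] at h
  have h0 := (tendsto_const_nhds (x := (0 : ℝ))).max h
  rwa [max_eq_right (bogF_nonneg hc r)] at h0

lemma lowProfile_nonneg (c ρ r : ℝ) : 0 ≤ lowProfile c ρ r := le_max_left _ _

lemma lowProfile_le {c : ℝ} (hc : 0 ≤ c) (hρ : 0 < ρ) (r : ℝ) : lowProfile c ρ r ≤ bogF c r := by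
  refine max_le (bogF_nonneg hc r) ?_
  have := mCut_pos hρ
  have := one_le_bogS hc r
  have := bogX_nonneg c r
  have : 0 ≤ bogS c r * ((mCut ρ + 2) * bogX c r ^ ⌈mCut ρ⌉₊) := by positivity
  linarith

open Classical in
lemma sum_lowModes_eq_tsum (hρ : 0 < ρ) (f : ℝ → ℝ) :
    ∑ u ∈ lowModes hρ, f (scaled ρ u) =
      ∑' u, if u ∈ PL ρ then f (spacing ρ * ‖latt u‖) else 0 := by
  rw [tsum_eq_sum (s := lowModes hρ)]
  · refine Finset.sum_congr rfl fun u hu => ?_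
    rw [if_pos ((mem_lowModes hρ).1 hu), scaled_eq hρ]
  · intro u hu
    rw [mem_lowModes] at hu
    rw [if_neg hu]

open Classical in
lemma tendsto_low_sum {c : ℝ} (hc : 0 ≤ c) {Φ : ℝ → ℝ → ℝ} (hΦ0 : ∀ ρ r, 0 ≤ Φ ρ r)
    (hΦ1 : ∀ ρ r, 0 < ρ → Φ ρ r ≤ bogF c r)
    (hΦ : ∀ (r : ℝ) (s : ℝ → ℝ), 0 < r → Tendsto s (𝓝[>] 0) (𝓝 r) →
      Tendsto (fun ρ => Φ ρ (s ρ)) (𝓝[>] 0) (𝓝 (bogF c r))) :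
    Tendsto (fun ρ => spacing ρ ^ 3 *
      ∑' u, if u ∈ PL ρ then Φ ρ (spacing ρ * ‖latt u‖) else 0) (𝓝[>] 0)
      (𝓝 (Real.pi * c ^ (3 / 2 : ℝ) / 3)) := by
  have hpos : ∀ᶠ ρ in 𝓝[>] (0 : ℝ), 0 < spacing ρ := by
    filter_upwards [self_mem_nhdsWithin] with ρ hρ using spacing_pos hρ
  have hS : ∀ᶠ ρ in 𝓝[>] (0 : ℝ), ∀ n, n ∈ PL ρ ↔
      ρ ^ eta ≤ spacing ρ * ‖latt n‖ ∧ spacing ρ * ‖latt n‖ ≤ mCut ρ := by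
    filter_upwards [self_mem_nhdsWithin] with ρ hρ n
    rw [← scaled_eq hρ]; exact mem_PL_iff hρ
  have h := tendsto_annulus_sum hc hpos tendsto_spacing
    (tendsto_rpow_zero (a := eta) (by norm_num [eta])) tendsto_mCut eventually_spacing_le PL hS
    -- `tendsto_annulus_sum` asks for domination at every `ρ`, so the family is set to zero where
    -- `ρ` is not positive.
    (Φ := fun ρ r => if 0 < ρ then Φ ρ r else 0)
    (fun ρ r => by split_ifs <;> [exact hΦ0 _ _; exact le_rfl])
    (fun ρ r => by split_ifs with h <;> [exact hΦ1 _ _ h; exact bogF_nonneg hc r])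
    (fun r s hr hs => (hΦ r s hr hs).congr' (by
      filter_upwards [self_mem_nhdsWithin] with ρ hρ using (if_pos hρ).symm))
  refine h.congr' ?_
  filter_upwards [self_mem_nhdsWithin] with ρ hρ
  simp only [if_pos (show 0 < ρ from hρ)]

/-- The tail is a sum of `r⁻⁴` over `r > ρ^{-η}`, whose scaled size is the inverse of the lower
radius. -/
lemma tailWeight_summable_and_le (hρ : 0 < ρ) (h1 : ρ < 1) (h4 : 4 * spacing ρ ≤ ρ ^ eta) :
    Summable (tailWeight V w ρ) ∧
      spacing ρ ^ 3 * tailSum V w ρ ≤ g0 V w ^ 2 * (192 * Real.pi) * ρ ^ eta := by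
  classical
  have he := Real.rpow_pos_of_pos hρ eta
  have hle : ρ ^ eta ≤ ρ ^ (-eta) :=
    Real.rpow_le_rpow_of_exponent_ge hρ h1.le (by norm_num [eta])
  obtain ⟨hs, hb⟩ := lattice_sum_inv_pow_four (spacing_pos hρ) (h4.trans hle)
  have hterm : ∀ k, tailWeight V w ρ k ≤ g0 V w ^ 2 *
      (if ρ ^ (-eta) ≤ spacing ρ * ‖latt k‖ then ((spacing ρ * ‖latt k‖) ^ 4)⁻¹ else 0) := by
    intro k
    have := spacing_pos hρ
    unfold tailWeight
    by_cases hk : k ∈ PIH ρ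
    · have hk' := (mem_PIH_iff hρ h1).1 hk
      rw [scaled_eq hρ] at hk'
      rw [if_pos hk, if_pos hk'.le, scaled_eq hρ, div_pow, ← pow_mul, div_eq_mul_inv]
    · rw [if_neg hk]; split_ifs <;> positivity
  have hs' := Summable.of_nonneg_of_le tailWeight_nonneg hterm (hs.mul_left (g0 V w ^ 2))
  refine ⟨hs', ?_⟩
  have h3 : tailSum V w ρ ≤ _ := hs'.tsum_le_tsum hterm (hs.mul_left (g0 V w ^ 2))
  rw [tsum_mul_left] at h3
  have hsp := spacing_pos hρ
  calc spacing ρ ^ 3 * tailSum V w ρ ≤ spacing ρ ^ 3 * _ :=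
        mul_le_mul_of_nonneg_left h3 (by positivity)
    _ = g0 V w ^ 2 * (spacing ρ ^ 3 * _) := by ring
    _ ≤ g0 V w ^ 2 * _ := mul_le_mul_of_nonneg_left hb (by positivity)
    _ = _ := by rw [Real.rpow_neg hρ.le]; field_simp

/-- Every low mode has `r ≤ t⁻¹`, so it contributes at least `t⁴` to the sum of `r⁻⁴` over `r ≥ t`,
which is `O(t⁻¹)` after scaling. -/
lemma card_lowModes_le (hρ : 0 < ρ) (h4 : 4 * spacing ρ ≤ ρ ^ eta) :
    spacing ρ ^ 3 * (lowModes hρ).card ≤ 192 * Real.pi / (ρ ^ eta) ^ 5 := by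
  classical
  have he := Real.rpow_pos_of_pos hρ eta
  have hsp := spacing_pos hρ
  obtain ⟨hs, hb⟩ := lattice_sum_inv_pow_four hsp h4
  have h1 : ((lowModes hρ).card : ℝ) * (ρ ^ eta) ^ 4 ≤
      ∑' n : Mode, (if ρ ^ eta ≤ spacing ρ * ‖latt n‖ then
        ((spacing ρ * ‖latt n‖) ^ 4)⁻¹ else 0) := by
    rw [← nsmul_eq_mul]
    refine le_trans (Finset.card_nsmul_le_sum _ _ _ fun u hu => ?_)
      (hs.sum_le_tsum (lowModes hρ) fun n _ => by split_ifs <;> positivity)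
    obtain ⟨h2, h3⟩ := (mem_PL_iff hρ).1 ((mem_lowModes hρ).1 hu)
    rw [scaled_eq hρ] at h2 h3
    rw [if_pos h2, ← inv_pow]
    refine pow_le_pow_left₀ he.le ?_ 4
    rw [Real.rpow_neg hρ.le] at h3
    exact (le_inv_comm₀ (by linarith) he).1 h3
  have h2 := (mul_le_mul_of_nonneg_left h1 (by positivity : 0 ≤ spacing ρ ^ 3)).trans hb
  rw [le_div_iff₀ (by positivity)]
  rw [le_div_iff₀ he] at h2
  calc _ = spacing ρ ^ 3 * (((lowModes hρ).card : ℝ) * (ρ ^ eta) ^ 4) * ρ ^ eta := by ring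
    _ ≤ _ := h2

lemma mCut_eq (hρ : 0 < ρ) : mCut ρ = (ρ ^ eta)⁻¹ := by rw [mCut, Real.rpow_neg hρ.le]

/-- The growth `m_c + 1 ≤ 2/t` is compensated by the factor `t` in the bound for `tailSum`; dividing
by `h³ N = (2π)³ t^{-100}` leaves `t^100`. -/
lemma asymBound_le (hρ : 0 < ρ) (h1 : ρ < 1) (h4 : 4 * spacing ρ ≤ ρ ^ eta)
    (hN : (N : ℝ) = ρ * boxVolume ρ) :
    asymBound V w ρ N ≤ 8 * (g0 V w ^ 2 * (192 * Real.pi)) * (ρ ^ eta) ^ 100 := by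
  have hsp := spacing_pos hρ
  have ht := Real.rpow_pos_of_pos hρ eta
  have ht1 : ρ ^ eta ≤ 1 := Real.rpow_le_one hρ.le h1.le (by norm_num [eta])
  have hS := (tailWeight_summable_and_le (V := V) (w := w) hρ h1 h4).2
  have hNt := spacing_pow_mul_card hρ hN
  have hS0 := tailSum_nonneg (V := V) (w := w) (ρ := ρ)
  set t := ρ ^ eta
  set C := g0 V w ^ 2 * (192 * Real.pi)
  have hC : 0 ≤ C := by have := Real.pi_pos; positivity
  have hpi : 1 ≤ (2 * Real.pi) ^ 3 := one_le_pow₀ (by linarith [Real.pi_gt_three])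
  have hN0 : 0 < (N : ℝ) := by
    rw [hN]; exact mul_pos hρ (boxVolume_pos hρ)
  rw [asymBound, mCut_eq hρ, div_le_iff₀ hN0]
  have h3 : 0 < spacing ρ ^ 3 := by positivity
  refine le_of_mul_le_mul_left ?_ h3
  have hm : t⁻¹ + 1 ≤ 2 * t⁻¹ := by
    have := (one_le_inv₀ ht).2 ht1
    linarith
  calc spacing ρ ^ 3 * (4 * (t⁻¹ + 1) * tailSum V w ρ)
      = 4 * (t⁻¹ + 1) * (spacing ρ ^ 3 * tailSum V w ρ) := by ring
    _ ≤ 4 * (2 * t⁻¹) * (C * t) := by gcongr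
    _ = 8 * C * 1 := by field_simp; ring
    _ ≤ 8 * C * (2 * Real.pi) ^ 3 := by gcongr
    _ = _ := by rw [← hNt]; ring

end asymptotics

/-! ### Error bookkeeping in powers of `ρ^η` and the limit of the scaled moments -/

section final
variable {V w : Space → ℝ} {ρ kc : ℝ} {N : ℕ}

/-- Here and below `t = ρ^η`, `δ` is `asymBound`, and `D`, `S` are the number of low modes and
`tailSum`, both multiplied by `h³`. The product `D t⁻¹ δ` is of order `t^94`, so `S`, of order `t`,
dominates. -/
lemma upper_error_le {t D δ S C₁ C₂ : ℝ} (ht : 0 < t) (ht1 : t ≤ 1)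
    (hC₂ : 0 ≤ C₂) (hδ0 : 0 ≤ δ) (hD : D ≤ C₂ / t ^ 5) (hδ : δ ≤ 8 * C₁ * t ^ 100)
    (hS : S ≤ C₁ * t) (hC₁ : 0 ≤ C₁) :
    D * (2 * (t⁻¹ + 1) * δ) + (4 * S + 4 * (D * δ)) ≤ (64 * C₁ * C₂ + 4 * C₁) * t := by
  have hm : t⁻¹ + 1 ≤ 2 * t⁻¹ := by linarith [(one_le_inv₀ ht).2 ht1]
  have hDδ : D * δ ≤ 8 * C₁ * C₂ * t ^ 95 := by
    calc D * δ ≤ C₂ / t ^ 5 * (8 * C₁ * t ^ 100) := by gcongr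
      _ = _ := by field_simp
  have h1 : D * (2 * (t⁻¹ + 1) * δ) ≤ 32 * C₁ * C₂ * t ^ 94 := by
    calc D * (2 * (t⁻¹ + 1) * δ) = 2 * (t⁻¹ + 1) * (D * δ) := by ring
      _ ≤ 2 * (t⁻¹ + 1) * (8 * C₁ * C₂ * t ^ 95) := by gcongr
      _ ≤ 2 * (2 * t⁻¹) * (8 * C₁ * C₂ * t ^ 95) := by gcongr
      _ = _ := by field_simp; ring
  have p1 : t ^ 94 ≤ t := pow_le_of_le_one ht.le ht1 (by norm_num)
  have p2 : t ^ 95 ≤ t := pow_le_of_le_one ht.le ht1 (by norm_num)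
  have q1 : 32 * C₁ * C₂ * t ^ 94 ≤ 32 * C₁ * C₂ * t := by gcongr
  have q2 : 8 * C₁ * C₂ * t ^ 95 ≤ 8 * C₁ * C₂ * t := by gcongr
  linarith

/-- Here `x` is the relative depletion `(2 excited + 1) / N`. The largest product is `D t⁻² x`, of
order `t^93`. -/
lemma lower_error_le {t D δ x s C₁ C₂ K : ℝ} (ht : 0 < t) (ht1 : t ≤ 1)
    (hC₂ : 0 ≤ C₂) (hs : 0 ≤ s) (hδ0 : 0 ≤ δ) (hx0 : 0 ≤ x) (hK : 0 ≤ K) (hC₁ : 0 ≤ C₁)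
    (hD : D ≤ C₂ / t ^ 5) (hδ : δ ≤ 8 * C₁ * t ^ 100) (hx : x ≤ K * t ^ 100) :
    D * ((1 + s * t⁻¹) * ((t⁻¹ + 2) * x + 2 * δ)) ≤ C₂ * (1 + s) * (3 * K + 16 * C₁) * t := by
  have hi := (one_le_inv₀ ht).2 ht1
  have hi0 : 0 < t⁻¹ := by positivity
  have h2 : t⁻¹ + 2 ≤ 3 * t⁻¹ := by linarith
  have h3 : 1 + s * t⁻¹ ≤ (1 + s) * t⁻¹ := by linarith
  have p1 : t ^ 100 ≤ t ^ 99 := pow_le_pow_of_le_one ht.le ht1 (by norm_num)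
  have h4 : (t⁻¹ + 2) * x + 2 * δ ≤ (3 * K + 16 * C₁) * t ^ 99 := by
    have e1 : (t⁻¹ + 2) * x ≤ 3 * t⁻¹ * (K * t ^ 100) := by gcongr
    have e2 : 3 * t⁻¹ * (K * t ^ 100) = 3 * K * t ^ 99 := by field_simp
    have e3 : 8 * C₁ * t ^ 100 ≤ 8 * C₁ * t ^ 99 := by gcongr
    linarith
  have p2 : t ^ 93 ≤ t := pow_le_of_le_one ht.le ht1 (by norm_num)
  calc D * ((1 + s * t⁻¹) * ((t⁻¹ + 2) * x + 2 * δ))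
      ≤ C₂ / t ^ 5 * ((1 + s) * t⁻¹ * ((3 * K + 16 * C₁) * t ^ 99)) := by gcongr
    _ = C₂ * (1 + s) * (3 * K + 16 * C₁) * t ^ 93 := by field_simp
    _ ≤ _ := by gcongr

/-- The square of the low occupation, of order `t^{-12}`, is small against `n = h³ N`, because `n ≥
t^{-100}`. -/
lemma square_error_le {t D δ S n C₁ C₂ : ℝ} (ht : 0 < t) (ht1 : t ≤ 1) (hD0 : 0 ≤ D)
    (hC₂ : 0 ≤ C₂) (hδ0 : 0 ≤ δ) (hC₁ : 0 ≤ C₁) (hn : 1 ≤ n * t ^ 100)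
    (hD : D ≤ C₂ / t ^ 5) (hδ : δ ≤ 8 * C₁ * t ^ 100) (hS : S ≤ C₁ * t) :
    2 * (D * (t⁻¹ + 1)) ^ 2 + 2 * n * (4 * S + 4 * (D * δ)) ≤
      (8 * C₂ ^ 2 + 8 * C₁ + 64 * C₁ * C₂) * t * n := by
  have hi := (one_le_inv₀ ht).2 ht1
  have hm : t⁻¹ + 1 ≤ 2 * t⁻¹ := by linarith
  have hn0 : 0 < n := pos_of_mul_pos_left (by linarith) (by positivity : 0 ≤ t ^ 100)
  have hDδ : D * δ ≤ 8 * C₁ * C₂ * t := by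
    calc D * δ ≤ C₂ / t ^ 5 * (8 * C₁ * t ^ 100) := by gcongr
      _ = 8 * C₁ * C₂ * t ^ 95 := by field_simp
      _ ≤ _ := by
        have p2 : t ^ 95 ≤ t := pow_le_of_le_one ht.le ht1 (by norm_num)
        gcongr
  have h1 : 2 * (D * (t⁻¹ + 1)) ^ 2 ≤ 8 * C₂ ^ 2 * t * n := by
    calc 2 * (D * (t⁻¹ + 1)) ^ 2 ≤ 2 * (C₂ / t ^ 5 * (2 * t⁻¹)) ^ 2 := by gcongr
      _ = 8 * C₂ ^ 2 * (t ^ 12)⁻¹ * 1 := by field_simp; ring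
      _ ≤ 8 * C₂ ^ 2 * (t ^ 12)⁻¹ * (n * t ^ 100) := by gcongr
      _ = 8 * C₂ ^ 2 * t ^ 88 * n := by field_simp
      _ ≤ _ := by
        have p2 : t ^ 88 ≤ t := pow_le_of_le_one ht.le ht1 (by norm_num)
        gcongr
  have h2 : 2 * n * (4 * S + 4 * (D * δ)) ≤ 2 * n * (4 * (C₁ * t) + 4 * (8 * C₁ * C₂ * t)) := by
    gcongr
  linarith

/-- The scaled mean number of excited particles converges, and its scaled second moment is
negligible against the total number of particles. -/
lemma eventually_excited (hV : IsPotential V) (hw : IsScatteringSolution V w) {ε : ℝ}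
    (hε : 0 < ε) :
    ∀ᶠ ρ in 𝓝[>] (0 : ℝ), ρ < 1 ∧ Summable (tailWeight V w ρ) ∧
      ∀ (kc : ℝ) (N : ℕ), (N : ℝ) = ρ * boxVolume ρ →
        |spacing ρ ^ 3 * excited V w ρ kc N -
          Real.pi * (4 * g0 V w) ^ (3 / 2 : ℝ) / 3| ≤ ε ∧
        spacing ρ ^ 3 * expect (prob V w ρ kc N)
          (fun α => ((N : ℝ) - α 0) * ((N : ℝ) - α 0)) ≤ ε * N := by
  classical
  have hg := g0_nonneg hV hw
  have hc : 0 ≤ 4 * g0 V w := by positivity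
  set c := 4 * g0 V w with hcdef
  set I := Real.pi * c ^ (3 / 2 : ℝ) / 3 with hI
  have hI0 : 0 ≤ I := by have := Real.pi_pos; positivity
  set C₁ := g0 V w ^ 2 * (192 * Real.pi)
  set C₂ := 192 * Real.pi
  have hC₁ : 0 ≤ C₁ := by have := Real.pi_pos; positivity
  have hC₂ : 0 ≤ C₂ := by have := Real.pi_pos; positivity
  -- `K` bounds `h³ (2 excited + 1)` once `h³ excited ≤ I + ε` and `h³ ≤ 1` are known.
  set K := 2 * (I + ε) + 1 with hK
  have hK0 : 0 ≤ K := by positivity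
  have hup := tendsto_low_sum hc (Φ := fun _ r => bogF c r) (fun _ r => bogF_nonneg hc r)
    (fun _ _ _ => le_rfl) (fun r s hr hs =>
      ((continuousOn_bogF hc).continuousAt (Ioi_mem_nhds hr)).tendsto.comp hs)
  have hlo := tendsto_low_sum hc (Φ := lowProfile c) (fun _ _ => lowProfile_nonneg _ _ _)
    (fun _ r hρ => lowProfile_le hc hρ r) (fun r s hr hs => tendsto_lowProfile hc hr hs)
  have ht := tendsto_rpow_zero (a := eta) (by norm_num [eta])
  have hsmall : ∀ (A : ℝ) {δ : ℝ}, 0 < δ → ∀ᶠ ρ in 𝓝[>] (0 : ℝ), A * ρ ^ eta < δ := by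
    intro A δ hδ
    have := ht.const_mul A
    rw [mul_zero] at this
    exact this.eventually_lt_const hδ
  have hr : ∀ᶠ ρ in 𝓝[>] (0 : ℝ), (g0 V w * ρ ^ (2 * eta)) ^ 2 < 1 / 4 := by
    have := ((tendsto_rpow_zero (a := 2 * eta) (by norm_num [eta])).const_mul (g0 V w)).pow 2
    rw [mul_zero, zero_pow two_ne_zero] at this
    exact this.eventually_lt_const (by norm_num)
  have hh : ∀ᶠ ρ in 𝓝[>] (0 : ℝ), spacing ρ < 1 := tendsto_spacing.eventually_lt_const one_pos
  have hρ1 : ∀ᶠ ρ in 𝓝[>] (0 : ℝ), ρ < 1 :=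
    (tendsto_id.mono_left nhdsWithin_le_nhds).eventually_lt_const one_pos
  filter_upwards [self_mem_nhdsWithin, hρ1, hr, hh, eventually_spacing_le,
    hup.eventually_lt_const (show I < I + ε / 2 by linarith),
    hlo.eventually_const_lt (show I - ε / 2 < I by linarith),
    hsmall (64 * C₁ * C₂ + 4 * C₁) (half_pos hε),
    hsmall (C₂ * (1 + Real.sqrt c) * (3 * K + 16 * C₁)) (half_pos hε),
    hsmall (8 * C₂ ^ 2 + 8 * C₁ + 64 * C₁ * C₂) hε] with ρ hρ' h1 hr hh h4 hU hL hs1 hs2 hs3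
  have hρ : 0 < ρ := hρ'
  obtain ⟨hS, hSle⟩ := tailWeight_summable_and_le (V := V) (w := w) hρ h1 h4
  refine ⟨h1, hS, fun kc N hN => ?_⟩
  have hNpos : (0 : ℝ) < N := by rw [hN]; exact mul_pos hρ (boxVolume_pos hρ)
  have hN0 : 0 < N := by exact_mod_cast hNpos
  have htpos := Real.rpow_pos_of_pos hρ eta
  have ht1 : ρ ^ eta ≤ 1 := Real.rpow_le_one hρ.le h1.le (by norm_num [eta])
  have hNt := spacing_pow_mul_card hρ hN
  have hD := card_lowModes_le hρ h4
  have hδ := asymBound_le (V := V) (w := w) hρ h1 h4 hN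
  have hδ0 := asymBound_nonneg (V := V) (w := w) (N := N) hρ
  have hm := mCut_eq hρ
  have hsp := spacing_pos hρ
  have hpi : 1 ≤ (2 * Real.pi) ^ 3 := one_le_pow₀ (by linarith [Real.pi_gt_three])
  have hq0 : 0 < spacing ρ ^ 3 := by positivity
  have hq1 : spacing ρ ^ 3 ≤ 1 := pow_le_one₀ hsp.le hh.le
  have hup1 := mul_le_mul_of_nonneg_left (excited_le hV hw hρ h1 hS hN hr.le (kc := kc)) hq0.le
  have hlo1 := mul_le_mul_of_nonneg_left (le_excited hV hw hρ h1 hS hN hN0 (kc := kc)) hq0.le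
  -- The factor is `h⁶`, not `h³`: it turns the squared number of low modes into `D²`, and `N
  -- tailSum` into a product of two scaled quantities.
  have hsq1 := mul_le_mul_of_nonneg_left
    (expect_excited_sq_le hV hw hρ h1 hS hN hr.le (kc := kc)) (mul_pos hq0 hq0).le
  have hn0 := excited_nonneg (V := V) (w := w) (ρ := ρ) (kc := kc) (N := N)
  rw [← sum_lowModes_eq_tsum hρ (bogF c)] at hU
  rw [← sum_lowModes_eq_tsum hρ (lowProfile c ρ)] at hL
  rw [hm] at hup1 hlo1 hsq1
  rw [Real.rpow_neg hρ.le] at hlo1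
  rw [← hcdef] at hup1 hlo1
  set t := ρ ^ eta
  set q := spacing ρ ^ 3
  set D := q * ((lowModes hρ).card : ℝ) with hDdef
  have hD0 : 0 ≤ D := by positivity
  set δ := asymBound V w ρ N
  set n := excited V w ρ kc N
  have eU := upper_error_le htpos ht1 hC₂ hδ0 hD hδ hSle hC₁
  have hnU : q * n ≤ I + ε := by
    rw [mul_add] at hup1
    have : q * ((lowModes hρ).card * (2 * (t⁻¹ + 1) * δ) +
        (4 * tailSum V w ρ + 4 * (lowModes hρ).card * δ)) =
        D * (2 * (t⁻¹ + 1) * δ) + (4 * (q * tailSum V w ρ) + 4 * (D * δ)) := by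
      rw [hDdef]; ring
    linarith
  -- The upper bound on `excited` feeds the lower one: relative depletion is `O(t^100) =
  -- O(ρ^{1/2})`.
  have hx : (2 * n + 1) / N ≤ K * t ^ 100 := by
    rw [div_le_iff₀ hNpos]
    refine le_of_mul_le_mul_left ?_ hq0
    calc q * (2 * n + 1) ≤ K * 1 := by linarith
      _ ≤ K * (2 * Real.pi) ^ 3 := by gcongr
      _ = _ := by rw [← hNt]; ring
  have eL := lower_error_le (x := (2 * n + 1) / N) htpos ht1 hC₂ (Real.sqrt_nonneg c) hδ0
    (by positivity) hK0 hC₁ hD hδ hx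
  have eS := square_error_le (n := q * N) htpos ht1 hD0 hC₂ hδ0 hC₁ (by rw [hNt]; exact hpi)
    hD hδ hSle
  refine ⟨abs_le.2 ⟨?_, by linarith⟩, ?_⟩
  · have : q * ((lowModes hρ).card * ((1 + Real.sqrt c * t⁻¹) *
        ((t⁻¹ + 2) * ((2 * n + 1) / N) + 2 * δ))) =
        D * ((1 + Real.sqrt c * t⁻¹) * ((t⁻¹ + 2) * ((2 * n + 1) / N) + 2 * δ)) := by
      rw [hDdef]; ring
    rw [mul_sub] at hlo1
    linarith
  · have e : q * q * (2 * ((lowModes hρ).card * (t⁻¹ + 1)) ^ 2 +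
        2 * N * (4 * tailSum V w ρ + 4 * (lowModes hρ).card * δ)) =
        2 * (D * (t⁻¹ + 1)) ^ 2 + 2 * (q * N) * (4 * (q * tailSum V w ρ) + 4 * (D * δ)) := by
      rw [hDdef]; ring
    rw [e] at hsq1
    refine le_of_mul_le_mul_left ?_ hq0
    rw [← mul_assoc]
    refine hsq1.trans (eS.trans ?_)
    have : (8 * C₂ ^ 2 + 8 * C₁ + 64 * C₁ * C₂) * t * (q * N) ≤ ε * (q * N) :=
      mul_le_mul_of_nonneg_right hs3.le (by positivity)
    linarith

end final
end BoseGas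
end

/-! ### Passage from the scaled moments to `Q` -/

theorem lemma6 (V w : BoseGas.Space → ℝ) (hV : BoseGas.IsPotential V)
    (hw : BoseGas.IsScatteringSolution V w) (kc : ℝ) (hkc : 0 < kc) (ε : ℝ) (hε : 0 < ε) :
    ∃ ρ₁ : ℝ, 0 < ρ₁ ∧ ∀ ρ : ℝ, 0 < ρ → ρ < ρ₁ →
      ∀ N : ℕ, (N : ℝ) = ρ * BoseGas.boxVolume ρ →
        HasSum (fun α => ‖BoseGas.trialState V w ρ kc N α‖ ^ 2) 1 ∧
        BoseGas.boxVolume ρ * (BoseGas.rho0 V w ρ - ε * ρ ^ (3 / 2 : ℝ)) ≤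
          BoseGas.Q (BoseGas.trialState V w ρ kc N) [0] ∧
        BoseGas.Q (BoseGas.trialState V w ρ kc N) [0] ≤
          BoseGas.boxVolume ρ * (BoseGas.rho0 V w ρ + ε * ρ ^ (3 / 2 : ℝ)) ∧
        (BoseGas.boxVolume ρ * (BoseGas.rho0 V w ρ - ε * ρ ^ (3 / 2 : ℝ))) ^ 2 ≤
          BoseGas.Q (BoseGas.trialState V w ρ kc N) [0, 0] ∧
        BoseGas.Q (BoseGas.trialState V w ρ kc N) [0, 0] ≤
          (BoseGas.boxVolume ρ * (BoseGas.rho0 V w ρ + ε * ρ ^ (3 / 2 : ℝ))) ^ 2 := by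
  have hg := BoseGas.g0_nonneg hV hw
  have hpi := Real.pi_pos
  set c₀ : ℝ := 1 / (3 * Real.pi ^ 2) * BoseGas.g0 V w ^ (3 / 2 : ℝ) with hc₀
  have hc₀0 : 0 ≤ c₀ := by positivity
  -- The factor `(2π)³` is `h³ |Λ| ρ^{3/2}`, so the accuracy is `ε/2` in units of `|Λ| ρ^{3/2}`. The
  -- other half of `ε` leaves room for the second moment.
  have hev := BoseGas.eventually_excited hV hw
    (show 0 < (2 * Real.pi) ^ 3 * (ε / 2) by positivity)
  have hsm : ∀ᶠ ρ in 𝓝[>] (0 : ℝ), (c₀ + ε) * ρ ^ (1 / 2 : ℝ) < 1 / 2 := by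
    have := (BoseGas.tendsto_rpow_zero (a := 1 / 2) (by norm_num)).const_mul (c₀ + ε)
    rw [mul_zero] at this
    exact this.eventually_lt_const (by norm_num)
  obtain ⟨ρ₁, hρ₁, hball⟩ := mem_nhdsGT_iff_exists_Ioo_subset.1 (hev.and hsm)
  refine ⟨ρ₁, hρ₁, fun ρ hρ hρlt N hN => ?_⟩
  obtain ⟨⟨h1, hS, hmain⟩, hsmall⟩ := hball ⟨hρ, hρlt⟩
  obtain ⟨hn, hsq⟩ := hmain kc N hN
  have hNpos : (0 : ℝ) < N := by rw [hN]; exact mul_pos hρ (BoseGas.boxVolume_pos hρ)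
  have hqD := BoseGas.spacing_pow_mul hρ
  have hq0 : 0 < BoseGas.spacing ρ ^ 3 := pow_pos (BoseGas.spacing_pos hρ) 3
  set D := BoseGas.boxVolume ρ * ρ ^ (3 / 2 : ℝ) with hD
  have hD0 : 0 < D := mul_pos (BoseGas.boxVolume_pos hρ) (Real.rpow_pos_of_pos hρ _)
  have hDN : D = N * ρ ^ (1 / 2 : ℝ) := by
    rw [hD, hN, show (3 / 2 : ℝ) = 1 + 1 / 2 by norm_num, Real.rpow_add hρ, Real.rpow_one]; ring
  have hlim : Real.pi * (4 * BoseGas.g0 V w) ^ (3 / 2 : ℝ) / 3 =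
      BoseGas.spacing ρ ^ 3 * (c₀ * D) := by
    -- The `8` from `(4 g₀)^{3/2}` cancels that of `(2π)³`, leaving the coefficient `1 / (3π²)`.
    have h4 : (4 : ℝ) ^ (3 / 2 : ℝ) = 8 := by
      rw [show (4 : ℝ) = 2 ^ (2 : ℝ) by norm_num, ← Real.rpow_mul (by norm_num)]; norm_num
    rw [mul_left_comm, hqD, Real.mul_rpow (by norm_num) hg, h4, hc₀]
    field_simp
    ring
  rw [hlim, ← mul_sub, abs_mul, abs_of_pos hq0, ← hqD, mul_assoc (BoseGas.spacing ρ ^ 3) D] at hn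
  rw [← hqD, mul_assoc (BoseGas.spacing ρ ^ 3) D, mul_assoc (BoseGas.spacing ρ ^ 3)] at hsq
  have hn' := abs_le.1 (le_of_mul_le_mul_left hn hq0)
  have hsq' := le_of_mul_le_mul_left hsq hq0
  have eB : ∀ s : ℝ, BoseGas.boxVolume ρ * (BoseGas.rho0 V w ρ + s * ρ ^ (3 / 2 : ℝ)) =
      N - c₀ * D + s * D := by
    intro s; rw [BoseGas.rho0, hN, hD, hc₀]; ring
  have eB' : BoseGas.boxVolume ρ * (BoseGas.rho0 V w ρ - ε * ρ ^ (3 / 2 : ℝ)) =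
      N - c₀ * D - ε * D := by
    have := eB (-ε)
    rw [neg_mul, neg_mul, ← sub_eq_add_neg, ← sub_eq_add_neg] at this
    exact this
  -- The depletion is at most half of `N`. This keeps the lower end of the window nonnegative, so
  -- that it may be squared, and gives the window a slope of order `N`.
  have hhalf : c₀ * D + ε * D ≤ N / 2 := by
    have : (N : ℝ) * ((c₀ + ε) * ρ ^ (1 / 2 : ℝ)) ≤ N * (1 / 2) :=
      mul_le_mul_of_nonneg_left hsmall.le hNpos.le
    rw [hDN]; linarith
  have hn0 := BoseGas.excited_nonneg (V := V) (w := w) (ρ := ρ) (kc := kc) (N := N)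
  have hnN := BoseGas.excited_le_card hV hw hρ h1 hS (kc := kc) (N := N)
  have hvar := BoseGas.excited_sq_le hV hw hρ h1 hS (kc := kc) (N := N)
  rw [eB', eB ε, BoseGas.Q_zero_eq hV hw hρ h1 hS, BoseGas.Q_zero_zero_eq hV hw hρ h1 hS]
  have hεD : 0 < ε * D := mul_pos hε hD0
  have hcD : 0 ≤ c₀ * D := by positivity
  set n := BoseGas.excited V w ρ kc N
  refine ⟨BoseGas.hasSum_prob hV hw hρ h1 hS kc N, by linarith [hn'.2], by linarith [hn'.1],
    ?_, ?_⟩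
  · have : (N - c₀ * D - ε * D) ^ 2 ≤ ((N : ℝ) - n) ^ 2 :=
      pow_le_pow_left₀ (by linarith) (by linarith [hn'.2]) 2
    linarith [sub_sq (N : ℝ) n]
  -- Widening the window from `ε/2` to `ε` raises its square by at least `(N/2) ε D`, which is
  -- exactly the bound on the second moment.
  · have h2 : ((N : ℝ) - n) ^ 2 ≤ (N - c₀ * D + ε / 2 * D) ^ 2 :=
      pow_le_pow_left₀ (by linarith) (by linarith [hn'.1]) 2
    have h3 : (N / 2 : ℝ) * (ε * D) ≤ (N - c₀ * D + ε / 2 * D) * (ε * D) :=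
      mul_le_mul_of_nonneg_right (by linarith) hεD.le
    have h4 : (N - c₀ * D + ε * D) ^ 2 = (N - c₀ * D + ε / 2 * D) ^ 2 +
      (N - c₀ * D + ε / 2 * D) * (ε * D) + (ε / 2 * D) ^ 2 := by ring
    have h5 := sq_nonneg (ε / 2 * D)
    rw [h4]
    nlinarith [sq_nonneg n]
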